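/- Spaces are compactly generated, and products are taken in that category. An operad is a non-symmetric topological operad (with components in all degrees $n\ge 0$ and an identity in degree $1$); for $N\ge 0$ an $N$-truncated operad consists of the components of degrees $0,\dots,N$, with those partial compositions $x\circ_i y$ whose degrees are in the range, an identity if $N\ge 1$, and the usual associativity and unit laws. $\mathcal O|_N$ is the restriction of $\mathcal O$ to degrees $\le N$. A (truncated) operad $B$ is obtained from $A$ by a *free attachment of cells* if it is a pushout of $A\leftarrow \mathrm{Free}(\partial D)\to \mathrm{Free}(D)$, where $D$ is, in each degree, a disjoint union of discs (of any dimensions $\ge 0$), and $\partial D$ the union of their boundary spheres. The images in $B$ of the open discs are the *generating cells*. A (truncated) operad is *cellular cofibrant* if it is obtained from the initial one by a (possibly transfinite) sequence of free attachments of cells. A *cofibrant model* of $A$ is a cellular cofibrant $\widetilde A$ with a morphism $\widetilde A\to A$ that is a weak homotopy equivalence in every degree. Let $\mathcal Assoc$ be the operad that is a point in every degree $n\ge 0$. Let $\widetilde P(n)$, $n\ge 0$, be the space of planar rooted trees with $n$ leaves, root of valence $1$, inner vertices of any valence $\ge 1$, and a length in $[0,1]$ on every internal edge (the root edge and the leaf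 edges have no length), modulo: an edge of length $0$ is contracted; an inner vertex of valence $2$ is removed, and the two adjacent edges become one edge, whose length is the maximum of the two lengths if both were internal, and which otherwise has no length. It carries the quotient topology from the disjoint union of the cubes $[0,1]^{E(T)}$ over all planar trees $T$ with $n$ leaves, where $E(T)$ is the set of internal edges. Composition is grafting, the new internal edges having length $1$; the identity is the tree without inner vertices. In the following, trees are represented without edges of length $0$ and without vertices of valence $2$. A tree is *prime* if it is not the identity and has no edge of length $1$. Every tree that is not the identity is an operadic composition of prime trees (its prime components). For a prime tree let $u$ be the number of its univalent inner vertices, and $e$ the number of its leaves plus $u$. Let $\widetilde P_n\subset\widetilde P$ be the suboperad of the trees all of whose prime components have $e\le n$, and, for $n\ge 2$ and $0\le i\le n$, let $\widetilde P_{n-1,i}$ be the suboperad of the trees all of whose prime components have $e\le n-1$, or $e=n$ and $u\le i$. Then: (i) $\widetilde P$ is a cofibrant model of $\mathcal Assoc$. (ii) For every $n\ge 1$, $\widetilde P_n|_n$ is a cofibrant model of the $n$-truncated operad $\mathcal Assoc|_n$, and $\widetilde P_n(k)$ is contractible for all $k\le n$. Explicitly, $\widetilde P_0$ is the initial operad,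 $\widetilde P$ is the colimit of $\widetilde P_0\subset\widetilde P_1\subset\widetilde P_2\subset\cdots$ in the category of operads, $\widetilde P_1$ is obtained from $\widetilde P_0$ by the free attachment of one $0$-cell in degree $0$ (the tree with one univalent inner vertex and no leaf), and for every $n\ge 2$ one has $\widetilde P_{n-1}\subset\widetilde P_{n-1,0}\subset\widetilde P_{n-1,1}\subset\dots\subset\widetilde P_{n-1,n}=\widetilde P_n$, where the $i$-th of these terms, $0\le i\le n$, is obtained from the preceding one ($\widetilde P_{n-1}$ if $i=0$, $\widetilde P_{n-1,i-1}$ if $i\ge 1$) by the free attachment of $\binom ni$ cells of dimension $n-2+i$ in degree $n-i$; the union of these generating cells is the set of prime trees with $n-i$ leaves and $i$ univalent inner vertices. -/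

import Mathlib

open CategoryTheory Topology
open scoped unitInterval Topology.Homotopy

/-! ## Topological non-symmetric operads, possibly truncated -/

/-- The degrees of an `N`-truncated operad: the natural numbers `n ≤ N` (all of them if `N = ⊤`). -/
abbrev Color (N : ℕ∞) : Type := {n : ℕ // (n : ℕ∞) ≤ N}

/-- The natural number `n` as a degree of an untruncated operad. -/
abbrev deg (n : ℕ) : Color ⊤ := ⟨n, le_top⟩

/-- An `N`-truncated non-symmetric operad in compactly generated spaces; for `N = ⊤` this is a
non-symmetric operad. The structure is given by the partial compositions `x ∘_i y` (inputs are
numbered from `0`) of degree `n + m - 1`, whenever all three degrees are in the range, and by an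
identity element if the degree `1` is in the range.

The monoidal product is the compactly generated product: a map out of `X n × X m` is continuous
for it if and only if it is continuous along every pair of continuous maps from one compact
Hausdorff space to `X n` and to `X m`. This is the field `continuous_comp`. -/
structure TopOperad (N : ℕ∞) : Type 1 where
  X : Color N → Type
  [top : ∀ c, TopologicalSpace (X c)]
  [cg : ∀ c, CompactlyGeneratedSpace (X c)]
  /-- The partial composition `x ∘_i y`. -/
  comp : ∀ {n m k : Color N}, Fin n.1 → n.1 + m.1 = k.1 + 1 → X n → X m → X k
  /-- The identity element. -/
  one : ∀ h : ((1 : ℕ) : ℕ∞) ≤ N, X ⟨1, h⟩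
  continuous_comp : ∀ {n m k : Color N} (i : Fin n.1) (h : n.1 + m.1 = k.1 + 1)
    (K : Type) [TopologicalSpace K] [CompactSpace K] [T2Space K] (f : C(K, X n)) (g : C(K, X m)),
    Continuous fun t => (comp i h (f t) (g t) : X k)
  one_comp : ∀ {n : Color N} (h : ((1 : ℕ) : ℕ∞) ≤ N) (i : Fin 1) (e : 1 + n.1 = n.1 + 1) (x : X n),
    comp (n := ⟨1, h⟩) i e (one h) x = x
  comp_one : ∀ {n : Color N} (h : ((1 : ℕ) : ℕ∞) ≤ N) (i : Fin n.1) (e : n.1 + 1 = n.1 + 1)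
    (x : X n), comp (m := ⟨1, h⟩) i e x (one h) = x
  /-- `(x ∘_i y) ∘_{i+j} z = x ∘_i (y ∘_j z)`. -/
  assoc_seq : ∀ {n m l a b k : Color N} (i : Fin n.1) (j : Fin m.1) (i' : Fin a.1)
    (_ : i'.1 = i.1 + j.1) (h₁ : n.1 + m.1 = a.1 + 1) (h₂ : a.1 + l.1 = k.1 + 1)
    (h₃ : m.1 + l.1 = b.1 + 1) (h₄ : n.1 + b.1 = k.1 + 1) (x : X n) (y : X m) (z : X l),
    (comp i' h₂ (comp i h₁ x y : X a) z : X k) = comp i h₄ x (comp j h₃ y z : X b)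
  /-- `(x ∘_i y) ∘_{j+m-1} z = (x ∘_j z) ∘_i y` for `i < j`. -/
  assoc_par : ∀ {n m l a b k : Color N} (i j : Fin n.1) (_ : i < j) (j' : Fin a.1) (i' : Fin b.1)
    (_ : j'.1 + 1 = j.1 + m.1) (_ : i'.1 = i.1) (h₁ : n.1 + m.1 = a.1 + 1)
    (h₂ : a.1 + l.1 = k.1 + 1) (h₃ : n.1 + l.1 = b.1 + 1) (h₄ : b.1 + m.1 = k.1 + 1)
    (x : X n) (y : X m) (z : X l),
    (comp j' h₂ (comp i h₁ x y : X a) z : X k) = comp i' h₄ (comp j h₃ x z : X b) y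

namespace TopOperad

attribute [instance] TopOperad.top TopOperad.cg

variable {N : ℕ∞}

/-- A morphism of (truncated) operads: continuous maps in all degrees, compatible with the
partial compositions and the identity. -/
@[ext]
structure Hom (A B : TopOperad N) where
  app : ∀ c, C(A.X c, B.X c)
  map_comp : ∀ {n m k : Color N} (i : Fin n.1) (h : n.1 + m.1 = k.1 + 1) (x : A.X n) (y : A.X m),
    app k (A.comp i h x y) = B.comp i h (app n x) (app m y)
  map_one : ∀ h : ((1 : ℕ) : ℕ∞) ≤ N, app _ (A.one h) = B.one h

instance : Category (TopOperad N) where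
  Hom A B := Hom A B
  id A := { app := fun _ => ContinuousMap.id _, map_comp := fun _ _ _ _ => rfl
            map_one := fun _ => rfl }
  comp f g :=
    { app := fun c => (g.app c).comp (f.app c)
      map_comp := fun i h x y => by simp [f.map_comp, g.map_comp]
      map_one := fun h => by simp [f.map_one, g.map_one] }

/-- The restriction of an `N`-truncated operad to its degrees `≤ M`, for `M ≤ N`. -/
def truncate (O : TopOperad N) (M : ℕ∞) (hM : M ≤ N) : TopOperad M where
  X c := O.X ⟨c.1, c.2.trans hM⟩
  comp i h x y := O.comp i h x y
  one h := O.one (h.trans hM)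
  continuous_comp i h K _ _ _ f g := O.continuous_comp i h K f g
  one_comp h i e x := O.one_comp (h.trans hM) i e x
  comp_one h i e x := O.comp_one (h.trans hM) i e x
  assoc_seq {_ _ _ a b _} i j i' hi h₁ h₂ h₃ h₄ x y z :=
    O.assoc_seq (a := ⟨a.1, a.2.trans hM⟩) (b := ⟨b.1, b.2.trans hM⟩) i j i' hi
      h₁ h₂ h₃ h₄ x y z
  assoc_par {_ _ _ a b _} i j hij j' i' hj hi h₁ h₂ h₃ h₄ x y z :=
    O.assoc_par (a := ⟨a.1, a.2.trans hM⟩) (b := ⟨b.1, b.2.trans hM⟩) i j hij j' i' hj hi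
      h₁ h₂ h₃ h₄ x y z

/-- The operad of unital associative monoids: one point in every degree `n ≥ 0`. -/
def assoc (N : ℕ∞) : TopOperad N where
  X _ := Unit
  comp _ _ _ _ := ()
  one _ := ()
  continuous_comp _ _ _ _ _ _ _ _ := continuous_const
  one_comp _ _ _ _ := rfl
  comp_one _ _ _ _ := rfl
  assoc_seq _ _ _ _ _ _ _ _ _ _ _ := rfl
  assoc_par _ _ _ _ _ _ _ _ _ _ _ _ _ _ := rfl

/-! ### Suboperads -/

/-- The elements of the suboperad generated by a family of sets `G`. -/
inductive Generated (O : TopOperad N) (G : ∀ c, Set (O.X c)) : ∀ c, O.X c → Prop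
  | of {c : Color N} (x : O.X c) (hx : x ∈ G c) : Generated O G c x
  | one (h : ((1 : ℕ) : ℕ∞) ≤ N) : Generated O G _ (O.one h)
  | comp {n m k : Color N} (i : Fin n.1) (h : n.1 + m.1 = k.1 + 1) (x : O.X n) (y : O.X m)
      (hx : Generated O G n x) (hy : Generated O G m y) : Generated O G k (O.comp i h x y)

/-- The underlying space in degree `c` of the suboperad generated by `G`. -/
def GeneratedCarrier (O : TopOperad N) (G : ∀ c, Set (O.X c)) (c : Color N) : Type :=
  {x : O.X c // Generated O G c x}

namespace GeneratedCarrier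

variable {O : TopOperad N} {G : ∀ c, Set (O.X c)} {c : Color N}

/-- An element of the suboperad, as an element of the operad. -/
def val (x : GeneratedCarrier O G c) : O.X c := Subtype.val x

lemma property (x : GeneratedCarrier O G c) : Generated O G c x.val := Subtype.property x

/-- An element of the operad that belongs to the suboperad. -/
def mk (x : O.X c) (hx : Generated O G c x) : GeneratedCarrier O G c := ⟨x, hx⟩

lemma ext {x y : GeneratedCarrier O G c} (h : x.val = y.val) : x = y := Subtype.ext h

/-- The topology of a suboperad is the subspace topology in the category of compactly generated
spaces, that is, the compactly generated topology associated with the induced topology. -/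
instance : TopologicalSpace (GeneratedCarrier O G c) :=
  @TopologicalSpace.compactlyGenerated.{0} {x : O.X c // Generated O G c x} inferInstance

lemma continuous_val : Continuous (val : GeneratedCarrier O G c → O.X c) :=
  continuous_from_compactlyGenerated.{0} (X := {x : O.X c // Generated O G c x}) Subtype.val
    fun _ g => continuous_subtype_val.comp g.2

lemma continuous_mk (K : Type) [TopologicalSpace K] [CompactSpace K] [T2Space K] (f : K → O.X c)
    (hf : Continuous f) (h : ∀ t, Generated O G c (f t)) :
    Continuous (fun t => (mk (f t) (h t) : GeneratedCarrier O G c)) := by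
  let T := Σ i : ((S : CompHaus.{0}) × C(S, {x : O.X c // Generated O G c x})), i.fst
  let q : T → GeneratedCarrier O G c := fun s => s.1.2 s.2
  have hq : Continuous q := continuous_coinduced_rng
  let g : C(CompHaus.of K, {x : O.X c // Generated O G c x}) :=
    ⟨fun t => ⟨f t, h t⟩, hf.subtype_mk h⟩
  let s : K → T := fun t => ⟨⟨CompHaus.of K, g⟩, t⟩
  have hs : Continuous s :=
    @continuous_sigmaMk ((S : CompHaus.{0}) × C(S, {x : O.X c // Generated O G c x}))
      (fun i => i.fst) _ ⟨CompHaus.of K, g⟩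
  exact hq.comp hs

instance : CompactlyGeneratedSpace (GeneratedCarrier O G c) := by
  apply compactlyGeneratedSpace_of_continuous_maps
  intro Y _ f hf
  refine continuous_from_compactlyGenerated.{0} (X := {x : O.X c // Generated O G c x}) f ?_
  intro S g
  exact hf S _ (continuous_mk S (fun t => (g t).1)
    (continuous_subtype_val.comp g.2) (fun t => (g t).2))

end GeneratedCarrier

/-- The suboperad of `O` generated by the elements in `G`. -/
def generated (O : TopOperad N) (G : ∀ c, Set (O.X c)) : TopOperad N where
  X := GeneratedCarrier O G
  comp i h x y := .mk (O.comp i h x.val y.val) (.comp i h _ _ x.property y.property)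
  one h := .mk (O.one h) (.one h)
  continuous_comp i h K _ _ _ f g := GeneratedCarrier.continuous_mk K _
    (O.continuous_comp i h K ⟨_, GeneratedCarrier.continuous_val.comp f.2⟩
      ⟨_, GeneratedCarrier.continuous_val.comp g.2⟩) _
  one_comp h i e x := GeneratedCarrier.ext (O.one_comp h i e x.val)
  comp_one h i e x := GeneratedCarrier.ext (O.comp_one h i e x.val)
  assoc_seq i j i' hi h₁ h₂ h₃ h₄ x y z :=
    GeneratedCarrier.ext (O.assoc_seq i j i' hi h₁ h₂ h₃ h₄ x.val y.val z.val)
  assoc_par i j hij j' i' hj hi h₁ h₂ h₃ h₄ x y z :=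
    GeneratedCarrier.ext (O.assoc_par i j hij j' i' hj hi h₁ h₂ h₃ h₄ x.val y.val z.val)

/-- The inclusion of a generated suboperad. -/
def generatedι (O : TopOperad N) (G : ∀ c, Set (O.X c)) : O.generated G ⟶ O :=
  (show Hom (O.generated G) O from
  { app := fun _ => ⟨GeneratedCarrier.val, GeneratedCarrier.continuous_val⟩
    map_comp := fun _ _ _ _ => rfl
    map_one := fun _ => rfl })

lemma Generated.mono {O : TopOperad N} {G G' : ∀ c, Set (O.X c)} (h : ∀ c, G c ⊆ G' c)
    {c : Color N} {x : O.X c} (hx : Generated O G c x) : Generated O G' c x := by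
  induction hx with
  | of x hx => exact .of x (h _ hx)
  | one h => exact .one h
  | comp i h x y _ _ ihx ihy => exact .comp i h x y ihx ihy

lemma continuous_generatedIncl {O : TopOperad N} {G G' : ∀ c, Set (O.X c)} (h : ∀ c, G c ⊆ G' c)
    (c : Color N) : Continuous fun x : GeneratedCarrier O G c =>
      (.mk x.val (x.property.mono h) : GeneratedCarrier O G' c) :=
  continuous_from_uCompactlyGeneratedSpace.{0} _ fun S g => GeneratedCarrier.continuous_mk S
    (fun t => (g t).val) (GeneratedCarrier.continuous_val.comp g.2) _

/-- The inclusion between two generated suboperads. -/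
def generatedIncl (O : TopOperad N) {G G' : ∀ c, Set (O.X c)} (h : ∀ c, G c ⊆ G' c) :
    O.generated G ⟶ O.generated G' :=
  (show Hom (O.generated G) (O.generated G') from
  { app := fun _ => ⟨_, continuous_generatedIncl h _⟩
    map_comp := fun _ _ _ _ => rfl
    map_one := fun _ => rfl })

/-! ### Cell attachments, cofibrant operads, cofibrant models -/

/-- The closed unit disc of dimension `d`. -/
abbrev Disc (d : ℕ) : Type := Metric.closedBall (0 : EuclideanSpace ℝ (Fin d)) 1

/-- The boundary sphere of the disc of dimension `d` (empty for `d = 0`). -/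
abbrev DiscBoundary (d : ℕ) : Type := {p : Disc d // ‖p.1‖ = 1}

/-- `f : A ⟶ B` is a free attachment of discs: `j : ι` indexes a disc of dimension `dim j` that is
attached in degree `col j`. The field `exists_unique` is the universal property of the pushout, in
the category of (truncated) operads, of `A ← Free(∂D) → Free(D)`: morphisms out of the free operad
on a collection of spaces are families of continuous maps out of that collection. -/
structure CellAttachment {A B : TopOperad N} (f : A ⟶ B) (ι : Type) (col : ι → Color N)
    (dim : ι → ℕ) where
  /-- The attaching maps. -/
  attach : ∀ j, C(DiscBoundary (dim j), A.X (col j))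
  /-- The characteristic maps. -/
  char : ∀ j, C(Disc (dim j), B.X (col j))
  comm : ∀ j (p : DiscBoundary (dim j)), char j p.1 = Hom.app f (col j) (attach j p)
  exists_unique : ∀ (C : TopOperad N) (g : A ⟶ C) (φ : ∀ j, C(Disc (dim j), C.X (col j))),
    (∀ j (p : DiscBoundary (dim j)), φ j p.1 = Hom.app g (col j) (attach j p)) →
    ∃! h : B ⟶ C, f ≫ h = g ∧ ∀ j p, Hom.app h (col j) (char j p) = φ j p

/-- The union of the (open) generating cells of an attachment, in degree `c`. -/
def CellAttachment.openCells {A B : TopOperad N} {f : A ⟶ B} {ι : Type} {c : Color N}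
    {dim : ι → ℕ} (a : CellAttachment f ι (fun _ => c) dim) : Set (B.X c) :=
  {x | ∃ (j : ι) (p : Disc (dim j)), ‖p.1‖ < 1 ∧ a.char j p = x}

/-- The class of morphisms that are free attachments of some (possibly infinite) family of discs of
arbitrary dimensions and degrees. -/
def freeAttachments (N : ℕ∞) : MorphismProperty (TopOperad N) := fun _ _ f =>
  ∃ (ι : Type) (col : ι → Color N) (dim : ι → ℕ), Nonempty (CellAttachment f ι col dim)

/-- `O` is cellular cofibrant: it is obtained from the initial operad by a transfinite sequence of
free attachments of discs. -/
def IsCofibrant (O : TopOperad N) : Prop :=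
  ∃ (E : TopOperad N) (hE : Limits.IsInitial E),
    MorphismProperty.transfiniteCompositions.{0} (freeAttachments N) (hE.to O)

end TopOperad

/-- The map of homotopy groups (of pointed sets for `n = 0`) induced by a continuous map. -/
def homotopyGroupMap {X Y : Type} [TopologicalSpace X] [TopologicalSpace Y] (f : C(X, Y)) (n : ℕ)
    (x : X) : HomotopyGroup (Fin n) X x → HomotopyGroup (Fin n) Y (f x) :=
  Quotient.map (fun γ => (⟨f.comp γ.1, fun t ht => congrArg f (γ.2 t ht)⟩ : GenLoop (Fin n) Y (f x)))
    fun _ _ h => ContinuousMap.HomotopicRel.comp_continuousMap h f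

/-- A weak homotopy equivalence: a continuous map that induces a bijection of the sets of path
components and of all homotopy groups at all base points. -/
def IsWeakEquivalence {X Y : Type} [TopologicalSpace X] [TopologicalSpace Y] (f : C(X, Y)) : Prop :=
  Function.Bijective (Quotient.map f fun _ _ h => h.map f.continuous :
      ZerothHomotopy X → ZerothHomotopy Y) ∧
    ∀ (n : ℕ) (x : X), Function.Bijective (homotopyGroupMap f n x)

/-- `P` is a cofibrant model of `A`: it is cellular cofibrant and has a morphism to `A` that is a
weak equivalence in every degree. -/
def TopOperad.IsCofibrantModel {N : ℕ∞} (P A : TopOperad N) : Prop :=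
  P.IsCofibrant ∧ ∃ f : P ⟶ A, ∀ c, IsWeakEquivalence (TopOperad.Hom.app f c)

/-! ## Planar metric trees -/

/-- A planar forest whose internal edges carry labels in `L`, read from left to right: it lists the
things that sit on top of a vertex. Either there is nothing (left) (`nil`), or the first one is a
leaf (`leaf`), or it is an internal vertex, connected by an edge of label `ℓ` and carrying
the forest `A` (`node ℓ A B`); in the last two cases `B` is the rest of the list. -/
inductive PlanarForest (L : Type) : Type
  | nil : PlanarForest L
  | leaf (B : PlanarForest L) : PlanarForest L
  | node (ℓ : L) (A B : PlanarForest L) : PlanarForest L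

/-- A planar rooted tree with a root of valence `1`: the tree without internal vertices, with one
leaf (`triv`), or a vertex next to the root, that carries a forest. Neither the root edge nor the
leaf edges are labelled. -/
inductive PlanarTree (L : Type) : Type
  | triv : PlanarTree L
  | vertex (F : PlanarForest L) : PlanarTree L

namespace PlanarForest

variable {L : Type}

/-- The number of leaves. -/
def leaves : PlanarForest L → ℕ
  | nil => 0
  | leaf B => B.leaves + 1
  | node _ A B => A.leaves + B.leaves

/-- The number of trees in the forest, which is the number of edges that go up from the vertex
that carries it. -/
def arity : PlanarForest L → ℕ
  | nil => 0
  | leaf B => B.arity + 1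
  | node _ _ B => B.arity + 1

/-- The number of internal vertices of valence `1` (no outgoing edge), not counting the vertex that
carries the forest. -/
def univalent : PlanarForest L → ℕ
  | nil => 0
  | leaf B => B.univalent
  | node _ A B => (if A.arity = 0 then 1 else 0) + A.univalent + B.univalent

/-- Juxtaposition of forests. -/
def append : PlanarForest L → PlanarForest L → PlanarForest L
  | nil, G => G
  | leaf B, G => leaf (B.append G)
  | node ℓ A B, G => node ℓ A (B.append G)

/-- The forest obtained by grafting, with an edge of length `1`, a vertex that carries `G` to the
`i`-th leaf (counted from `0`). -/
def graft : PlanarForest I → ℕ → PlanarForest I → PlanarForest I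
  | nil, _, _ => nil
  | leaf B, 0, G => node 1 G B
  | leaf B, i + 1, G => leaf (B.graft i G)
  | node ℓ A B, i, G =>
    if i < A.leaves then node ℓ (A.graft i G) B else node ℓ A (B.graft (i - A.leaves) G)

/-- The elementary identifications of metric trees, away from the vertex next to the root:
contraction of an edge of length `0`; removal of a bivalent vertex whose outgoing edge is a leaf
edge, or is an internal edge (then the new edge has the maximum of the two lengths). -/
inductive Step : PlanarForest I → PlanarForest I → Prop
  | contract (A B) : Step (node 0 A B) (A.append B)
  | unary_leaf (ℓ B) : Step (node ℓ (leaf nil) B) (leaf B)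
  | unary_node (ℓ ℓ' A B) : Step (node ℓ (node ℓ' A nil) B) (node (max ℓ ℓ') A B)
  | leaf {B B'} : Step B B' → Step (leaf B) (leaf B')
  | node_left (ℓ) {A A'} (B) : Step A A' → Step (node ℓ A B) (node ℓ A' B)
  | node_right (ℓ) (A) {B B'} : Step B B' → Step (node ℓ A B) (node ℓ A B')

/-- All internal edges have length in `(0, 1)`, and no internal vertex (the one carrying the
forest not being considered) is bivalent. -/
def Prime : PlanarForest I → Prop
  | nil => True
  | leaf B => B.Prime
  | node ℓ A B => 0 < ℓ ∧ ℓ < 1 ∧ A.arity ≠ 1 ∧ A.Prime ∧ B.Prime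

/-- The cube of all families of edge lengths on a given shape, a copy of `[0,1]^E` where `E` is the
set of internal edges. -/
def Cube : PlanarForest Unit → Type
  | nil => Unit
  | leaf B => B.Cube
  | node _ A B => I × A.Cube × B.Cube

instance instTopCube : ∀ s : PlanarForest Unit, TopologicalSpace s.Cube
  | nil => inferInstanceAs (TopologicalSpace Unit)
  | leaf B => instTopCube B
  | node _ A B =>
    letI := instTopCube A
    letI := instTopCube B
    inferInstanceAs (TopologicalSpace (I × A.Cube × B.Cube))

/-- The metric forest with given shape and edge lengths. -/
def fill : ∀ s : PlanarForest Unit, s.Cube → PlanarForest I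
  | nil, _ => nil
  | leaf B, c => leaf (fill B c)
  | node _ A B, c => node c.1 (fill A c.2.1) (fill B c.2.2)

instance instCompactCube : ∀ s : PlanarForest Unit, CompactSpace s.Cube
  | nil => inferInstanceAs (CompactSpace Unit)
  | leaf B => instCompactCube B
  | node _ A B =>
    haveI := instCompactCube A
    haveI := instCompactCube B
    inferInstanceAs (CompactSpace (I × A.Cube × B.Cube))

instance instT2Cube : ∀ s : PlanarForest Unit, T2Space s.Cube
  | nil => inferInstanceAs (T2Space Unit)
  | leaf B => instT2Cube B
  | node _ A B =>
    haveI := instT2Cube A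
    haveI := instT2Cube B
    inferInstanceAs (T2Space (I × A.Cube × B.Cube))

lemma leaves_fill : ∀ (s : PlanarForest Unit) (c : s.Cube), (fill s c).leaves = s.leaves
  | nil, _ => rfl
  | leaf B, c => by simp [fill, leaves, leaves_fill B c]
  | node _ A B, c => by simp [fill, leaves, leaves_fill A, leaves_fill B]

lemma exists_fill : ∀ F : PlanarForest I, ∃ (s : PlanarForest Unit) (c : s.Cube), fill s c = F
  | nil => ⟨nil, (), rfl⟩
  | leaf B => by
    obtain ⟨s, c, h⟩ := exists_fill B
    exact ⟨leaf s, c, by simp [fill, h]⟩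
  | node ℓ A B => by
    obtain ⟨s, c, h⟩ := exists_fill A
    obtain ⟨s', c', h'⟩ := exists_fill B
    exact ⟨node () s s', (ℓ, c, c'), by simp [fill, h, h']⟩

lemma leaves_append (A B : PlanarForest L) : (A.append B).leaves = A.leaves + B.leaves := by
  induction A with
  | nil => simp [append, leaves]
  | leaf A ih => simp [append, leaves, ih]; omega
  | node ℓ A A' _ ih => simp [append, leaves, ih]; omega

lemma leaves_graft (F G : PlanarForest I) (i : ℕ) (hi : i < F.leaves) :
    (F.graft i G).leaves + 1 = F.leaves + G.leaves := by
  induction F generalizing i with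
  | nil => simp [leaves] at hi
  | leaf B ih =>
    cases i with
    | zero => simp [graft, leaves]; omega
    | succ i =>
      simp only [leaves] at hi
      have := ih i (by omega)
      simp [graft, leaves]; omega
  | node ℓ A B ihA ihB =>
    simp only [leaves] at hi
    simp only [graft]
    split_ifs with h
    · have := ihA i h
      simp only [leaves]; omega
    · have := ihB (i - A.leaves) (by omega)
      simp only [leaves]; omega

lemma append_graft (A B G : PlanarForest I) (i : ℕ) :
    (A.append B).graft i G =
      if i < A.leaves then (A.graft i G).append B else A.append (B.graft (i - A.leaves) G) := by
  induction A generalizing i with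
  | nil => simp [append, leaves]
  | leaf A ih =>
    cases i with
    | zero => simp [append, graft, leaves]
    | succ i =>
      simp only [append, graft, leaves, ih, Nat.add_lt_add_iff_right, Nat.add_sub_add_right]
      split_ifs <;> rfl
  | node ℓ A A' _ ih =>
    simp only [append, graft, leaves, ih]
    by_cases h : i < A.leaves
    · have : i < A.leaves + A'.leaves := by omega
      simp [h, this, append]
    · by_cases h' : i < A.leaves + A'.leaves
      · have : i - A.leaves < A'.leaves := by omega
        simp [h, h', this, append]
      · have : ¬ i - A.leaves < A'.leaves := by omega
        simp [h, h', this, Nat.sub_add_eq]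

lemma leaves_step {F F' : PlanarForest I} (h : Step F F') : F.leaves = F'.leaves := by
  induction h with
  | contract A B => simp [leaves, leaves_append]
  | unary_leaf ℓ B => simp [leaves]; omega
  | unary_node ℓ ℓ' A B => simp [leaves]
  | leaf h ih => simp [leaves, ih]
  | node_left ℓ B h ih => simp [leaves, ih]
  | node_right ℓ A h ih => simp [leaves, ih]

lemma graft_step_left {F F' : PlanarForest I} (h : Step F F') (G : PlanarForest I) (i : ℕ)
    (hi : i < F.leaves) : Step (F.graft i G) (F'.graft i G) := by
  induction h generalizing i with
  | contract A B =>
    rw [append_graft]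
    simp only [graft]
    split_ifs
    · exact .contract _ _
    · exact .contract _ _
  | unary_leaf ℓ B =>
    cases i with
    | zero =>
      simp only [graft, leaves]
      have h : max ℓ (1 : I) = 1 := max_eq_right (unitInterval.le_one ℓ)
      simpa [h] using Step.unary_node ℓ 1 G B
    | succ i => simpa [graft, leaves] using Step.unary_leaf ℓ (B.graft i G)
  | unary_node ℓ ℓ' A B =>
    simp only [graft, leaves, add_zero]
    split_ifs <;> exact .unary_node _ _ _ _
  | leaf h ih =>
    cases i with
    | zero => exact .node_right _ _ h
    | succ i => exact .leaf (ih i (by simp only [leaves] at hi; omega))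
  | node_left ℓ B h ih =>
    simp only [graft, leaves] at hi ⊢
    rw [← leaves_step h]
    split_ifs with h'
    · exact .node_left _ _ (ih _ h')
    · exact .node_left _ _ h
  | node_right ℓ A h ih =>
    simp only [graft, leaves] at hi ⊢
    split_ifs with h'
    · exact .node_right _ _ h
    · exact .node_right _ _ (ih _ (by omega))

lemma graft_step_right (F : PlanarForest I) {G G' : PlanarForest I} (h : Step G G') (i : ℕ)
    (hi : i < F.leaves) : Step (F.graft i G) (F.graft i G') := by
  induction F generalizing i with
  | nil => simp [leaves] at hi
  | leaf B ih =>
    cases i with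
    | zero => exact .node_left _ _ h
    | succ i => exact .leaf (ih i (by simp only [leaves] at hi; omega))
  | node ℓ A B ihA ihB =>
    simp only [graft, leaves] at hi ⊢
    split_ifs with h'
    · exact .node_left _ _ (ihA _ h')
    · exact .node_right _ _ (ihB _ (by omega))

lemma graft_unary_leaf (F : PlanarForest I) (i : ℕ) (hi : i < F.leaves) :
    Step (F.graft i (leaf nil)) F := by
  induction F generalizing i with
  | nil => simp [leaves] at hi
  | leaf B ih =>
    cases i with
    | zero => exact .unary_leaf _ _
    | succ i => exact .leaf (ih i (by simp only [leaves] at hi; omega))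
  | node ℓ A B ihA ihB =>
    simp only [graft, leaves] at hi ⊢
    split_ifs with h'
    · exact .node_left _ _ (ihA _ h')
    · exact .node_right _ _ (ihB _ (by omega))

lemma graft_unary_node (F : PlanarForest I) (ℓ : I) (A : PlanarForest I) (i : ℕ)
    (hi : i < F.leaves) : Step (F.graft i (node ℓ A nil)) (F.graft i A) := by
  induction F generalizing i with
  | nil => simp [leaves] at hi
  | leaf B ih =>
    cases i with
    | zero =>
      have h : max 1 ℓ = (1 : I) := max_eq_left (unitInterval.le_one ℓ)
      simpa [graft, h] using Step.unary_node 1 ℓ A B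
    | succ i => exact .leaf (ih i (by simp only [leaves] at hi; omega))
  | node ℓ A B ihA ihB =>
    simp only [graft, leaves] at hi ⊢
    split_ifs with h'
    · exact .node_left _ _ (ihA _ h')
    · exact .node_right _ _ (ihB _ (by omega))

lemma graft_seq (F G H : PlanarForest I) (i j : ℕ) (hi : i < F.leaves) (hj : j < G.leaves) :
    (F.graft i G).graft (i + j) H = F.graft i (G.graft j H) := by
  induction F generalizing i with
  | nil => simp [leaves] at hi
  | leaf B ih =>
    cases i with
    | zero => simp [graft, hj]
    | succ i =>
      simp only [leaves] at hi
      rw [show i + 1 + j = (i + j) + 1 by omega]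
      simp [graft, ih i (by omega)]
  | node ℓ A B ihA ihB =>
    simp only [leaves] at hi
    by_cases h : i < A.leaves
    · have h1 := leaves_graft A G i h
      have h2 : i + j < (A.graft i G).leaves := by omega
      simp [graft, h, h2, ihA i h]
    · have h2 : ¬ i + j < A.leaves := by omega
      simp [graft, h, h2, show i + j - A.leaves = (i - A.leaves) + j by omega,
        ihB (i - A.leaves) (by omega)]

lemma graft_par (F G H : PlanarForest I) (i j j' : ℕ) (hij : i < j) (hj : j < F.leaves)
    (hj' : j' + 1 = j + G.leaves) :
    (F.graft i G).graft j' H = (F.graft j H).graft i G := by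
  induction F generalizing i j j' with
  | nil => simp [leaves] at hj
  | leaf B ih =>
    simp only [leaves] at hj
    obtain ⟨j, rfl⟩ : ∃ k, j = k + 1 := ⟨j - 1, by omega⟩
    cases i with
    | zero =>
      have h1 : ¬ j' < G.leaves := by omega
      simp [graft, h1, show j' - G.leaves = j by omega]
    | succ i =>
      obtain ⟨j', rfl⟩ : ∃ k, j' = k + 1 := ⟨j' - 1, by omega⟩
      simp [graft, ih i j j' (by omega) (by omega) (by omega)]
  | node ℓ A B ihA ihB =>
    simp only [leaves] at hj
    by_cases h : i < A.leaves
    · have h1 := leaves_graft A G i h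
      by_cases h' : j < A.leaves
      · have h2 := leaves_graft A H j h'
        have h3 : j' < (A.graft i G).leaves := by omega
        have h4 : i < (A.graft j H).leaves := by omega
        simp [graft, h, h', h3, h4, ihA i j j' hij h' hj']
      · have h3 : ¬ j' < (A.graft i G).leaves := by omega
        simp [graft, h, h', h3, show j' - (A.graft i G).leaves = j - A.leaves by omega]
    · have h' : ¬ j < A.leaves := by omega
      have h3 : ¬ j' < A.leaves := by omega
      simp [graft, h, h', h3,
        ihB (i - A.leaves) (j - A.leaves) (j' - A.leaves) (by omega) (by omega) (by omega)]

lemma exists_graft_cube (s t : PlanarForest Unit) (i : ℕ) (hi : i < s.leaves) :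
    ∃ (u : PlanarForest Unit) (g : s.Cube × t.Cube → u.Cube), Continuous g ∧
      u.leaves + 1 = s.leaves + t.leaves ∧
      ∀ p, fill u (g p) = (fill s p.1).graft i (fill t p.2) := by
  induction s generalizing i with
  | nil => simp [leaves] at hi
  | leaf B ih =>
    cases i with
    | zero =>
      refine ⟨node () t B, fun p => (1, p.2, p.1), ?_, ?_, fun p => rfl⟩
      · exact continuous_const.prodMk (continuous_snd.prodMk continuous_fst)
      · simp only [leaves]; omega
    | succ i =>
      simp only [leaves] at hi
      obtain ⟨u, g, hg, hu, h⟩ := ih i (by omega)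
      refine ⟨leaf u, g, hg, ?_, fun p => ?_⟩
      · simp only [leaves]; omega
      · exact congrArg leaf (h p)
  | node ℓ A B ihA ihB =>
    simp only [leaves] at hi
    by_cases hA : i < A.leaves
    · obtain ⟨u, g, hg, hu, h⟩ := ihA i hA
      refine ⟨node () u B, fun p => (p.1.1, g (p.1.2.1, p.2), p.1.2.2), ?_, ?_, fun p => ?_⟩
      · have h1 : Continuous fun p : (I × A.Cube × B.Cube) × t.Cube =>
            (p.1.1, g (p.1.2.1, p.2), p.1.2.2) := by fun_prop
        exact h1
      · simp only [leaves]; omega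
      · simp [fill, graft, leaves_fill, hA, h]
    · obtain ⟨u, g, hg, hu, h⟩ := ihB (i - A.leaves) (by omega)
      refine ⟨node () A u, fun p => (p.1.1, p.1.2.1, g (p.1.2.2, p.2)), ?_, ?_, fun p => ?_⟩
      · have h1 : Continuous fun p : (I × A.Cube × B.Cube) × t.Cube =>
            (p.1.1, p.1.2.1, g (p.1.2.2, p.2)) := by fun_prop
        exact h1
      · simp only [leaves]; omega
      · simp [fill, graft, leaves_fill, hA, h]

end PlanarForest

namespace PlanarTree

variable {L : Type}

/-- The number of leaves. -/
def leaves : PlanarTree L → ℕ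
  | triv => 1
  | vertex F => F.leaves

/-- The number of internal vertices of valence `1`. -/
def univalent : PlanarTree L → ℕ
  | triv => 0
  | vertex F => (if F.arity = 0 then 1 else 0) + F.univalent

/-- Grafting of the tree `T'` to the `i`-th leaf of `T` (counted from `0`); the new internal edge,
if there is one, has length `1`. -/
def graft : PlanarTree I → ℕ → PlanarTree I → PlanarTree I
  | triv, _, T' => T'
  | vertex F, _, triv => vertex F
  | vertex F, i, vertex G => vertex (F.graft i G)

/-- The elementary identifications of metric trees: those away from the vertex next to the root,
and removal of the vertex next to the root if it is bivalent. -/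
inductive Step : PlanarTree I → PlanarTree I → Prop
  | vertex {F F'} : PlanarForest.Step F F' → Step (vertex F) (vertex F')
  | unary_leaf : Step (vertex (.leaf .nil)) triv
  | unary_node (ℓ A) : Step (vertex (.node ℓ A .nil)) (vertex A)

/-- The tree has at least one internal vertex, all its internal edges have length in `(0, 1)`, and
none of its internal vertices is bivalent. -/
def Prime : PlanarTree I → Prop
  | triv => False
  | vertex F => F.arity ≠ 1 ∧ F.Prime

/-- The cube of all families of edge lengths on a given shape. -/
def Cube : PlanarTree Unit → Type
  | triv => Unit
  | vertex F => F.Cube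

instance : ∀ s : PlanarTree Unit, TopologicalSpace s.Cube
  | triv => inferInstanceAs (TopologicalSpace Unit)
  | vertex F => inferInstanceAs (TopologicalSpace F.Cube)

instance : ∀ s : PlanarTree Unit, CompactSpace s.Cube
  | triv => inferInstanceAs (CompactSpace Unit)
  | vertex F => inferInstanceAs (CompactSpace F.Cube)

instance : ∀ s : PlanarTree Unit, T2Space s.Cube
  | triv => inferInstanceAs (T2Space Unit)
  | vertex F => inferInstanceAs (T2Space F.Cube)

/-- The metric tree with given shape and edge lengths. -/
def fill : ∀ s : PlanarTree Unit, s.Cube → PlanarTree I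
  | triv, _ => triv
  | vertex F, c => vertex (F.fill c)

lemma leaves_fill : ∀ (s : PlanarTree Unit) (c : s.Cube), (fill s c).leaves = s.leaves
  | triv, _ => rfl
  | vertex F, c => F.leaves_fill c

lemma exists_fill : ∀ T : PlanarTree I, ∃ (s : PlanarTree Unit) (c : s.Cube), fill s c = T
  | triv => ⟨triv, (), rfl⟩
  | vertex F => by
    obtain ⟨s, c, h⟩ := F.exists_fill
    exact ⟨vertex s, c, congrArg vertex h⟩

lemma leaves_graft (T T' : PlanarTree I) (i : ℕ) (hi : i < T.leaves) :
    (T.graft i T').leaves + 1 = T.leaves + T'.leaves := by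
  cases T with
  | triv => simp only [graft, leaves]; omega
  | vertex F =>
    cases T' with
    | triv => rfl
    | vertex G => exact F.leaves_graft G i hi

lemma graft_step_left {T T₁ : PlanarTree I} (h : Step T T₁) (T' : PlanarTree I) (i : ℕ)
    (hi : i < T.leaves) : Step (T.graft i T') (T₁.graft i T') := by
  cases T' with
  | triv =>
    cases h with
    | vertex h => exact .vertex h
    | unary_leaf => exact .unary_leaf
    | unary_node ℓ A => exact .unary_node ℓ A
  | vertex G =>
    cases h with
    | vertex h => exact .vertex (PlanarForest.graft_step_left h G i hi)
    | unary_leaf =>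
      obtain rfl : i = 0 := by simp only [leaves, PlanarForest.leaves] at hi; omega
      exact .unary_node 1 G
    | unary_node ℓ A =>
      have h : i < A.leaves := by simpa [leaves, PlanarForest.leaves] using hi
      simpa [graft, PlanarForest.graft, h] using Step.unary_node ℓ (A.graft i G)

lemma graft_step_right (T : PlanarTree I) {T' T₁ : PlanarTree I} (h : Step T' T₁) (i : ℕ)
    (hi : i < T.leaves) : Step (T.graft i T') (T.graft i T₁) := by
  cases T with
  | triv => exact h
  | vertex F =>
    cases h with
    | vertex h => exact .vertex (F.graft_step_right h i hi)
    | unary_leaf => exact .vertex (F.graft_unary_leaf i hi)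
    | unary_node ℓ A => exact .vertex (F.graft_unary_node ℓ A i hi)

lemma graft_triv (T : PlanarTree I) (i : ℕ) : T.graft i triv = T := by
  cases T <;> rfl

lemma graft_seq (T T' T'' : PlanarTree I) (i j : ℕ) (hi : i < T.leaves) (hj : j < T'.leaves) :
    (T.graft i T').graft (i + j) T'' = T.graft i (T'.graft j T'') := by
  cases T with
  | triv =>
    obtain rfl : i = 0 := by simp only [leaves] at hi; omega
    simp [graft]
  | vertex F =>
    cases T' with
    | triv =>
      obtain rfl : j = 0 := by simp only [leaves] at hj; omega
      rfl
    | vertex G =>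
      cases T'' with
      | triv => rfl
      | vertex H => exact congrArg vertex (F.graft_seq G H i j hi hj)

lemma graft_par (T T' T'' : PlanarTree I) (i j j' : ℕ) (hij : i < j) (hj : j < T.leaves)
    (hj' : j' + 1 = j + T'.leaves) :
    (T.graft i T').graft j' T'' = (T.graft j T'').graft i T' := by
  cases T with
  | triv => simp only [leaves] at hj; omega
  | vertex F =>
    cases T' with
    | triv =>
      obtain rfl : j' = j := by simp only [leaves] at hj'; omega
      rw [graft_triv, graft_triv]
    | vertex G =>
      cases T'' with
      | triv => rfl
      | vertex H => exact congrArg vertex (F.graft_par G H i j j' hij hj hj')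

lemma exists_graft_cube (s t : PlanarTree Unit) (i : ℕ) (hi : i < s.leaves) :
    ∃ (u : PlanarTree Unit) (g : s.Cube × t.Cube → u.Cube), Continuous g ∧
      u.leaves + 1 = s.leaves + t.leaves ∧
      ∀ p, fill u (g p) = (fill s p.1).graft i (fill t p.2) := by
  cases s with
  | triv => exact ⟨t, Prod.snd, continuous_snd, by simp only [leaves]; omega, fun p => rfl⟩
  | vertex F =>
    cases t with
    | triv => exact ⟨vertex F, Prod.fst, continuous_fst, rfl, fun p => rfl⟩
    | vertex G =>
      obtain ⟨u, g, hg, hu, h⟩ := F.exists_graft_cube G i hi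
      exact ⟨vertex u, g, hg, hu, fun p => congrArg vertex (h p)⟩

end PlanarTree

/-- The metric trees with `n` leaves: planar rooted trees with a length in `[0, 1]` on every
internal edge. -/
abbrev MetricTree (n : ℕ) : Type := {T : PlanarTree I // T.leaves = n}

/-- The space of metric trees with `n` leaves, up to contraction of the edges of length `0` and
removal of the bivalent vertices. (`Quot` divides by the equivalence relation that is generated.) -/
def TreeSpace (n : ℕ) : Type := Quot fun T T' : MetricTree n => PlanarTree.Step T.1 T'.1

namespace TreeSpace

/-- The class of a metric tree. -/
def mk {n : ℕ} (T : MetricTree n) : TreeSpace n := Quot.mk _ T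

/-- The disjoint union of the cubes of edge lengths, over all planar trees with `n` leaves. -/
abbrev Cubes (n : ℕ) : Type := Σ s : {s : PlanarTree Unit // s.leaves = n}, s.1.Cube

/-- The canonical map from the disjoint union of cubes. -/
def proj (n : ℕ) (p : Cubes n) : TreeSpace n :=
  mk ⟨PlanarTree.fill p.1.1 p.2, (PlanarTree.leaves_fill _ _).trans p.1.2⟩

/-- The quotient topology from the disjoint union of cubes. -/
instance (n : ℕ) : TopologicalSpace (TreeSpace n) := .coinduced (proj n) inferInstance

lemma isQuotientMap_proj (n : ℕ) : IsQuotientMap (proj n) := by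
  refine ⟨⟨rfl⟩, ?_⟩
  rintro ⟨T, hT⟩
  obtain ⟨s, c, rfl⟩ := T.exists_fill
  exact ⟨⟨⟨s, (PlanarTree.leaves_fill s c).symm.trans hT⟩, c⟩, rfl⟩

instance (n : ℕ) : CompactlyGeneratedSpace (TreeSpace n) :=
  compactlyGeneratedSpace_of_coinduced (isQuotientMap_proj n).continuous rfl

/-- Grafting of metric trees. -/
def comp {n m k : ℕ} (i : Fin n) (h : n + m = k + 1) :
    TreeSpace n → TreeSpace m → TreeSpace k :=
  Quot.map₂ (fun T T' => ⟨T.1.graft i T'.1, by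
      have := T.1.leaves_graft T'.1 i (T.2.symm ▸ i.2)
      have h1 := T.2
      have h2 := T'.2
      omega⟩)
    (fun T _ _ h => T.1.graft_step_right h i (T.2.symm ▸ i.2))
    (fun T _ T' h => PlanarTree.graft_step_left h T'.1 i (T.2.symm ▸ i.2))

lemma continuous_sigma_prod {ι Y Z : Type} {X : ι → Type} [∀ s, TopologicalSpace (X s)]
    [TopologicalSpace Y] [TopologicalSpace Z] {F : (Σ s, X s) × Y → Z}
    (h : ∀ s, Continuous fun p : X s × Y => F (⟨s, p.1⟩, p.2)) : Continuous F := by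
  have h1 : Continuous (F ∘ (Homeomorph.sigmaProdDistrib (X := X) (Y := Y)).symm) :=
    continuous_sigma h
  simpa [Function.comp_assoc] using h1.comp (Homeomorph.sigmaProdDistrib (X := X) (Y := Y)).continuous

lemma continuous_comp_proj {n m k : ℕ} (i : Fin n) (h : n + m = k + 1) :
    Continuous fun p : Cubes n × Cubes m => comp i h (proj n p.1) (proj m p.2) := by
  refine continuous_sigma_prod fun s => ?_
  have h1 : Continuous fun p : Cubes m × s.1.Cube => comp i h (proj n ⟨s, p.2⟩) (proj m p.1) := by
    refine continuous_sigma_prod fun t => ?_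
    obtain ⟨u, g, hg, hu, hf⟩ := s.1.exists_graft_cube t.1 i (s.2.symm ▸ i.2)
    have hk : u.leaves = k := by
      have h1 := s.2
      have h2 := t.2
      omega
    have h2 : Continuous fun p : t.1.Cube × s.1.Cube =>
        proj k ⟨⟨u, hk⟩, g (p.2, p.1)⟩ :=
      (isQuotientMap_proj k).continuous.comp
        ((@continuous_sigmaMk {s : PlanarTree Unit // s.leaves = k} (fun s => s.1.Cube) _
          ⟨u, hk⟩).comp (hg.comp continuous_swap))
    convert h2 using 2 with p
    exact congrArg mk (Subtype.ext (hf (p.2, p.1)).symm)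
  exact h1.comp continuous_swap

instance (n : ℕ) : LocallyCompactSpace (Cubes n) := by
  have : WeaklyLocallyCompactSpace (Cubes n) := ⟨fun p =>
    ⟨Set.range (Sigma.mk p.1), isCompact_range continuous_sigmaMk,
      IsOpenEmbedding.sigmaMk.isOpen_range.mem_nhds ⟨p.2, rfl⟩⟩⟩
  infer_instance

lemma continuous_comp {n m k : ℕ} (i : Fin n) (h : n + m = k + 1) (K : Type)
    [TopologicalSpace K] [CompactSpace K] [T2Space K] (f : C(K, TreeSpace n))
    (g : C(K, TreeSpace m)) : Continuous fun t => comp i h (f t) (g t) := by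
  have h1 : Continuous fun p : TreeSpace n × Cubes m => comp i h p.1 (proj m p.2) :=
    (isQuotientMap_proj n).continuous_lift_prod_left (continuous_comp_proj i h)
  have h2 : Continuous fun p : K × Cubes m => comp i h (f p.1) (proj m p.2) :=
    h1.comp ((f.continuous.comp continuous_fst).prodMk continuous_snd)
  have h3 : Continuous fun p : K × TreeSpace m => comp i h (f p.1) p.2 :=
    (isQuotientMap_proj m).continuous_lift_prod_right h2
  exact h3.comp (continuous_id.prodMk g.continuous)

end TreeSpace

/-- The operad of planar metric trees: composition is grafting, with the new internal edges
of length `1`, and the identity is the tree without internal vertices. -/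
def treeOperad : TopOperad ⊤ where
  X c := TreeSpace c.1
  comp i h x y := TreeSpace.comp i h x y
  one _ := TreeSpace.mk ⟨.triv, rfl⟩
  continuous_comp i h K _ _ _ f g := TreeSpace.continuous_comp i h K f g
  one_comp _ i e x := by
    induction x using Quot.ind
    rfl
  comp_one _ i e x := by
    induction x using Quot.ind with | mk T =>
    exact congrArg (Quot.mk _) (Subtype.ext (T.1.graft_triv _))
  assoc_seq i j i' hi h₁ h₂ h₃ h₄ x y z := by
    induction x using Quot.ind with | mk T =>
    induction y using Quot.ind with | mk T' =>
    induction z using Quot.ind with | mk T'' =>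
    refine congrArg (Quot.mk _) (Subtype.ext ?_)
    have := T.1.graft_seq T'.1 T''.1 i j (T.2.symm ▸ i.2) (T'.2.symm ▸ j.2)
    rw [← hi] at this
    exact this
  assoc_par i j hij j' i' hj hi h₁ h₂ h₃ h₄ x y z := by
    induction x using Quot.ind with | mk T =>
    induction y using Quot.ind with | mk T' =>
    induction z using Quot.ind with | mk T'' =>
    refine congrArg (Quot.mk _) (Subtype.ext ?_)
    have := T.1.graft_par T'.1 T''.1 i j j' hij (T.2.symm ▸ j.2) (T'.2.symm ▸ hj)
    exact this.trans (congrArg (fun r => PlanarTree.graft _ r T'.1) hi.symm)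

/-! ### The filtration -/

/-- The set of (classes of) prime trees with `k` leaves such that `S e u` holds, where `u` is the
number of univalent internal vertices and `e` is the sum of `u` and of the number of leaves. A
prime tree is one that is not the identity and has no edge of length `1`; here it is represented
without edges of length `0` and without bivalent vertices. -/
def primeTrees (S : ℕ → ℕ → Prop) (k : Color ⊤) : Set (treeOperad.X k) :=
  {x | ∃ T : MetricTree k.1, T.1.Prime ∧ S (T.1.leaves + T.1.univalent) T.1.univalent ∧
    TreeSpace.mk T = x}

lemma primeTrees_mono {S S' : ℕ → ℕ → Prop} (h : ∀ e u, S e u → S' e u) (k : Color ⊤) :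
    primeTrees S k ⊆ primeTrees S' k :=
  fun _ ⟨T, hT, hS, hx⟩ => ⟨T, hT, h _ _ hS, hx⟩

/-- The filtration term number `n`: all operadic compositions of prime trees whose number of leaves
plus number of univalent internal vertices is at most `n`. -/
def treeFiltration (n : ℕ) : TopOperad ⊤ :=
  treeOperad.generated (primeTrees fun e _ => e ≤ n)

/-- The intermediate filtration term number `(n, i)`: all operadic compositions of prime trees for
which `e`, the number of leaves plus the number of univalent internal vertices, is at most `n`, or
is `n + 1` while there are at most `i` univalent internal vertices. -/
def treeFiltrationAux (n i : ℕ) : TopOperad ⊤ :=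
  treeOperad.generated (primeTrees fun e u => e ≤ n ∨ (e = n + 1 ∧ u ≤ i))

/-- The inclusion of a filtration term into the operad of metric trees. -/
def treeFiltrationι (n : ℕ) : treeFiltration n ⟶ treeOperad := treeOperad.generatedι _

/-- The inclusion of an intermediate filtration term into the operad of metric trees. -/
def treeFiltrationAuxι (n i : ℕ) : treeFiltrationAux n i ⟶ treeOperad := treeOperad.generatedι _

/-- The inclusions of the filtration terms into each other. -/
def treeFiltrationMap {n m : ℕ} (h : n ≤ m) : treeFiltration n ⟶ treeFiltration m :=
  treeOperad.generatedIncl (primeTrees_mono fun _ _ he => he.trans h)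

/-- The inclusion of the term `n` into the term `(n, 0)`. -/
def treeFiltrationAuxStart (n : ℕ) : treeFiltration n ⟶ treeFiltrationAux n 0 :=
  treeOperad.generatedIncl (primeTrees_mono fun _ _ he => Or.inl he)

/-- The inclusion of the term `(n, i)` into the term `(n, i + 1)`. -/
def treeFiltrationAuxStep (n i : ℕ) : treeFiltrationAux n i ⟶ treeFiltrationAux n (i + 1) :=
  treeOperad.generatedIncl (primeTrees_mono fun _ _ he => he.imp_right
    fun h => ⟨h.1, h.2.trans (Nat.le_succ i)⟩)

/-- The inclusion of the term `(n, n + 1)` into the term `n + 1` (they are equal). -/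
def treeFiltrationAuxEnd (n : ℕ) : treeFiltrationAux n (n + 1) ⟶ treeFiltration (n + 1) :=
  treeOperad.generatedIncl (primeTrees_mono fun _ _ he => he.elim
    (fun h => h.trans (Nat.le_succ n)) fun h => h.1.le)

/-- The sequence of the filtration terms. -/
def treeFiltrationFunctor : ℕ ⥤ TopOperad ⊤ where
  obj n := treeFiltration n
  map f := treeFiltrationMap (leOfHom f)
  map_id _ := rfl
  map_comp _ _ := rfl

/-- The operad of metric trees as a cocone under the sequence of the filtration terms. -/
def treeFiltrationCocone : Limits.Cocone treeFiltrationFunctor where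
  pt := treeOperad
  ι := { app := fun n => treeFiltrationι n, naturality := fun _ _ _ => rfl }

/-- `f : A ⟶ B` is a free attachment of `r` cells of dimension `d` in degree `c`, and the union of
these (open) generating cells is `U`. -/
def TopOperad.AttachesCells {N : ℕ∞} {A B : TopOperad N} (f : A ⟶ B) (r : ℕ) (c : Color N) (d : ℕ)
    (U : Set (B.X c)) : Prop :=
  ∃ a : CellAttachment f (Fin r) (fun _ => c) (fun _ => d), a.openCells = U

/-! ## Equivalence of metric trees, continuous families of metric trees -/

/-! Cutting a metric tree at its edges of length 1 decomposes it into components, each of which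
reduces to a prime tree or to the identity, and grafting merely puts the components of two trees
together. The type of a prime tree is the pair `(e, u)`. For a set `S` of types, `Ok S` says, on
arbitrary representatives with edges of length 0 and bivalent vertices, that every component is an
identity or has its type in `S`. This is invariant under the identifications and under grafting, and
it describes exactly the suboperad generated by the prime trees of type in `S` (`generated_iff_ok`).

All cell attachments are instances of one statement, in which a single type `(n, i)` is added to `S`
(`TreeCells.attachment`). Suppose that the prime trees of this type are the disjoint interiors of
discs, with boundaries in lexicographically smaller types. A morphism `g` on the suboperad of `S`
and compatible maps `φ` on the discs extend in just one way: evaluate every component by `g` or `φ`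
and compose the values. Since identity components evaluate to the identity, this respects the
identifications (`cellEv_step`); associativity makes it compatible with grafting (`cellEv_graft`).
The argument runs in `N`-truncated operads, where intermediate degrees must stay in range: a
component of type `(e, u)` has at most `max 1 e` inputs, and elements of degree 0 are composed
first.

Continuity is the delicate point, as the components of a tree change over a cube of edge lengths.
The part of a cube where `Ok S` holds is a finite union of closed faces, on each of which the
generic components already have types in `S`; for this, `S` must be closed downwards
lexicographically, since types only drop under specialization (`below_map`). So continuity can be
tested on families whose generic components have types in `S` (`continuous_of_families`). Cutting
only the edges that have length 1 throughout the family is independent of the parameter, and every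
generic component is a family in the old suboperad or in a single disc (`continuousFamily_cellEv`).

For the discs, fix which `i` of the `n` ends (leaves and univalent vertices, called stumps below)
are stumps; this gives `n.choose i` cells. A tree is determined by the heights at which consecutive
ends meet, whose minimum is 0, and by the lengths of the stump edges. This gives `n - 1` heights up
to a common translation and `i` numbers `2 * ℓ - 1`, hence dimension `n - 2 + i`. The largest of the
remaining edge lengths and of the numbers `|2 * ℓ - 1|` is a homogeneous gauge; its open unit ball
consists of the prime trees. Where it equals 1, some edge has length 1 or some stump edge has length
0, and the type drops. Radial rescaling turns the gauge ball into a Euclidean disc (`treeCells`).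

Running through the types in lexicographic order, starting from the initial operad, shows that the
operad of trees and, in degrees at most `n`, the filtration term `n` are cellular cofibrant
(`isCofibrant_of_iso`). It remains to contract the spaces of trees with all components of `e ≤ n`
and at most `n` leaves. Shrinking all edges at once would merge components and could make `e` too
large. Instead, the parts without leaves are pruned first, in such an order that no component gains
ends (`ends_prune_le`); afterwards the number of ends of a component is bounded by the number of
leaves, and all lengths can be scaled to 0. -/

lemma Relation.EqvGen.map_rel {α β : Type*} {r : α → α → Prop} {s : β → β → Prop} (f : α → β)
    (h : ∀ a b, r a b → s (f a) (f b)) {a b : α} (hab : Relation.EqvGen r a b) :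
    Relation.EqvGen s (f a) (f b) := by
  induction hab with
  | rel _ _ h' => exact .rel _ _ (h _ _ h')
  | refl => exact .refl _
  | symm _ _ _ ih => exact .symm _ _ ih
  | trans _ _ _ _ _ ih ih' => exact .trans _ _ _ ih ih'

namespace PlanarForest

variable {L L' L'' : Type}

/-- The forest with relabelled internal edges. -/
def map (f : L → L') : PlanarForest L → PlanarForest L'
  | nil => nil
  | leaf B => leaf (B.map f)
  | node ℓ A B => node (f ℓ) (A.map f) (B.map f)

/-- All labels satisfy `P`. -/
def All (P : L → Prop) : PlanarForest L → Prop
  | nil => True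
  | leaf B => B.All P
  | node ℓ A B => P ℓ ∧ A.All P ∧ B.All P

/-- The number of leaves and internal edges. -/
def size : PlanarForest L → ℕ
  | nil => 0
  | leaf B => B.size + 1
  | node _ A B => A.size + B.size + 1

lemma append_nil (A : PlanarForest L) : A.append nil = A := by
  induction A with
  | nil => rfl
  | leaf B ih => simp [append, ih]
  | node ℓ A B _ ih => simp [append, ih]

lemma append_assoc (A B C : PlanarForest L) : (A.append B).append C = A.append (B.append C) := by
  induction A with
  | nil => rfl
  | leaf A ih => simp [append, ih]
  | node ℓ A A' _ ih => simp [append, ih]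

lemma arity_append (A B : PlanarForest L) : (A.append B).arity = A.arity + B.arity := by
  induction A with
  | nil => simp [append, arity]
  | leaf A ih => simp [append, arity, ih]; omega
  | node ℓ A A' _ ih => simp [append, arity, ih]; omega

lemma arity_eq_zero {A : PlanarForest L} : A.arity = 0 ↔ A = nil := by
  cases A <;> simp [arity]

lemma all_map {P : L' → Prop} {f : L → L'} {A : PlanarForest L} :
    (A.map f).All P ↔ A.All (fun ℓ => P (f ℓ)) := by
  induction A with
  | nil => rfl
  | leaf A ih => exact ih
  | node ℓ A A' ih ih' => exact and_congr Iff.rfl (and_congr ih ih')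

lemma map_map (f : L → L') (g : L' → L'') (A : PlanarForest L) :
    (A.map f).map g = A.map (fun ℓ => g (f ℓ)) := by
  induction A with
  | nil => rfl
  | leaf A ih => simp [map, ih]
  | node ℓ A A' ih ih' => simp [map, ih, ih']

lemma map_id (A : PlanarForest L) : A.map (fun ℓ => ℓ) = A := by
  induction A with
  | nil => rfl
  | leaf A ih => simp [map, ih]
  | node ℓ A A' ih ih' => simp [map, ih, ih']

lemma map_append (f : L → L') (A B : PlanarForest L) :
    (A.append B).map f = (A.map f).append (B.map f) := by
  induction A with
  | nil => rfl
  | leaf A ih => simp [map, append, ih]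
  | node ℓ A A' _ ih => simp [map, append, ih]

lemma leaves_map (f : L → L') (A : PlanarForest L) : (A.map f).leaves = A.leaves := by
  induction A with
  | nil => rfl
  | leaf A ih => simp [map, leaves, ih]
  | node ℓ A A' ih ih' => simp [map, leaves, ih, ih']

lemma arity_map (f : L → L') (A : PlanarForest L) : (A.map f).arity = A.arity := by
  induction A with
  | nil => rfl
  | leaf A ih => simp [map, arity, ih]
  | node ℓ A A' ih ih' => simp [map, arity, ih']

/-- The equivalence relation generated by the elementary identifications. -/
def Equivalent (F G : PlanarForest I) : Prop := Relation.EqvGen Step F G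

namespace Equivalent

lemma refl (F : PlanarForest I) : Equivalent F F := Relation.EqvGen.refl _

lemma symm {F G : PlanarForest I} (h : Equivalent F G) : Equivalent G F := Relation.EqvGen.symm _ _ h

lemma trans {F G H : PlanarForest I} (h : Equivalent F G) (h' : Equivalent G H) :
    Equivalent F H := Relation.EqvGen.trans _ _ _ h h'

lemma of_step {F G : PlanarForest I} (h : Step F G) : Equivalent F G := .rel _ _ h

lemma leaf {B B' : PlanarForest I} (h : Equivalent B B') : Equivalent (leaf B) (.leaf B') :=
  Relation.EqvGen.map_rel _ (fun _ _ h => Step.leaf h) h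

lemma node (ℓ : I) {A A' B B' : PlanarForest I} (h : Equivalent A A') (h' : Equivalent B B') :
    Equivalent (.node ℓ A B) (.node ℓ A' B') :=
  (Relation.EqvGen.map_rel (fun A => PlanarForest.node ℓ A B)
    (fun _ _ h => Step.node_left ℓ B h) h).trans _ _ _
  (Relation.EqvGen.map_rel (fun B => PlanarForest.node ℓ A' B)
    (fun _ _ h => Step.node_right ℓ A' h) h')

end Equivalent

lemma Step.append_right {A A' : PlanarForest I} (h : Step A A') (G : PlanarForest I) :
    Step (A.append G) (A'.append G) := by
  induction h with
  | contract A B => rw [append_assoc]; exact .contract _ _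
  | unary_leaf ℓ B => exact .unary_leaf _ _
  | unary_node ℓ ℓ' A B => exact .unary_node _ _ _ _
  | leaf h ih => exact .leaf ih
  | node_left ℓ B h ih => exact .node_left _ _ h
  | node_right ℓ A h ih => exact .node_right _ _ ih

lemma Step.append_left (G : PlanarForest I) {A A' : PlanarForest I} (h : Step A A') :
    Step (G.append A) (G.append A') := by
  induction G with
  | nil => exact h
  | leaf B ih => exact .leaf ih
  | node ℓ B C _ ih => exact .node_right _ _ ih

lemma Equivalent.append {A A' B B' : PlanarForest I} (h : Equivalent A A') (h' : Equivalent B B') :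
    Equivalent (A.append B) (A'.append B') :=
  Equivalent.trans (G := A'.append B)
    (Relation.EqvGen.map_rel (fun A : PlanarForest I => A.append B) (fun _ _ h => h.append_right B) h)
    (Relation.EqvGen.map_rel (fun B : PlanarForest I => A'.append B) (fun _ _ h => h.append_left A') h')

/-- A forest without edges of length `1` can be brought into prime form. -/
lemma exists_prime {F : PlanarForest I} (hF : F.All (· ≠ 1)) :
    ∃ F', Equivalent F F' ∧ F'.Prime := by
  induction F with
  | nil => exact ⟨nil, .refl _, trivial⟩
  | leaf B ih =>
    obtain ⟨B', h, h'⟩ := ih hF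
    exact ⟨leaf B', h.leaf, h'⟩
  | node ℓ A B ihA ihB =>
    obtain ⟨hℓ, hA, hB⟩ := hF
    obtain ⟨A', hA, hA'⟩ := ihA hA
    obtain ⟨B', hB, hB'⟩ := ihB hB
    have h := Equivalent.node ℓ hA hB
    by_cases h0 : ℓ = 0
    · subst h0
      refine ⟨A'.append B', h.trans (.of_step (.contract _ _)), ?_⟩
      clear h hA hB
      induction A' with
      | nil => exact hB'
      | leaf A ih => exact ih hA'
      | node ℓ A A' _ ih => exact ⟨hA'.1, hA'.2.1, hA'.2.2.1, hA'.2.2.2.1, ih hA'.2.2.2.2⟩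
    have hℓ0 : 0 < ℓ := unitInterval.pos_iff_ne_zero.2 h0
    have hℓ1 : ℓ < 1 := unitInterval.lt_one_iff_ne_one.2 hℓ
    cases A' with
    | nil => exact ⟨_, h, hℓ0, hℓ1, by simp [arity], trivial, hB'⟩
    | leaf A₁ =>
      cases A₁ with
      | nil => exact ⟨leaf B', h.trans (.of_step (.unary_leaf _ _)), hB'⟩
      | leaf A₂ => exact ⟨_, h, hℓ0, hℓ1, by simp [arity], hA', hB'⟩
      | node ℓ' A₂ A₃ => exact ⟨_, h, hℓ0, hℓ1, by simp [arity], hA', hB'⟩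
    | node ℓ' A₁ A₂ =>
      cases A₂ with
      | nil =>
        exact ⟨_, h.trans (.of_step (.unary_node _ _ _ _)), lt_max_of_lt_left hℓ0,
          max_lt hℓ1 hA'.2.1, hA'.2.2.1, hA'.2.2.2.1, hB'⟩
      | leaf A₂ => exact ⟨_, h, hℓ0, hℓ1, by simp [arity], hA', hB'⟩
      | node ℓ' A₂ A₃ => exact ⟨_, h, hℓ0, hℓ1, by simp [arity], hA', hB'⟩

end PlanarForest

namespace PlanarTree

variable {L L' L'' : Type}

/-- The tree with relabelled internal edges. -/
def map (f : L → L') : PlanarTree L → PlanarTree L'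
  | triv => triv
  | vertex F => vertex (F.map f)

lemma leaves_map (f : L → L') : ∀ T : PlanarTree L, (T.map f).leaves = T.leaves
  | triv => rfl
  | vertex F => F.leaves_map f

/-- The equivalence relation generated by the elementary identifications. -/
def Equivalent (T T' : PlanarTree I) : Prop := Relation.EqvGen Step T T'

lemma leaves_step {T T' : PlanarTree I} (h : Step T T') : T.leaves = T'.leaves := by
  cases h with
  | vertex h => exact PlanarForest.leaves_step h
  | unary_leaf => rfl
  | unary_node ℓ A => simp [leaves, PlanarForest.leaves]

namespace Equivalent

lemma refl (F : PlanarTree I) : Equivalent F F := Relation.EqvGen.refl _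

lemma symm {F G : PlanarTree I} (h : Equivalent F G) : Equivalent G F := Relation.EqvGen.symm _ _ h

lemma trans {F G H : PlanarTree I} (h : Equivalent F G) (h' : Equivalent G H) :
    Equivalent F H := Relation.EqvGen.trans _ _ _ h h'

lemma of_step {F G : PlanarTree I} (h : Step F G) : Equivalent F G := .rel _ _ h

lemma vertex {F G : PlanarForest I} (h : F.Equivalent G) : Equivalent (vertex F) (.vertex G) :=
  Relation.EqvGen.map_rel _ (fun _ _ h => Step.vertex h) h

lemma leaves_eq {T T' : PlanarTree I} (h : Equivalent T T') : T.leaves = T'.leaves := by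
  induction h with
  | rel _ _ h => exact leaves_step h
  | refl => rfl
  | symm _ _ _ ih => exact ih.symm
  | trans _ _ _ _ _ ih ih' => exact ih.trans ih'

end Equivalent

/-- A tree whose inner edges do not have length `1` is trivial or equivalent to a prime one. -/
lemma exists_prime {F : PlanarForest I} (hF : F.All (· ≠ 1)) :
    ∃ T, Equivalent (vertex F) T ∧ (T = triv ∨ T.Prime) := by
  obtain ⟨F', h, h'⟩ := PlanarForest.exists_prime hF
  have h := Equivalent.vertex h
  cases F' with
  | nil => exact ⟨_, h, .inr ⟨by simp [PlanarForest.arity], trivial⟩⟩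
  | leaf A =>
    cases A with
    | nil => exact ⟨_, h.trans (.of_step .unary_leaf), .inl rfl⟩
    | leaf A₂ => exact ⟨_, h, .inr ⟨by simp [PlanarForest.arity], h'⟩⟩
    | node ℓ' A₂ A₃ => exact ⟨_, h, .inr ⟨by simp [PlanarForest.arity], h'⟩⟩
  | node ℓ A B =>
    cases B with
    | nil => exact ⟨_, h.trans (.of_step (.unary_node _ _)), .inr ⟨h'.2.2.1, h'.2.2.2.1⟩⟩
    | leaf A₂ => exact ⟨_, h, .inr ⟨by simp [PlanarForest.arity], h'⟩⟩
    | node ℓ' A₂ A₃ => exact ⟨_, h, .inr ⟨by simp [PlanarForest.arity], h'⟩⟩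

end PlanarTree

lemma TreeSpace.mk_eq_of_equivalent {n : ℕ} {T T' : PlanarTree I} (h : T.Equivalent T')
    (hT : T.leaves = n) (hT' : T'.leaves = n) :
    TreeSpace.mk ⟨T, hT⟩ = TreeSpace.mk ⟨T', hT'⟩ := by
  induction h with
  | rel _ _ h => exact Quot.sound h
  | refl => rfl
  | symm _ _ _ ih => exact (ih _ _).symm
  | trans T₁ T₂ T₃ h _ ih ih' =>
    exact (ih hT ((PlanarTree.Equivalent.leaves_eq h).symm.trans hT)).trans (ih' _ _)

/-! ### Continuous families -/

namespace PlanarForest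

variable {K : Type} [TopologicalSpace K]

/-- The member at the parameter `t` of a continuous family of metric forests of the same shape. -/
def at' (F : PlanarForest C(K, I)) (t : K) : PlanarForest I := F.map (fun ℓ => ℓ t)

lemma exists_cube (F : PlanarForest C(K, I)) : ∃ c : K → (F.map fun _ => ()).Cube, Continuous c ∧
    ∀ t, fill _ (c t) = F.at' t := by
  induction F with
  | nil => exact ⟨fun _ => (), continuous_const, fun _ => rfl⟩
  | leaf B ih =>
    obtain ⟨c, h, h'⟩ := ih
    exact ⟨c, h, fun t => congrArg leaf (h' t)⟩
  | node ℓ A B ihA ihB =>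
    obtain ⟨c, h, h'⟩ := ihA
    obtain ⟨d, h₁, h₁'⟩ := ihB
    refine ⟨fun t => (ℓ t, c t, d t), ℓ.continuous.prodMk (h.prodMk h₁), fun t => ?_⟩
    simp only [map, fill, at', node.injEq, true_and]
    exact ⟨h' t, h₁' t⟩

/-- The tautological family over the cube of edge lengths. -/
lemma exists_taut (s : PlanarForest Unit) :
    ∃ F : PlanarForest C(s.Cube, I), ∀ c, F.at' c = fill s c := by
  induction s with
  | nil => exact ⟨nil, fun _ => rfl⟩
  | leaf B ih =>
    obtain ⟨F, h⟩ := ih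
    exact ⟨leaf F, fun c => congrArg leaf (h c)⟩
  | node ℓ A B ihA ihB =>
    obtain ⟨F, h⟩ := ihA
    obtain ⟨G, h'⟩ := ihB
    let X := I × A.Cube × B.Cube
    have h1 : Continuous fun c : X => c.2.1 := by fun_prop
    have h2 : Continuous fun c : X => c.2.2 := by fun_prop
    refine ⟨(node (⟨fun c => c.1, continuous_fst⟩ : C(X, I))
      (F.map fun ℓ => ℓ.comp ⟨_, h1⟩) (G.map fun ℓ => ℓ.comp ⟨_, h2⟩) :), fun c => ?_⟩
    have := h c.2.1
    have := h' c.2.2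
    simp only [at', map, fill, node.injEq] at *
    exact ⟨rfl, (map_map _ _ F).trans (h c.2.1), (map_map _ _ G).trans (h' c.2.2)⟩

end PlanarForest

namespace PlanarTree

variable {K : Type} [TopologicalSpace K]

/-- The member at the parameter `t` of a continuous family of metric trees of the same shape. -/
def at' (F : PlanarTree C(K, I)) (t : K) : PlanarTree I := F.map (fun ℓ => ℓ t)

lemma leaves_at' (F : PlanarTree C(K, I)) (t : K) : (F.at' t).leaves = F.leaves := leaves_map _ _

lemma exists_taut : ∀ s : PlanarTree Unit,
    ∃ F : PlanarTree C(s.Cube, I), ∀ c, F.at' c = fill s c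
  | triv => ⟨triv, fun _ => rfl⟩
  | vertex s => by
    obtain ⟨F, h⟩ := s.exists_taut
    exact ⟨vertex F, fun c => congrArg vertex (h c)⟩

lemma continuous_mk {n : ℕ} (F : PlanarTree C(K, I)) (h : F.leaves = n) :
    Continuous fun t => (TreeSpace.mk ⟨F.at' t, (F.leaves_at' t).trans h⟩ : TreeSpace n) := by
  have key : ∃ (s : PlanarTree Unit) (c : K → s.Cube), Continuous c ∧ ∀ t, fill s (c t) = F.at' t := by
    cases F with
    | triv => exact ⟨triv, fun _ => (), continuous_const, fun _ => rfl⟩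
    | vertex F =>
      obtain ⟨c, hc, h⟩ := F.exists_cube
      exact ⟨vertex _, c, hc, fun t => congrArg vertex (h t)⟩
  obtain ⟨s, c, hc, hs⟩ := key
  -- The number of leaves of `s` is read off at one parameter; over an empty parameter space there
  -- is nothing to prove.
  by_cases hK : Nonempty K
  · obtain ⟨t₀⟩ := hK
    have hn : s.leaves = n := by rw [← leaves_fill s (c t₀), hs, leaves_at', h]
    have h1 : Continuous fun t => TreeSpace.proj n ⟨⟨s, hn⟩, c t⟩ :=
      (TreeSpace.isQuotientMap_proj n).continuous.comp
        ((@continuous_sigmaMk {s : PlanarTree Unit // s.leaves = n} (fun s => s.1.Cube) _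
          ⟨s, hn⟩).comp hc)
    convert h1 using 2 with t
    exact congrArg TreeSpace.mk (Subtype.ext (hs t).symm)
  · exact continuous_iff_continuousAt.2 fun t => (hK ⟨t⟩).elim

end PlanarTree

/-- A map out of a closed piece of the space of trees is continuous if it is continuous along all
cubes. -/
lemma TreeSpace.continuous_of_cubes {n : ℕ} {Y : Type} [TopologicalSpace Y]
    {P : TreeSpace n → Prop} (f : {x // P x} → Y)
    (hP : ∀ (s : PlanarTree Unit) (hs : s.leaves = n),
      IsClosed {c : s.Cube | P (proj n ⟨⟨s, hs⟩, c⟩)})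
    (hf : ∀ (s : PlanarTree Unit) (hs : s.leaves = n),
      Continuous fun c : {c : s.Cube // P (proj n ⟨⟨s, hs⟩, c⟩)} => f ⟨_, c.2⟩) :
    Continuous f := by
  have hcl : IsClosed {x | P x} := by
    rw [← (isQuotientMap_proj n).isClosed_preimage, isClosed_sigma_iff]
    exact fun s => hP s.1 s.2
  rw [continuous_iff_isClosed]
  intro Z hZ
  -- The quotient topology is that of the whole space, so the closed set is pushed forward to it; in
  -- each cube its preimage is closed in the closed part where `P` holds.
  have h1 : IsClosed (Subtype.val '' (f ⁻¹' Z)) := by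
    rw [← (isQuotientMap_proj n).isClosed_preimage, isClosed_sigma_iff]
    intro s
    have h2 := (hP s.1 s.2).isClosedEmbedding_subtypeVal.isClosedMap _ (hZ.preimage (hf s.1 s.2))
    convert h2 using 1
    ext c
    constructor
    · rintro ⟨⟨x, hx⟩, h3, h4⟩
      simp only at h4
      subst h4
      exact ⟨⟨c, hx⟩, h3, rfl⟩
    · rintro ⟨⟨c, hc⟩, h3, rfl⟩
      exact ⟨⟨_, hc⟩, h3, rfl⟩
  have := h1.preimage (continuous_subtype_val (p := P))
  rwa [Set.preimage_image_eq _ Subtype.val_injective] at this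

/-! ## The prime components of a tree -/

/-- A set of pairs that is closed downwards for the lexicographic order. -/
def LexLower (S : ℕ → ℕ → Prop) : Prop :=
  ∀ ⦃e u e' u' : ℕ⦄, S e u → (e' < e ∨ (e' = e ∧ u' ≤ u)) → S e' u'

/-- `S`, or the type of the identity. -/
def OrId (S : ℕ → ℕ → Prop) (e u : ℕ) : Prop := S e u ∨ (e = 1 ∧ u = 0)

lemma OrId.lower {S : ℕ → ℕ → Prop} (hS : LexLower S) {e u e' u' : ℕ} (h : OrId S e u)
    (h' : e' < e ∨ (e' = e ∧ u' ≤ u)) (h1 : 1 ≤ e') : OrId S e' u' := by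
  rcases h with h | h
  · exact .inl (hS h h')
  · exact .inr (by omega)

namespace PlanarForest

section

variable {L L' : Type} [Zero L] [One L] [Zero L'] [One L']

open Classical in
/-- The number of leaves plus the number of univalent internal vertices of the component next to
the root, after reduction. -/
noncomputable def ends : PlanarForest L → ℕ
  | nil => 0
  | leaf B => B.ends + 1
  | node ℓ A B => (if ℓ = 1 then 1 else if ℓ = 0 then A.ends else max 1 A.ends) + B.ends

open Classical in
/-- The number of univalent internal vertices of the component next to the root, after
reduction. -/
noncomputable def uni : PlanarForest L → ℕ
  | nil => 0
  | leaf B => B.uni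
  | node ℓ A B => (if ℓ = 1 then 0 else if ℓ = 0 then A.uni else if A.ends = 0 then 1 else A.uni)
      + B.uni

open Classical in
/-- The number of univalent internal vertices of the component next to the root, including the
vertex that carries the forest. -/
noncomputable def rootUni (F : PlanarForest L) : ℕ := if F.ends = 0 then 1 else F.uni

/-- The component next to the root is the identity or of a type in `S`. -/
def Good (S : ℕ → ℕ → Prop) (F : PlanarForest L) : Prop := OrId S (max 1 F.ends) F.rootUni

/-- All the components that begin with an edge of the forest are identities or of a type in `S`. -/
def Ok (S : ℕ → ℕ → Prop) : PlanarForest L → Prop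
  | nil => True
  | leaf B => B.Ok S
  | node ℓ A B => (ℓ = 1 → A.Good S) ∧ A.Ok S ∧ B.Ok S

lemma ends_append (A B : PlanarForest L) : (A.append B).ends = A.ends + B.ends := by
  induction A with
  | nil => simp [append, ends]
  | leaf A ih => simp [append, ends, ih]; omega
  | node ℓ A A' _ ih => simp [append, ends, ih]; omega

lemma uni_append (A B : PlanarForest L) : (A.append B).uni = A.uni + B.uni := by
  induction A with
  | nil => simp [append, uni]
  | leaf A ih => simp [append, uni, ih]
  | node ℓ A A' _ ih => simp [append, uni, ih]; omega

lemma ok_append {S : ℕ → ℕ → Prop} (A B : PlanarForest L) :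
    (A.append B).Ok S ↔ A.Ok S ∧ B.Ok S := by
  induction A with
  | nil => simp [append, Ok]
  | leaf A ih => simp [append, Ok, ih]
  | node ℓ A A' _ ih => simp [append, Ok, ih, and_assoc]

lemma uni_le_ends (A : PlanarForest L) : A.uni ≤ A.ends := by
  induction A with
  | nil => simp [ends, uni]
  | leaf A ih => simp only [ends, uni]; omega
  | node ℓ A A' ih ih' =>
    simp only [ends, uni]
    split_ifs <;> omega

lemma Ok.mono {S S' : ℕ → ℕ → Prop} (h : ∀ e u, S e u → S' e u) {A : PlanarForest L}
    (hA : A.Ok S) : A.Ok S' := by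
  induction A with
  | nil => trivial
  | leaf A ih => exact ih hA
  | node ℓ A A' ih ih' => exact ⟨fun h' => (hA.1 h').imp_left (h _ _), ih hA.2.1, ih' hA.2.2⟩

lemma ends_map {f : L → L'} {F : PlanarForest L}
    (hf : F.All fun ℓ => (f ℓ = 0 ↔ ℓ = 0) ∧ (f ℓ = 1 ↔ ℓ = 1)) : (F.map f).ends = F.ends := by
  induction F with
  | nil => rfl
  | leaf A ih => simp [ends, map, ih hf]
  | node ℓ A A' ih ih' =>
    obtain ⟨⟨h0, h1⟩, hA, hB⟩ := hf
    by_cases h : ℓ = 1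
    · simp only [ends, map, ih' hB, if_pos (h1.2 h), if_pos h]
    by_cases h' : ℓ = 0
    · simp only [ends, map, ih hA, ih' hB, if_pos (h0.2 h'), if_neg (mt h1.1 h), if_neg h, if_pos h']
    · simp only [ends, map, ih hA, ih' hB, if_neg (mt h0.1 h'), if_neg (mt h1.1 h), if_neg h,
        if_neg h']

lemma uni_map {f : L → L'} {F : PlanarForest L}
    (hf : F.All fun ℓ => (f ℓ = 0 ↔ ℓ = 0) ∧ (f ℓ = 1 ↔ ℓ = 1)) : (F.map f).uni = F.uni := by
  induction F with
  | nil => rfl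
  | leaf A ih => simp [uni, map, ih hf]
  | node ℓ A A' ih ih' =>
    obtain ⟨⟨h0, h1⟩, hA, hB⟩ := hf
    by_cases h : ℓ = 1
    · simp only [uni, map, ih' hB, if_pos (h1.2 h), if_pos h]
    by_cases h' : ℓ = 0
    · simp only [uni, map, ih hA, ih' hB, if_pos (h0.2 h'), if_neg (mt h1.1 h), if_neg h, if_pos h']
    · simp only [uni, map, ih hA, ih' hB, ends_map hA, if_neg (mt h0.1 h'), if_neg (mt h1.1 h), if_neg h,
        if_neg h']

lemma good_map {S : ℕ → ℕ → Prop} {f : L → L'} {F : PlanarForest L}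
    (hf : F.All fun ℓ => (f ℓ = 0 ↔ ℓ = 0) ∧ (f ℓ = 1 ↔ ℓ = 1)) : (F.map f).Good S ↔ F.Good S := by
  simp [Good, rootUni, ends_map hf, uni_map hf]

lemma ok_map {S : ℕ → ℕ → Prop} {f : L → L'} {F : PlanarForest L}
    (hf : F.All fun ℓ => (f ℓ = 0 ↔ ℓ = 0) ∧ (f ℓ = 1 ↔ ℓ = 1)) : (F.map f).Ok S ↔ F.Ok S := by
  induction F with
  | nil => rfl
  | leaf A ih => simp [Ok, map, ih hf]
  | node ℓ A A' ih ih' => simp [Ok, map, ih hf.2.1, ih' hf.2.2, hf.1.2, good_map hf.2.1]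

/-- How the type of a component changes under specialization of lengths. -/
def Below (e' u' e u : ℕ) : Prop := (e' < e ∨ (e' = e ∧ u' ≤ u)) ∧ (u < e → u' < e')

/-- The second clause of `Below` says that a component with a leaf keeps a leaf. It excludes the
only bad passage when an edge is put below: type `(1, 0)`, a leaf, turning into type `(1, 1)`, a
stump. -/
lemma Below.edge {e' u' e u : ℕ} (h : Below e' u' e u) (hu : u ≤ e) (hu' : u' ≤ e') :
    Below (max 1 e') (if e' = 0 then 1 else u') (max 1 e) (if e = 0 then 1 else u) := by
  unfold Below at *
  split_ifs <;> omega

/-- The map `f` is a specialization of lengths, such as evaluation of functions at a point. Only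
edges labelled neither 0 nor 1 can change their nature: an edge that becomes 1 replaces everything
above it by one leaf, and one that becomes 0 loses at most the end that it guaranteed. -/
lemma below_map {f : L → L'} (h0 : f 0 = 0) (h1 : f 1 = 1) (h01 : (0 : L') ≠ 1)
    (F : PlanarForest L) : Below (F.map f).ends (F.map f).uni F.ends F.uni := by
  induction F with
  | nil => simp [Below, map, ends, uni]
  | leaf A ih =>
    simp only [Below, map, ends, uni] at *
    have := (A.map f).uni_le_ends
    omega
  | node ℓ A A' ih ih' =>
    have ha := A.uni_le_ends
    have ha' := (A.map f).uni_le_ends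
    have hb := A'.uni_le_ends
    have hb' := (A'.map f).uni_le_ends
    by_cases hℓ1 : ℓ = 1
    · subst hℓ1
      simp only [Below, map, ends, uni, h1, if_true] at *
      omega
    by_cases hℓ0 : ℓ = 0
    · subst hℓ0
      simp only [Below, map, ends, uni, h0, if_true, hℓ1, if_false, h01] at *
      omega
    simp only [map, ends, uni, hℓ1, hℓ0, if_false]
    by_cases hf1 : f ℓ = 1
    · simp only [hf1, if_true, Below] at *
      split_ifs <;> omega
    by_cases hf0 : f ℓ = 0
    · simp only [hf0, if_true, h01, if_false, Below] at *
      split_ifs <;> omega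
    have := ih.edge ha ha'
    simp only [hf1, hf0, if_false]
    unfold Below at *
    split_ifs at * <;> omega

lemma good_map_of_good {S : ℕ → ℕ → Prop} (hS : LexLower S) {f : L → L'} (h0 : f 0 = 0)
    (h1 : f 1 = 1) (h01 : (0 : L') ≠ 1) {F : PlanarForest L} (h : F.Good S) :
    (F.map f).Good S := by
  have := (below_map h0 h1 h01 F).edge F.uni_le_ends (F.map f).uni_le_ends
  exact OrId.lower hS h this.1 (le_max_left _ _)

/-- An edge that is generically inside a component may specialize to length 1 and split off a new
component. The type of that one is bounded by the type of the component from which it is split off,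
so the induction carries an admissible bound `(e, u)` for the forest. -/
lemma ok_map_of_ok {S : ℕ → ℕ → Prop} (hS : LexLower S) {f : L → L'} (h0 : f 0 = 0)
    (h1 : f 1 = 1) (h01 : (0 : L') ≠ 1) {F : PlanarForest L} {e u : ℕ} (he : OrId S e u)
    (hF : F.ends < e ∨ (F.ends = e ∧ F.uni ≤ u)) (h : F.Ok S) : (F.map f).Ok S := by
  induction F generalizing e u with
  | nil => trivial
  | leaf A ih =>
    refine ih he ?_ h
    simp only [ends, uni] at hF
    omega
  | node ℓ A A' ih ih' =>
    obtain ⟨hg, hA, hA'⟩ := h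
    simp only [ends, uni] at hF
    have hb := A'.uni_le_ends
    refine ⟨fun hℓ => ?_, ?_, ih' he (by split_ifs at hF <;> omega) hA'⟩
    · by_cases hℓ1 : ℓ = 1
      · exact good_map_of_good hS h0 h1 h01 (hg hℓ1)
      by_cases hℓ0 : ℓ = 0
      · rw [hℓ0, h0] at hℓ
        exact (h01 hℓ).elim
      simp only [hℓ1, hℓ0, if_false] at hF
      refine good_map_of_good hS h0 h1 h01 (he.lower hS ?_ (le_max_left _ _))
      simp only [rootUni]
      omega
    · by_cases hℓ1 : ℓ = 1
      · refine ih (hg hℓ1) ?_ hA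
        unfold rootUni
        split_ifs <;> omega
      · refine ih he ?_ hA
        have := A.uni_le_ends
        split_ifs at hF <;> omega

end

section

variable {S : ℕ → ℕ → Prop}

lemma max_eq_zero_iff (a b : I) : max a b = 0 ↔ a = 0 ∧ b = 0 := by
  constructor
  · intro h
    exact ⟨le_antisymm (h ▸ le_max_left a b) unitInterval.nonneg',
      le_antisymm (h ▸ le_max_right a b) unitInterval.nonneg'⟩
  · rintro ⟨rfl, rfl⟩; exact max_self _

lemma max_eq_one_iff (a b : I) : max a b = 1 ↔ a = 1 ∨ b = 1 := by
  constructor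
  · intro h
    rcases max_choice a b with h' | h' <;> simp_all
  · rintro (rfl | rfl)
    · exact max_eq_left unitInterval.le_one'
    · exact max_eq_right unitInterval.le_one'

lemma zero_ne_one_I : (0 : I) ≠ 1 := zero_ne_one

lemma ends_uni_node_unary (ℓ ℓ' : I) (A B : PlanarForest I) :
    (node ℓ (node ℓ' A nil) B).ends = (node (max ℓ ℓ') A B).ends ∧
    (node ℓ (node ℓ' A nil) B).uni = (node (max ℓ ℓ') A B).uni := by
  simp only [ends, uni, max_eq_zero_iff, max_eq_one_iff]
  have := zero_ne_one_I
  by_cases h1 : ℓ = 1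
  · simp [h1]
  by_cases h1' : ℓ' = 1
  · by_cases h0 : ℓ = 0 <;> simp [h1, h1', h0]
  by_cases h0 : ℓ = 0 <;> by_cases h0' : ℓ' = 0 <;> simp [h1, h1', h0, h0']

/-- `ends` and `uni` count after reduction: an edge of length 0 hands its forest to the vertex
below, and a maximum of two lengths is 1 if one of them is 1, and 0 if both are 0. Removing a
bivalent vertex next to a cut edge deletes a component of type `(1, 0)`, which `OrId` admits. -/
lemma step_invariant {F F' : PlanarForest I} (h : Step F F') :
    F.ends = F'.ends ∧ F.uni = F'.uni ∧ (F.Ok S ↔ F'.Ok S) := by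
  induction h with
  | contract A B => simp [ends_append, uni_append, ok_append, ends, uni, Ok]
  | unary_leaf ℓ B =>
    simp only [ends, uni, Ok, Good, rootUni]
    refine ⟨?_, ?_, ?_⟩
    · split_ifs <;> omega
    · simp
    · simp [OrId]
  | unary_node ℓ ℓ' A B =>
    refine ⟨(ends_uni_node_unary _ _ _ _).1, (ends_uni_node_unary _ _ _ _).2, ?_⟩
    simp only [Ok, max_eq_one_iff, Good, rootUni, ends, uni]
    by_cases h1 : ℓ = 1
    · by_cases h1' : ℓ' = 1
      · simp [h1, h1', OrId, and_assoc]
      · by_cases h0 : ℓ' = 0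
        · simp [h1, h0]
        · simp [h1, h1', h0]
    · by_cases h1' : ℓ' = 1 <;> simp [h1, h1', and_assoc]
  | leaf h ih => simpa [ends, uni, Ok] using ih
  | node_left ℓ B h ih => 
    simp only [ends, uni, Ok, Good, rootUni]
    rw [ih.1, ih.2.1, ih.2.2]
    simp
  | node_right ℓ A h ih => simp [ends, uni, Ok, ih]

lemma Prime.stats {F : PlanarForest I} (h : F.Prime) :
    F.ends = F.leaves + F.univalent ∧ F.uni = F.univalent ∧ F.Ok S ∧ F.arity ≤ F.ends ∧
      F.All (· ≠ 1) := by
  induction F with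
  | nil => simp [ends, uni, leaves, univalent, Ok, arity, All]
  | leaf A ih =>
    have := ih h
    simp only [ends, uni, leaves, univalent, Ok, arity, All]
    exact ⟨by omega, by omega, this.2.2.1, by omega, this.2.2.2.2⟩
  | node ℓ A B ihA ihB =>
    obtain ⟨h0, h1, ha, hA, hB⟩ := h
    have hA := ihA hA
    have hB := ihB hB
    simp only [ends, uni, leaves, univalent, Ok, arity, All, h1.ne, h0.ne', if_false]
    have hz : A.arity = 0 → A.ends = 0 ∧ A.leaves = 0 ∧ A.univalent = 0 := by
      rw [arity_eq_zero]
      rintro rfl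
      simp [ends, leaves, univalent]
    refine ⟨?_, ?_, ⟨by simp, hA.2.2.1, hB.2.2.1⟩, by omega, h1.ne, hA.2.2.2.2, hB.2.2.2.2⟩
    · split_ifs with h
      · have := hz h; omega
      · omega
    · split_ifs <;> omega

/-- The new edge has length 1, so it counts as one end, just like the leaf that it replaces. The
only new component begins with `G`. -/
lemma graft_invariant {F G : PlanarForest I} {i : ℕ} (hi : i < F.leaves) :
    (F.graft i G).ends = F.ends ∧ (F.graft i G).uni = F.uni ∧
      (F.Ok S → G.Good S → G.Ok S → (F.graft i G).Ok S) := by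
  induction F generalizing i with
  | nil => simp [leaves] at hi
  | leaf B ih =>
    cases i with
    | zero =>
      simp [graft, ends, uni, Ok]
      exact ⟨by omega, fun h1 h2 h3 => ⟨h2, h3, h1⟩⟩
    | succ i => simpa [graft, ends, uni, Ok] using ih (by simpa [leaves] using hi)
  | node ℓ A B ihA ihB =>
    simp only [leaves] at hi
    simp only [graft]
    split_ifs with h
    · have := ihA h
      simp only [ends, uni, Ok, Good, rootUni] at this ⊢
      rw [this.1, this.2.1]
      exact ⟨rfl, rfl, fun h1 h2 h3 => ⟨h1.1, this.2.2 h1.2.1 h2 h3, h1.2.2⟩⟩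
    · have := ihB (i := i - A.leaves) (by omega)
      simp only [ends, uni, Ok, this, true_and]
      exact fun h1 h2 h3 => ⟨h1.1, h1.2.1, this.2.2 h1.2.2 h2 h3⟩

end

end PlanarForest

namespace PlanarTree

variable {L L' : Type} [Zero L] [One L] [Zero L'] [One L'] {S : ℕ → ℕ → Prop}

/-- All prime components are of a type in `S`. -/
def Ok (S : ℕ → ℕ → Prop) : PlanarTree L → Prop
  | triv => True
  | vertex F => F.Good S ∧ F.Ok S

lemma Ok.map_of_ok (hS : LexLower S) {f : L → L'} (h0 : f 0 = 0)
    (h1 : f 1 = 1) (h01 : (0 : L') ≠ 1) : ∀ {T : PlanarTree L}, T.Ok S → (T.map f).Ok S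
  | triv, _ => trivial
  | vertex F, h => ⟨PlanarForest.good_map_of_good hS h0 h1 h01 h.1,
      PlanarForest.ok_map_of_ok hS h0 h1 h01 h.1
        (by unfold PlanarForest.rootUni; split_ifs <;> omega) h.2⟩

lemma ok_of_step {T T' : PlanarTree I} (h : Step T T') : T.Ok S ↔ T'.Ok S := by
  cases h with
  | vertex h =>
    have := PlanarForest.step_invariant (S := S) h
    simp only [Ok, PlanarForest.Good, PlanarForest.rootUni, this]
  | unary_leaf => simp [Ok, PlanarForest.Good, PlanarForest.rootUni, PlanarForest.ends,
      PlanarForest.uni, PlanarForest.Ok, OrId]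
  | unary_node ℓ A =>
    simp only [Ok, PlanarForest.Good, PlanarForest.rootUni, PlanarForest.ends,
      PlanarForest.uni, PlanarForest.Ok]
    by_cases h1 : ℓ = 1
    · simp [h1, OrId]
    · by_cases h0 : ℓ = 0
      · simp [h0]
      · simp [h0, h1]

lemma Ok.graft {T T' : PlanarTree I} (h : T.Ok S) (h' : T'.Ok S) {i : ℕ} (hi : i < T.leaves) :
    (T.graft i T').Ok S := by
  cases T with
  | triv => exact h'
  | vertex F =>
    cases T' with
    | triv => exact h
    | vertex G =>
      have := PlanarForest.graft_invariant (S := S) (G := G) hi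
      exact ⟨by simpa only [PlanarForest.Good, PlanarForest.rootUni, this] using h.1,
        this.2.2 h.2 h'.1 h'.2⟩

/-- For a prime tree the reduced counts are the naive ones. The last clause separates it from the
identity, so that for its type `OrId S` means `S`. -/
lemma Prime.type {F : PlanarForest I} (h : (vertex F).Prime) :
    max 1 F.ends = (vertex F).leaves + (vertex F).univalent ∧ F.rootUni = (vertex F).univalent ∧
      F.Ok S ∧ F.All (· ≠ 1) ∧ ¬ (max 1 F.ends = 1 ∧ F.rootUni = 0) := by
  have h1 := PlanarForest.Prime.stats (S := S) h.2
  have h2 := h.1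
  have hz : F.arity = 0 → F.ends = 0 ∧ F.leaves = 0 ∧ F.univalent = 0 := by
    rw [PlanarForest.arity_eq_zero]
    rintro rfl
    simp [PlanarForest.ends, PlanarForest.leaves, PlanarForest.univalent]
  simp only [leaves, univalent, PlanarForest.rootUni]
  refine ⟨?_, ?_, h1.2.2.1, h1.2.2.2.2, ?_⟩
  · split_ifs with h
    · have := hz h; omega
    · omega
  · by_cases h : F.arity = 0
    · simp [h, hz h]
    · have : F.ends ≠ 0 := by omega
      simp [h, this, h1.2.1]
  · rintro ⟨h3, h4⟩
    split_ifs at h4; omega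

end PlanarTree

/-- All prime components are of a type in `S`. -/
def TreeSpace.Ok (S : ℕ → ℕ → Prop) {n : ℕ} : TreeSpace n → Prop :=
  Quot.lift (fun T => T.1.Ok S) fun _ _ h => propext (PlanarTree.ok_of_step h)

lemma TreeSpace.Ok.comp {S : ℕ → ℕ → Prop} {n m k : ℕ} (i : Fin n) (h : n + m = k + 1)
    {x : TreeSpace n} {y : TreeSpace m} (hx : x.Ok S) (hy : y.Ok S) :
    (TreeSpace.comp i h x y).Ok S := by
  induction x using Quot.ind with | mk T =>
  induction y using Quot.ind with | mk T' =>
  exact PlanarTree.Ok.graft hx hy (T.2.symm ▸ i.2)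

lemma ok_of_generated {S : ℕ → ℕ → Prop} {c : Color ⊤} {x : treeOperad.X c}
    (h : TopOperad.Generated treeOperad (primeTrees S) c x) : TreeSpace.Ok S x := by
  induction h with
  | of x hx =>
    obtain ⟨⟨T, hT'⟩, hT, hS, rfl⟩ := hx
    cases T with
    | triv => exact hT.elim
    | vertex F =>
      have := hT.type (S := S)
      refine ⟨.inl ?_, this.2.2.1⟩
      rw [this.1, this.2.1]
      exact hS
  | one h => exact trivial
  | comp i h x y _ _ ihx ihy => exact TreeSpace.Ok.comp i h ihx ihy

/-! ## Iterated compositions in truncated operads -/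

/-- The number `k` is a degree of an `N`-truncated operad. -/
abbrev InRange (N : ℕ∞) (k : ℕ) : Prop := (k : ℕ∞) ≤ N

lemma InRange.mono {N : ℕ∞} {k k' : ℕ} (h : InRange N k) (h' : k' ≤ k) : InRange N k' :=
  (Nat.cast_le.2 h').trans h

namespace TopOperad

variable {N : ℕ∞}

/-- The elements of an operad, in all degrees. -/
def El (O : TopOperad N) : Type := Σ c : Color N, O.X c

namespace El

variable {O : TopOperad N}

/-- The degree of an element. -/
def deg (x : O.El) : ℕ := x.1.1

lemma inRange (x : O.El) : InRange N x.deg := x.1.2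

open Classical in
/-- The partial composition, with a default value if it is not defined. -/
noncomputable def comp (x : O.El) (i : ℕ) (y : O.El) : O.El :=
  if h : i < x.deg ∧ InRange N (x.deg + y.deg - 1) then
    ⟨⟨x.deg + y.deg - 1, h.2⟩, O.comp (n := x.1) (m := y.1) ⟨i, h.1⟩
      (by have := h.1; unfold deg at *; simp only; omega) x.2 y.2⟩
  else x

lemma comp_of_pos {x y : O.El} {i : ℕ} (h : i < x.deg ∧ InRange N (x.deg + y.deg - 1)) :
    comp x i y = ⟨⟨x.deg + y.deg - 1, h.2⟩, O.comp (n := x.1) (m := y.1) ⟨i, h.1⟩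
      (by have := h.1; unfold deg at *; simp only; omega) x.2 y.2⟩ := dif_pos h

lemma comp_of_neg {x y : O.El} {i : ℕ} (h : ¬ (i < x.deg ∧ InRange N (x.deg + y.deg - 1))) :
    comp x i y = x := dif_neg h

lemma comp_mk {n m k : Color N} (i : Fin n.1) (h : n.1 + m.1 = k.1 + 1) (x : O.X n) (y : O.X m) :
    comp (⟨n, x⟩ : O.El) i ⟨m, y⟩ = ⟨k, O.comp i h x y⟩ := by
  have h1 : n.1 + m.1 - 1 = k.1 := by omega
  obtain ⟨k, hk⟩ := k
  simp only at h1
  subst h1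
  exact dif_pos ⟨i.2, hk⟩

lemma deg_comp {x y : O.El} {i : ℕ} (hi : i < x.deg) (h : InRange N (x.deg + y.deg - 1)) :
    (comp x i y).deg = x.deg + y.deg - 1 := by
  rw [comp_of_pos ⟨hi, h⟩]
  rfl

/-- The range hypotheses cover both intermediate compositions and the result; without them `comp`
might return its default value on one side. -/
lemma comp_seq {x y z : O.El} {i j : ℕ} (hi : i < x.deg) (hj : j < y.deg)
    (h1 : InRange N (x.deg + y.deg - 1)) (h2 : InRange N (y.deg + z.deg - 1))
    (h3 : InRange N (x.deg + y.deg + z.deg - 2)) :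
    comp (comp x i y) (i + j) z = comp x i (comp y j z) := by
  obtain ⟨n, x⟩ := x
  obtain ⟨m, y⟩ := y
  obtain ⟨l, z⟩ := z
  simp only [deg] at *
  have e1 := comp_mk (k := ⟨_, h1⟩) ⟨i, hi⟩ (by simp only; omega) x y
  have e2 := comp_mk (k := ⟨_, h2⟩) ⟨j, hj⟩ (by simp only; omega) y z
  simp only at e1 e2
  rw [e1, e2]
  exact (comp_mk (k := ⟨_, h3⟩) ⟨i + j, by simp only; omega⟩ (by simp only; omega) _ z).trans
    ((congrArg (Sigma.mk _) (O.assoc_seq ⟨i, hi⟩ ⟨j, hj⟩ _ rfl _ _ _ (by simp only; omega) x y z)).trans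
    (comp_mk (k := ⟨_, h3⟩) ⟨i, hi⟩ _ x _).symm)

lemma comp_par {x y z : O.El} {i j j' : ℕ} (hij : i < j) (hj : j < x.deg)
    (hj' : j' + 1 = j + y.deg)
    (h1 : InRange N (x.deg + y.deg - 1)) (h2 : InRange N (x.deg + z.deg - 1))
    (h3 : InRange N (x.deg + y.deg + z.deg - 2)) :
    comp (comp x i y) j' z = comp (comp x j z) i y := by
  obtain ⟨n, x⟩ := x
  obtain ⟨m, y⟩ := y
  obtain ⟨l, z⟩ := z
  simp only [deg] at *
  have hi : i < n.1 := by omega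
  have e1 := comp_mk (k := ⟨_, h1⟩) ⟨i, hi⟩ (by simp only; omega) x y
  have e2 := comp_mk (k := ⟨_, h2⟩) ⟨j, hj⟩ (by simp only; omega) x z
  simp only at e1 e2
  have h4 : n.1 + m.1 + l.1 - 2 + 1 = n.1 + l.1 - 1 + m.1 := by omega
  rw [e1, e2]
  exact (comp_mk (k := ⟨_, h3⟩) ⟨j', by simp only; omega⟩ (by simp only; omega) _ z).trans
    ((congrArg (Sigma.mk _) (O.assoc_par (a := ⟨_, h1⟩) (b := ⟨_, h2⟩)
      (k := ⟨_, h3⟩) ⟨i, hi⟩ ⟨j, hj⟩ hij ⟨j', _⟩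
      ⟨i, show i < n.1 + l.1 - 1 by omega⟩ hj' rfl _ _ _ h4.symm x y z)).trans
    (comp_mk (k := ⟨_, h3⟩) ⟨i, show i < n.1 + l.1 - 1 by omega⟩ _ _ y).symm)

/-- The identity element. -/
def one (h : InRange N 1) : O.El := ⟨⟨1, h⟩, O.one h⟩

lemma deg_one (h : InRange N 1) : (one h : O.El).deg = 1 := rfl

lemma one_comp (h : InRange N 1) (y : O.El) : comp (one h) 0 y = y := by
  obtain ⟨m, y⟩ := y
  exact (comp_mk (k := m) ⟨0, Nat.one_pos⟩ (Nat.add_comm _ _) _ y).trans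
    (congrArg _ (O.one_comp h _ _ y))

lemma comp_one (h : InRange N 1) (x : O.El) (i : ℕ) : comp x i (one h) = x := by
  by_cases hi : i < x.deg
  · obtain ⟨n, x⟩ := x
    exact (comp_mk (k := n) ⟨i, hi⟩ rfl x _).trans (congrArg _ (O.comp_one h _ _ x))
  · exact comp_of_neg fun h => hi h.1

/-- The composition of `x` with the elements of a list, in its inputs from number `p` on. The
elements of degree `0` come first. -/
noncomputable def gam : O.El → ℕ → List O.El → O.El
  | x, _, [] => x
  | x, p, y :: ys => if y.deg = 0 then gam (comp x p y) p ys else comp (gam x (p + 1) ys) p y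

lemma gam_cons_zero {x y : O.El} {p : ℕ} {ys : List O.El} (h : y.deg = 0) :
    gam x p (y :: ys) = gam (comp x p y) p ys := if_pos h

lemma gam_cons_pos {x y : O.El} {p : ℕ} {ys : List O.El} (h : y.deg ≠ 0) :
    gam x p (y :: ys) = comp (gam x (p + 1) ys) p y := if_neg h

/-- The sum of the degrees of the elements of a list. -/
def degSum (ys : List O.El) : ℕ := (ys.map deg).sum

@[simp] lemma degSum_nil : degSum ([] : List O.El) = 0 := rfl

@[simp] lemma degSum_cons (y : O.El) (ys : List O.El) : degSum (y :: ys) = y.deg + degSum ys := by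
  simp [degSum]

/-- The elements of degree 0 lower the degree first, and the others do not lower it afterwards.
Hence all intermediate degrees are in range as soon as the degrees of `x` and of the result are. -/
lemma deg_gam {x : O.El} {p : ℕ} {ys : List O.El} (hp : p + ys.length ≤ x.deg)
    (h : InRange N (x.deg + degSum ys - ys.length)) :
    (gam x p ys).deg + ys.length = x.deg + degSum ys := by
  induction ys generalizing x p with
  | nil => simp [gam]
  | cons y ys ih =>
    simp only [List.length_cons, degSum_cons, gam] at *
    split_ifs with hy
    · have h1 := deg_comp (x := x) (y := y) (i := p) (by omega) (x.inRange.mono (by omega))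
      have h2 := ih (x := comp x p y) (p := p) (by omega) (h.mono (by omega))
      omega
    · have h2 := ih (x := x) (p := p + 1) (by omega) (h.mono (by omega))
      have h1 := deg_comp (x := gam x (p + 1) ys) (y := y) (i := p) (by omega) (h.mono (by omega))
      omega

/-- Parallel associativity moves an element of degree 0 past all compositions into later inputs. It
is needed in `gam_comp` when a composition produces an element of degree 0, which then has to come
early instead of late. -/
lemma gam_comp_zero {x z : O.El} {p q : ℕ} {ys : List O.El} (hz : z.deg = 0) (hq : q ≤ p)
    (hp : p + 1 + ys.length ≤ x.deg) (h : InRange N (x.deg + degSum ys - ys.length)) :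
    comp (gam x (p + 1) ys) q z = gam (comp x q z) p ys := by
  induction ys generalizing x p q with
  | nil => simp [gam]
  | cons y ys ih =>
    simp only [List.length_cons, degSum_cons, gam] at *
    have hx := x.inRange
    split_ifs with hy
    · have h1 := deg_comp (x := x) (y := y) (i := p + 1) (by omega) (hx.mono (by omega))
      rw [ih hq (by omega) (h.mono (by omega))]
      congr 1
      exact (comp_par (by omega) (by omega) (by omega) (hx.mono (by omega)) (hx.mono (by omega))
        (hx.mono (by omega))).symm
    · have h1 := deg_gam (x := x) (p := p + 1 + 1) (ys := ys) (by omega) (h.mono (by omega))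
      rw [← ih (x := x) (p := p + 1) (q := q) (by omega) (by omega) (h.mono (by omega))]
      exact (comp_par (by omega) (by omega) (by omega) (h.mono (by omega)) (h.mono (by omega))
        (h.mono (by omega))).symm

/-- Composition of `b` into input number `i` of a list of elements. -/
noncomputable def compList : List O.El → ℕ → O.El → List O.El
  | [], _, _ => []
  | y :: ys, i, b => if i < y.deg then comp y i b :: ys else y :: compList ys (i - y.deg) b

/-- Input `p + i` of the composite belongs to one element of the list. For that element sequential
associativity applies, and parallel associativity carries `b` past the others. -/
lemma gam_comp {x b : O.El} {p i : ℕ} {ys : List O.El} (hp : p + ys.length ≤ x.deg)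
    (h : InRange N (x.deg + degSum ys - ys.length)) (hi : i < degSum ys)
    (hys : InRange N (degSum ys + b.deg - 1))
    (h' : InRange N (x.deg + degSum ys - ys.length + b.deg - 1)) :
    comp (gam x p ys) (p + i) b = gam x p (compList ys i b) := by
  induction ys generalizing x p i with
  | nil => simp at hi
  | cons y ys ih =>
    simp only [List.length_cons, degSum_cons] at *
    have hx := x.inRange
    by_cases hiy : i < y.deg
    · have hy : y.deg ≠ 0 := by omega
      have h1 := deg_gam (x := x) (p := p + 1) (ys := ys) (by omega) (h.mono (by omega))
      have h2 := deg_comp (x := y) (y := b) hiy (hys.mono (by omega))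
      simp only [compList, gam, hiy, hy, if_true, if_false]
      rw [comp_seq (by omega) hiy (h.mono (by omega)) (hys.mono (by omega)) (h'.mono (by omega))]
      split_ifs with h3
      · exact gam_comp_zero h3 le_rfl (by omega) (h.mono (by omega))
      · rfl
    · simp only [compList, gam, hiy, if_false]
      split_ifs with hy
      · have h1 := deg_comp (x := x) (y := y) (i := p) (by omega) (hx.mono (by omega))
        rw [ih (x := comp x p y) (by omega) (h.mono (by omega)) (by omega) (hys.mono (by omega))
          (h'.mono (by omega)), hy]
        rfl
      · have h1 := deg_gam (x := x) (p := p + 1) (ys := ys) (by omega) (h.mono (by omega))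
        rw [← ih (x := x) (p := p + 1) (i := i - y.deg) (by omega) (h.mono (by omega)) (by omega)
          (hys.mono (by omega)) (h'.mono (by omega))]
        exact comp_par (by omega) (by omega) (by omega) (h.mono (by omega)) (h'.mono (by omega))
          (h'.mono (by omega))

lemma gam_one (h : InRange N 1) (y : O.El) : gam (one h) 0 [y] = y := by
  simp [gam, one_comp]

lemma gam_ones (h : InRange N 1) (x : O.El) (p k : ℕ) :
    gam x p (List.replicate k (one h)) = x := by
  induction k generalizing p with
  | zero => rfl
  | succ k ih => simp [List.replicate_succ, gam, deg_one, comp_one, ih]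

lemma gam_induction {Q : O.El → Prop} (hQ : ∀ x i y, Q x → Q y → Q (comp x i y)) {x : O.El}
    {p : ℕ} {ys : List O.El} (hx : Q x) (hy : ∀ y ∈ ys, Q y) : Q (gam x p ys) := by
  induction ys generalizing x p with
  | nil => exact hx
  | cons y ys ih =>
    simp only [List.mem_cons, forall_eq_or_imp] at hy
    simp only [gam]
    split_ifs
    · exact ih (hQ _ _ _ hx hy.1) hy.2
    · exact hQ _ _ _ (ih hx hy.2) hy.1

/-- The map of elements induced by a morphism of operads. -/
def map {O' : TopOperad N} (f : O ⟶ O') (x : O.El) : O'.El := ⟨x.1, Hom.app f x.1 x.2⟩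

lemma deg_map {O' : TopOperad N} (f : O ⟶ O') (x : O.El) : (map f x).deg = x.deg := rfl

lemma map_comp {O' : TopOperad N} (f : O ⟶ O') (x y : O.El) (i : ℕ) :
    map f (comp x i y) = comp (map f x) i (map f y) := by
  by_cases h : i < x.deg ∧ InRange N (x.deg + y.deg - 1)
  · rw [comp_of_pos h, comp_of_pos (x := map f x) (y := map f y) h]
    exact congrArg (Sigma.mk _) (Hom.map_comp f _ _ _ _)
  · rw [comp_of_neg h, comp_of_neg (x := map f x) (y := map f y) h]

lemma map_one {O' : TopOperad N} (f : O ⟶ O') (h : InRange N 1) : map f (one h) = one h :=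
  congrArg (Sigma.mk _) (Hom.map_one f h)

lemma map_gam {O' : TopOperad N} (f : O ⟶ O') (x : O.El) (p : ℕ) (ys : List O.El) :
    map f (gam x p ys) = gam (map f x) p (ys.map (map f)) := by
  induction ys generalizing x p with
  | nil => rfl
  | cons y ys ih =>
    rw [List.map_cons]
    by_cases hy : y.deg = 0
    · rw [gam_cons_zero hy, gam_cons_zero (y := map f y) hy, ih, map_comp]
    · rw [gam_cons_pos hy, gam_cons_pos (y := map f y) hy, map_comp, ih]

/-- Continuous families of elements of constant degree. -/
def ContinuousFamily {K : Type} [TopologicalSpace K] (d : ℕ) (f : K → O.El) : Prop :=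
  ∃ (h : InRange N d) (g : C(K, O.X ⟨d, h⟩)), ∀ t, f t = ⟨⟨d, h⟩, g t⟩

namespace ContinuousFamily

variable {K : Type} [TopologicalSpace K]

lemma deg_eq {d : ℕ} {f : K → O.El} (h : ContinuousFamily d f) (t : K) : (f t).deg = d := by
  obtain ⟨h, g, hg⟩ := h
  rw [hg]; rfl

variable [CompactSpace K] [T2Space K]

lemma comp {d d' : ℕ} {f f' : K → O.El} (h : ContinuousFamily d f) (h' : ContinuousFamily d' f')
    {i : ℕ} (hi : i < d) (hN : InRange N (d + d' - 1)) :
    ContinuousFamily (d + d' - 1) fun t => comp (f t) i (f' t) := by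
  obtain ⟨h, g, hg⟩ := h
  obtain ⟨h', g', hg'⟩ := h'
  refine ⟨hN, ⟨_, O.continuous_comp (n := ⟨d, h⟩) (m := ⟨d', h'⟩) (k := ⟨_, hN⟩) ⟨i, hi⟩
    (by simp only; omega) K g g'⟩, fun t => ?_⟩
  refine (congrArg₂ (fun a b => El.comp a i b) (hg t) (hg' t)).trans ?_
  exact comp_mk (O := O) (n := ⟨d, h⟩) (m := ⟨d', h'⟩) (k := ⟨_, hN⟩) ⟨i, hi⟩ _ _ _

lemma gam {d : ℕ} {f : K → O.El} (h : ContinuousFamily d f) {p : ℕ}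
    {ι : Type} {ys : List ι} {r : ι → ℕ} {y : ι → K → O.El}
    (hy : ∀ j ∈ ys, ContinuousFamily (r j) (y j)) (hp : p + ys.length ≤ d)
    (hN : InRange N (d + (ys.map r).sum - ys.length)) :
    ContinuousFamily (d + (ys.map r).sum - ys.length)
      fun t => gam (f t) p (ys.map fun j => y j t) := by
  induction ys generalizing d f p with
  | nil => simpa [El.gam] using h
  | cons j ys ih =>
    simp only [List.mem_cons, forall_eq_or_imp, List.length_cons, List.map_cons,
      List.sum_cons] at *
    obtain ⟨hN1, -⟩ := id h
    by_cases hd : r j = 0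
    · have h1 := h.comp hy.1 (i := p) (by omega) (hN1.mono (by omega))
      have h2 := ih h1 hy.2 (p := p) (by omega) (hN.mono (by omega))
      have e : d + (r j + (ys.map r).sum) - (ys.length + 1) =
        d + r j - 1 + (ys.map r).sum - ys.length := by omega
      rw [e]
      convert h2 using 2 with t
      simp [El.gam, hy.1.deg_eq, hd]
    · have h1 := ih h hy.2 (p := p + 1) (by omega) (hN.mono (by omega))
      have h2 := h1.comp hy.1 (i := p) (by omega) (hN.mono (by omega))
      have e : d + (r j + (ys.map r).sum) - (ys.length + 1) =
        d + (ys.map r).sum - ys.length + r j - 1 := by omega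
      rw [e]
      convert h2 using 2 with t
      simp [El.gam, hy.1.deg_eq, hd]

end ContinuousFamily

end El

end TopOperad

/-! ## Cutting a tree along its edges of length `1` -/

namespace PlanarForest

section

variable {L : Type} [One L]

open Classical in
/-- The component next to the root: the edges of length `1` become leaves. -/
noncomputable def root : PlanarForest L → PlanarForest L
  | nil => nil
  | leaf B => leaf B.root
  | node ℓ A B => if ℓ = 1 then leaf B.root else node ℓ A.root B.root

open Classical in
/-- The trees on top of the leaves of the component next to the root. -/
noncomputable def subs : PlanarForest L → List (PlanarTree L)
  | nil => []
  | leaf B => .triv :: B.subs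
  | node ℓ A B => if ℓ = 1 then .vertex A :: B.subs else A.subs ++ B.subs

lemma length_subs (F : PlanarForest L) : F.subs.length = F.root.leaves := by
  induction F with
  | nil => rfl
  | leaf B ih => simp [subs, root, leaves, ih]
  | node ℓ A B ihA ihB =>
    by_cases h : ℓ = 1
    · simp [subs, root, leaves, h, ihB]
    · simp [subs, root, leaves, h, ihA, ihB]

lemma sum_leaves_subs (F : PlanarForest L) : (F.subs.map PlanarTree.leaves).sum = F.leaves := by
  induction F with
  | nil => rfl
  | leaf B ih => simp [subs, leaves, PlanarTree.leaves, ih]; omega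
  | node ℓ A B ihA ihB =>
    by_cases h : ℓ = 1
    · simp [subs, leaves, PlanarTree.leaves, h, ihB]
    · simp [subs, leaves, h, ihA, ihB]

lemma leaves_le_of_mem_subs {F : PlanarForest L} {T : PlanarTree L} (h : T ∈ F.subs) :
    T.leaves ≤ F.leaves := by
  rw [← F.sum_leaves_subs]
  exact List.single_le_sum (fun _ _ => Nat.zero_le _) _ (List.mem_map_of_mem h)

lemma all_root (F : PlanarForest L) : F.root.All (· ≠ 1) := by
  induction F with
  | nil => trivial
  | leaf B ih => exact ih
  | node ℓ A B ihA ihB =>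
    by_cases h : ℓ = 1
    · simpa [root, h, All] using ihB
    · simpa [root, h, All] using ⟨ihA, ihB⟩

/-- The trees in `F.subs` are carried by subforests of `F`, so structural induction on the forest
proves the property for all of them at once. -/
lemma cut_induction {P : PlanarTree L → Prop} (h : P .triv)
    (h' : ∀ F : PlanarForest L, (∀ T ∈ F.subs, P T) → P (.vertex F)) (T : PlanarTree L) : P T := by
  have key : ∀ F : PlanarForest L, ∀ T ∈ F.subs, P T := by
    intro F
    induction F with
    | nil => simp [subs]
    | leaf B ih => simpa [subs] using ⟨h, ih⟩
    | node ℓ A B ihA ihB =>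
      by_cases h : ℓ = 1
      · simpa [subs, h] using ⟨h' _ ihA, ihB⟩
      · simp only [subs, h, if_false, List.mem_append]
        rintro T (hT | hT)
        exacts [ihA _ hT, ihB _ hT]
  cases T with
  | triv => exact h
  | vertex F => exact h' F (key F)

variable [Zero L]

lemma ends_root (F : PlanarForest L) : F.root.ends = F.ends := by
  induction F with
  | nil => rfl
  | leaf B ih => simp [root, ends, ih]
  | node ℓ A B ihA ihB =>
    by_cases h : ℓ = 1
    · simp [root, ends, h, ihB]; omega
    · simp [root, ends, h, ihA, ihB]

lemma uni_root (F : PlanarForest L) : F.root.uni = F.uni := by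
  induction F with
  | nil => rfl
  | leaf B ih => simp [root, uni, ih]
  | node ℓ A B ihA ihB =>
    by_cases h : ℓ = 1
    · simp [root, uni, h, ihB]
    · simp [root, uni, h, ihA, ihB, ends_root]

lemma leaves_add_uni {F : PlanarForest L} (h : F.All (· ≠ 1)) : F.leaves + F.uni = F.ends := by
  induction F with
  | nil => rfl
  | leaf B ih => simp only [leaves, uni, ends]; have := ih h; omega
  | node ℓ A B ihA ihB =>
    have := ihA h.2.1
    have := ihB h.2.2
    simp only [leaves, uni, ends, h.1, if_false]
    split_ifs <;> omega

/-- After cutting, the ends of the component next to the root are its leaves, cut edges included,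
and its stumps. This bounds its degree by the first entry of its type. -/
lemma leaves_root_add_uni (F : PlanarForest L) : F.root.leaves + F.uni = F.ends := by
  rw [← uni_root, leaves_add_uni F.all_root, ends_root]

lemma ok_subs {S : ℕ → ℕ → Prop} {F : PlanarForest L} (h : F.Ok S) : ∀ T ∈ F.subs, T.Ok S := by
  induction F with
  | nil => simp [subs]
  | leaf B ih => simpa [subs] using ⟨trivial, ih h⟩
  | node ℓ A B ihA ihB =>
    by_cases hℓ : ℓ = 1
    · simpa [subs, hℓ] using ⟨⟨h.1 hℓ, h.2.1⟩, ihB h.2.2⟩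
    · simp only [subs, hℓ, if_false, List.mem_append]
      rintro T (hT | hT)
      exacts [ihA h.2.1 _ hT, ihB h.2.2 _ hT]

lemma ok_of_all {S : ℕ → ℕ → Prop} {F : PlanarForest L} (h : F.All (· ≠ 1)) : F.Ok S := by
  induction F with
  | nil => trivial
  | leaf B ih => exact ih h
  | node ℓ A B ihA ihB => exact ⟨fun h' => (h.1 h').elim, ihA h.2.1, ihB h.2.2⟩

end

/-- The simultaneous grafting of trees to the leaves of a forest from number `p` on. -/
def graftAll : PlanarForest I → ℕ → List (PlanarTree I) → PlanarForest I
  | X, _, [] => X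
  | X, p, .triv :: ys => graftAll X (p + 1) ys
  | X, p, .vertex G :: ys =>
    if G.leaves = 0 then graftAll (X.graft p G) p ys else (graftAll X (p + 1) ys).graft p G

lemma leaves_graftAll {X : PlanarForest I} {p : ℕ} {ys : List (PlanarTree I)}
    (hp : p + ys.length ≤ X.leaves) :
    (graftAll X p ys).leaves + ys.length = X.leaves + (ys.map PlanarTree.leaves).sum := by
  induction ys generalizing X p with
  | nil => simp [graftAll]
  | cons y ys ih =>
    cases y with
    | triv =>
      simp only [graftAll, List.length_cons, List.map_cons, List.sum_cons, PlanarTree.leaves] at *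
      have := ih (X := X) (p := p + 1) (by omega)
      omega
    | vertex G =>
      simp only [graftAll, List.length_cons, List.map_cons, List.sum_cons, PlanarTree.leaves] at *
      split_ifs with h
      · have h1 := X.leaves_graft G p (by omega)
        have := ih (X := X.graft p G) (p := p) (by omega)
        omega
      · have := ih (X := X) (p := p + 1) (by omega)
        have h1 := (graftAll X (p + 1) ys).leaves_graft G p (by omega)
        omega

lemma graftAll_leaf (X : PlanarForest I) (p : ℕ) (ys : List (PlanarTree I)) :
    graftAll (leaf X) (p + 1) ys = leaf (graftAll X p ys) := by
  induction ys generalizing X p with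
  | nil => rfl
  | cons y ys ih =>
    cases y with
    | triv => exact ih X (p + 1)
    | vertex G =>
      simp only [graftAll]
      split_ifs
      · exact ih _ p
      · rw [ih]; rfl

lemma graftAll_node_right (ℓ : I) (A B : PlanarForest I) (p : ℕ) (ys : List (PlanarTree I)) :
    graftAll (node ℓ A B) (A.leaves + p) ys = node ℓ A (graftAll B p ys) := by
  induction ys generalizing B p with
  | nil => rfl
  | cons y ys ih =>
    cases y with
    | triv => exact ih B (p + 1)
    | vertex G =>
      simp only [graftAll]
      split_ifs
      · simp [graft, ih]
      · rw [add_assoc, ih]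
        simp [graft]

lemma graftAll_node (ℓ : I) (A B : PlanarForest I) (p : ℕ) (ys zs : List (PlanarTree I))
    (h : p + ys.length = A.leaves) :
    graftAll (node ℓ A B) p (ys ++ zs) = node ℓ (graftAll A p ys) (graftAll B 0 zs) := by
  induction ys generalizing A p with
  | nil =>
    have := graftAll_node_right ℓ A B 0 zs
    rw [add_zero] at this
    simp only [List.length_nil, add_zero] at h
    rw [List.nil_append, h, this]
    rfl
  | cons y ys ih =>
    simp only [List.length_cons] at h
    cases y with
    | triv => exact ih A (p + 1) (by omega)
    | vertex G =>
      have hp : p < A.leaves := by omega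
      simp only [List.cons_append, graftAll]
      split_ifs with hG
      · simp only [graft, hp, if_true]
        have := A.leaves_graft G p hp
        exact ih _ p (by omega)
      · rw [ih A (p + 1) (by omega)]
        have := leaves_graftAll (X := A) (p := p + 1) (ys := ys) (by omega)
        have hp' : p < (graftAll A (p + 1) ys).leaves := by omega
        simp [graft, hp']

/-- Grafting creates edges of length 1, so every edge labelled 1 can be regarded as grafted. Only `f
1 = 1` is needed: other edges may also get length 1 under `f` and just remain inside the pieces, so
the decomposition of a family is the same at all parameters. -/
lemma map_eq_graftAll {L : Type} [One L] {f : L → I} (h1 : f 1 = 1) (F : PlanarForest L) :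
    F.map f = graftAll (F.root.map f) 0 (F.subs.map fun T => T.map f) := by
  induction F with
  | nil => rfl
  | leaf B ih =>
    rw [map, ih]
    exact (graftAll_leaf _ 0 _).symm
  | node ℓ A B ihA ihB =>
    by_cases h : ℓ = 1
    · subst h
      simp only [root, subs, if_true, List.map_cons, map, h1]
      rw [PlanarTree.map]
      simp only [graftAll]
      split_ifs with hA
      · have := graftAll_node_right 1 (A.map f) (B.root.map f) 0 (B.subs.map fun T => T.map f)
        rw [hA] at this
        rw [ihB]
        exact this.symm
      · rw [graftAll_leaf, ← ihB]
        rfl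
    · simp only [root, subs, h, if_false, List.map_append, map]
      rw [graftAll_node, ← ihA, ← ihB]
      simp [leaves_map, length_subs]

lemma root_graft {F G : PlanarForest I} {i : ℕ} (hi : i < F.leaves) :
    (F.graft i G).root = F.root := by
  induction F generalizing i with
  | nil => simp [leaves] at hi
  | leaf B ih =>
    cases i with
    | zero => simp [graft, root]
    | succ i => simpa [graft, root] using ih (by simpa [leaves] using hi)
  | node ℓ A B ihA ihB =>
    simp only [leaves] at hi
    simp only [graft]
    split_ifs with h
    · simp [root, ihA h]
    · simp [root, ihB (show i - A.leaves < B.leaves by omega)]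

/-- Grafting of a tree to a leaf of one of the trees in a list. -/
def graftList : List (PlanarTree I) → ℕ → PlanarTree I → List (PlanarTree I)
  | [], _, _ => []
  | y :: ys, i, b => if i < y.leaves then y.graft i b :: ys else y :: graftList ys (i - y.leaves) b

lemma graftList_append (ys zs : List (PlanarTree I)) (i : ℕ) (b : PlanarTree I) :
    graftList (ys ++ zs) i b = if i < (ys.map PlanarTree.leaves).sum then graftList ys i b ++ zs
      else ys ++ graftList zs (i - (ys.map PlanarTree.leaves).sum) b := by
  induction ys generalizing i with
  | nil => simp
  | cons y ys ih =>
    simp only [List.cons_append, graftList, List.map_cons, List.sum_cons, ih]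
    by_cases h : i < y.leaves
    · simp [h, show i < y.leaves + (ys.map PlanarTree.leaves).sum by omega]
    · by_cases h' : i < y.leaves + (ys.map PlanarTree.leaves).sum
      · simp [h, h', show i - y.leaves < (ys.map PlanarTree.leaves).sum by omega]
      · simp [h, h', show ¬ i - y.leaves < (ys.map PlanarTree.leaves).sum by omega,
          Nat.sub_add_eq]

/-- With `root_graft`, this says that grafting happens entirely above the component next to the
root: a leaf of `F` is a leaf of exactly one of the trees in `F.subs`, identities included. -/
lemma subs_graft {F G : PlanarForest I} {i : ℕ} (hi : i < F.leaves) :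
    (F.graft i G).subs = graftList F.subs i (.vertex G) := by
  induction F generalizing i with
  | nil => simp [leaves] at hi
  | leaf B ih =>
    cases i with
    | zero => simp [graft, subs, graftList, PlanarTree.leaves, PlanarTree.graft]
    | succ i =>
      simpa [graft, subs, graftList, PlanarTree.leaves] using ih (by simpa [leaves] using hi)
  | node ℓ A B ihA ihB =>
    simp only [leaves] at hi
    simp only [graft]
    by_cases hA : i < A.leaves
    · by_cases hℓ : ℓ = 1
      · simp [subs, hℓ, hA, graftList, PlanarTree.leaves, PlanarTree.graft]
      · simp [subs, hℓ, hA, graftList_append, sum_leaves_subs, ihA hA]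
    · by_cases hℓ : ℓ = 1
      · simp [subs, hℓ, hA, graftList, PlanarTree.leaves, ihB (show i - A.leaves < B.leaves by omega)]
      · simp [subs, hℓ, hA, graftList_append, sum_leaves_subs,
          ihB (show i - A.leaves < B.leaves by omega)]

end PlanarForest

open Classical in
/-- The class of a metric tree in the truncated operad of metric trees (a default value if the degree
is not in the range). -/
noncomputable def PlanarTree.cls (N : ℕ∞) (T : PlanarTree I) : (treeOperad.truncate N le_top).El :=
  if h : InRange N T.leaves then ⟨⟨T.leaves, h⟩, TreeSpace.mk ⟨T, rfl⟩⟩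
  else ⟨⟨0, by simp⟩, TreeSpace.mk ⟨.vertex .nil, rfl⟩⟩

namespace PlanarTree

open TopOperad

variable {N : ℕ∞}

lemma cls_eq {T : PlanarTree I} {n : ℕ} (h : InRange N n) (hT : T.leaves = n) :
    T.cls N = ⟨⟨n, h⟩, TreeSpace.mk ⟨T, hT⟩⟩ := by
  subst hT
  exact dif_pos h

lemma deg_cls {T : PlanarTree I} (h : InRange N T.leaves) : (T.cls N).deg = T.leaves := by
  rw [cls_eq h rfl]; rfl

lemma cls_graft {T T' : PlanarTree I} {i : ℕ} (hi : i < T.leaves) (h : InRange N T.leaves)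
    (h' : InRange N T'.leaves) (hN : InRange N (T.leaves + T'.leaves - 1)) :
    (T.graft i T').cls N = El.comp (T.cls N) i (T'.cls N) := by
  have := T.leaves_graft T' i hi
  rw [cls_eq h rfl, cls_eq h' rfl, cls_eq hN (by omega)]
  exact (El.comp_mk (O := treeOperad.truncate N le_top) (n := ⟨_, h⟩) (m := ⟨_, h'⟩) (k := ⟨_, hN⟩)
    ⟨i, hi⟩ (by simp only; omega) (TreeSpace.mk ⟨T, rfl⟩) (TreeSpace.mk ⟨T', rfl⟩)).symm

/-- A map from trees to elements of an operad that is compatible with grafting is compatible with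
simultaneous grafting. -/
lemma graftAll_of_graft {O : TopOperad N} {E : PlanarTree I → O.El} {Q : PlanarTree I → Prop}
    (hQ : ∀ {T T' i}, i < leaves T → Q T → Q T' → Q (T.graft i T'))
    (hdeg : ∀ {T}, Q T → InRange N T.leaves → (E T).deg = T.leaves)
    (hE : ∀ {T T' i}, i < leaves T → Q T → Q T' → InRange N T.leaves → InRange N T'.leaves →
      InRange N (T.leaves + T'.leaves - 1) → E (T.graft i T') = El.comp (E T) i (E T'))
    {X : PlanarForest I} {p : ℕ} {ys : List (PlanarTree I)} (hQX : Q (vertex X))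
    (hQys : ∀ y ∈ ys, Q y) (hX : InRange N X.leaves) (hp : p + ys.length ≤ X.leaves)
    (hN : InRange N (X.leaves + (ys.map leaves).sum - ys.length))
    (hys : ∀ y ∈ ys, InRange N y.leaves) :
    E (vertex (X.graftAll p ys)) = El.gam (E (vertex X)) p (ys.map E) ∧
      Q (vertex (X.graftAll p ys)) := by
  induction ys generalizing X p with
  | nil => exact ⟨rfl, hQX⟩
  | cons y ys ih =>
    simp only [List.mem_cons, forall_eq_or_imp, List.length_cons, List.map_cons,
      List.sum_cons] at *
    obtain ⟨hy, hys⟩ := hys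
    obtain ⟨hQy, hQys⟩ := hQys
    have key := PlanarForest.leaves_graftAll (X := X) (p := p + 1) (ys := ys) (by omega)
    cases y with
    | triv =>
      have hd := hdeg hQy hy
      have e1 : triv.leaves (L := I) = 1 := rfl
      rw [El.gam_cons_pos (by rw [hd, e1]; simp)]
      have h2 := ih hQX hQys hX (by omega) (hN.mono (by omega)) hys (p := p + 1)
      have h1 := hE (T := vertex (X.graftAll (p + 1) ys)) (T' := triv) (i := p)
        (by simp only [leaves]; omega) h2.2 hQy (hN.mono (by simp only [leaves]; omega)) hy
        (hN.mono (by simp only [leaves]; omega))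
      rw [← h2.1, ← h1]
      exact ⟨rfl, h2.2⟩
    | vertex G =>
      have hd := hdeg hQy hy
      have e1 : (vertex G).leaves = G.leaves := rfl
      simp only [PlanarForest.graftAll]
      split_ifs with hG
      · rw [El.gam_cons_zero (by rw [hd, e1, hG])]
        have h2 := X.leaves_graft G p (by omega)
        have hlt : p < (vertex X).leaves := by simp only [leaves]; omega
        have h3 := hE (T := vertex X) (T' := vertex G) hlt hQX hQy hX hy
          (hX.mono (by simp only [leaves]; omega))
        have h4 := hQ hlt hQX hQy
        rw [← h3]
        exact ih (X := X.graft p G) h4 hQys (hX.mono (by omega)) (by omega) (hN.mono (by omega)) hys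
      · have h2 := ih hQX hQys hX (by omega) (hN.mono (by omega)) hys (p := p + 1)
        have hlt : p < (vertex (X.graftAll (p + 1) ys)).leaves := by simp only [leaves]; omega
        rw [El.gam_cons_pos (by rwa [hd, e1]), ← h2.1]
        exact ⟨hE hlt h2.2 hQy (hN.mono (by simp only [leaves]; omega)) hy
          (hN.mono (by simp only [leaves]; omega)), hQ hlt h2.2 hQy⟩

/-- The value of `E` on a specialized tree is composed along the cuts of the unspecialized one. Used
for families of trees, this is what makes continuity of `E` a question about single components. -/
lemma map_of_graft {O : TopOperad N} {E : PlanarTree I → O.El} {Q : PlanarTree I → Prop}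
    (hQ : ∀ {T T' i}, i < leaves T → Q T → Q T' → Q (T.graft i T'))
    (hdeg : ∀ {T}, Q T → InRange N T.leaves → (E T).deg = T.leaves)
    (hE : ∀ {T T' i}, i < leaves T → Q T → Q T' → InRange N T.leaves → InRange N T'.leaves →
      InRange N (T.leaves + T'.leaves - 1) → E (T.graft i T') = El.comp (E T) i (E T'))
    {L : Type} [One L] {f : L → I} (h1 : f 1 = 1) {F : PlanarForest L}
    (hQF : Q (vertex (F.root.map f))) (hQF' : ∀ T ∈ F.subs, Q (T.map f))
    (hF : InRange N F.leaves) (hF' : InRange N F.root.leaves) :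
    E (vertex (F.map f)) =
      El.gam (E (vertex (F.root.map f))) 0 (F.subs.map fun T => E (T.map f)) := by
  rw [F.map_eq_graftAll h1, (graftAll_of_graft hQ hdeg hE hQF _ _ _ _ _).1]
  · simp [Function.comp_def]
  · simpa using hQF'
  · rwa [PlanarForest.leaves_map]
  · simp [PlanarForest.leaves_map, PlanarForest.length_subs]
  · refine hF.mono ?_
    have := F.sum_leaves_subs
    simp only [PlanarForest.leaves_map, List.map_map, Function.comp_def, leaves_map, this,
      List.length_map, F.length_subs]
    omega
  · simp only [List.mem_map]
    rintro _ ⟨T, hT, rfl⟩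
    rw [leaves_map]
    exact hF.mono (PlanarForest.leaves_le_of_mem_subs hT)

lemma cls_vertex {F : PlanarForest I} (hF : InRange N F.leaves) (hF' : InRange N F.root.leaves) :
    (vertex F).cls N = El.gam ((vertex F.root).cls N) 0 (F.subs.map (cls N)) := by
  have := map_of_graft (E := cls N) (Q := fun _ => True) (fun _ _ _ => trivial) (fun _ => deg_cls)
    (fun hi _ _ => cls_graft hi) (f := fun ℓ => ℓ) rfl trivial (fun _ _ => trivial) hF hF'
  have e : (fun T : PlanarTree I => (T.map fun ℓ => ℓ).cls N) = cls N := by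
    funext T
    cases T with
    | triv => rfl
    | vertex F => rw [PlanarTree.map, PlanarForest.map_id]
  rwa [PlanarForest.map_id, PlanarForest.map_id, e] at this

lemma cls_triv (h : InRange N 1) : triv.cls N = El.one h := cls_eq h rfl

lemma cls_eq_of_equivalent {T T' : PlanarTree I} (h : T.Equivalent T') : T.cls N = T'.cls N := by
  by_cases hN : InRange N T.leaves
  · rw [cls_eq hN rfl, cls_eq hN h.leaves_eq.symm]
    exact congrArg _ (TreeSpace.mk_eq_of_equivalent h _ _)
  · have hN' : ¬ InRange N T'.leaves := by rwa [← h.leaves_eq]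
    have key : ∀ {T : PlanarTree I}, ¬ InRange N T.leaves → T.cls N =
      ⟨⟨0, by simp⟩, TreeSpace.mk ⟨.vertex .nil, rfl⟩⟩ := fun h => dif_neg h
    rw [key hN, key hN']

lemma generated_of_good {S : ℕ → ℕ → Prop} {F : PlanarForest I} (h : F.Good S)
    (hF : F.All (· ≠ 1)) : Generated treeOperad (primeTrees S) (deg F.leaves)
      (TreeSpace.mk ⟨vertex F, rfl⟩) := by
  obtain ⟨T, hT, hT'⟩ := exists_prime hF
  have hok := (ok_of_step (S := S) (T := vertex F) (T' := T))
  have hl : T.leaves = F.leaves := hT.leaves_eq.symm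
  rw [show (TreeSpace.mk ⟨vertex F, rfl⟩ : treeOperad.X (deg F.leaves)) = TreeSpace.mk ⟨T, hl⟩ from
    -- A single component is replaced by its reduced form, which is the identity or a generator.
    TreeSpace.mk_eq_of_equivalent hT rfl hl]
  rcases hT' with rfl | hT'
  · have h1 : ∀ n (h : triv.leaves = n),
        Generated treeOperad (primeTrees S) (deg n) (TreeSpace.mk ⟨triv, h⟩) := by
      rintro n rfl
      exact .one le_top
    exact h1 _ _
  · refine .of _ ⟨⟨T, hl⟩, hT', ?_, rfl⟩
    cases T with
    | triv => exact hT'.elim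
    | vertex F' =>
      have h2 := hT'.type (S := S)
      have h3 : (vertex F').Ok S := by
        have : ∀ {T T' : PlanarTree I}, T.Equivalent T' → (T.Ok S ↔ T'.Ok S) := by
          intro T T' h
          induction h with
          | rel _ _ h => exact ok_of_step h
          | refl => rfl
          | symm _ _ _ ih => exact ih.symm
          | trans _ _ _ _ _ ih ih' => exact ih.trans ih'
        exact (this hT).1 ⟨h, PlanarForest.ok_of_all hF⟩
      rw [← h2.1, ← h2.2.1]
      exact h3.1.resolve_right h2.2.2.2.2

lemma generated_of_ok {S : ℕ → ℕ → Prop} (T : PlanarTree I) (h : T.Ok S) :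
    Generated treeOperad (primeTrees S) (deg T.leaves) (TreeSpace.mk ⟨T, rfl⟩) := by
  have key : ∀ T : PlanarTree I, T.Ok S →
      Generated treeOperad (primeTrees S) (T.cls ⊤).1 (T.cls ⊤).2 := by
    refine PlanarForest.cut_induction (fun _ => ?_) fun F ih h => ?_
    · rw [cls_triv le_top]
      exact .one le_top
    · rw [cls_vertex le_top le_top]
      refine El.gam_induction (O := treeOperad.truncate ⊤ le_top)
        (Q := fun x => Generated treeOperad (primeTrees S) x.1 x.2) ?_ ?_ ?_
      · intro x i y hx hy
        by_cases h : i < x.deg ∧ InRange ⊤ (x.deg + y.deg - 1)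
        · rw [El.comp_of_pos h]
          exact .comp (O := treeOperad) (n := x.1) (m := y.1) (k := ⟨x.deg + y.deg - 1, h.2⟩)
            ⟨i, h.1⟩ (by have := h.1; unfold El.deg at *; simp only; omega) x.2 y.2 hx hy
        · rw [El.comp_of_neg h]
          exact hx
      · rw [cls_eq le_top rfl]
        refine generated_of_good ?_ F.all_root
        have := h.1
        rwa [PlanarForest.Good, PlanarForest.rootUni, PlanarForest.ends_root,
          PlanarForest.uni_root]
      · simp only [List.mem_map]
        rintro _ ⟨T, hT, rfl⟩
        exact ih T hT (PlanarForest.ok_subs h.2 T hT)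
  have := key T h
  rwa [cls_eq le_top rfl] at this

end PlanarTree

/-- One direction holds because `Ok` passes to grafts, the other one by induction along cuts: the
component next to the root reduces to a generator or to the identity, and the tree is its
composition with the trees above it. -/
lemma generated_iff_ok {S : ℕ → ℕ → Prop} {c : Color ⊤} (x : treeOperad.X c) :
    TopOperad.Generated treeOperad (primeTrees S) c x ↔ TreeSpace.Ok S x := by
  refine ⟨ok_of_generated, fun h => ?_⟩
  induction x using Quot.ind with | mk T =>
  obtain ⟨T, hT⟩ := T
  obtain ⟨c, hc⟩ := c
  simp only at hT
  subst hT
  exact T.generated_of_ok h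

/-! ## Continuity on the space of trees with restricted prime components -/

namespace PlanarForest

variable {Q : Type} [TopologicalSpace Q]

/-- The face of the parameter space of a family of trees that is given by those edges that have
length `0` or `1` at the parameter `c₀`. -/
def face (F : PlanarForest C(Q, I)) (c₀ : Q) : Set Q :=
  {c | F.All fun ℓ => (ℓ c₀ = 0 → ℓ c = 0) ∧ (ℓ c₀ = 1 → ℓ c = 1)}

lemma isClosed_face (F : PlanarForest C(Q, I)) (c₀ : Q) : IsClosed (F.face c₀) := by
  induction F with
  | nil => exact isClosed_univ
  | leaf B ih => exact ih
  | node ℓ A B ihA ihB =>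
    have h : ∀ a : I, IsClosed {c : Q | ℓ c₀ = a → ℓ c = a} := fun a => by
      by_cases h : ℓ c₀ = a
      · simpa [h] using isClosed_eq ℓ.continuous continuous_const
      · simp [h]
    exact ((h 0).inter (h 1)).inter (ihA.inter ihB)

lemma mem_face (F : PlanarForest C(Q, I)) (c₀ : Q) : c₀ ∈ F.face c₀ := by
  induction F with
  | nil => trivial
  | leaf B ih => exact ih
  | node ℓ A B ihA ihB => exact ⟨⟨id, id⟩, ihA, ihB⟩

/-- Each edge contributes only the conditions that it has length 0, length 1, or none, and there are
finitely many edges. -/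
lemma finite_range_face (F : PlanarForest C(Q, I)) : (Set.range F.face).Finite := by
  induction F with
  | nil => exact (Set.finite_singleton Set.univ).subset (by rintro _ ⟨c, rfl⟩; rfl)
  | leaf B ih => exact ih
  | node ℓ A B ihA ihB =>
    have h : ∀ a : I, (Set.range fun c₀ : Q => {c : Q | ℓ c₀ = a → ℓ c = a}).Finite := by
      intro a
      refine (Set.toFinite {{c : Q | ℓ c = a}, Set.univ}).subset ?_
      rintro _ ⟨c, rfl⟩
      by_cases h : ℓ c = a <;> simp [h]
    refine (((h 0).image2 (· ∩ ·) (h 1)).image2 (· ∩ ·) (ihA.image2 (· ∩ ·) ihB)).subset ?_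
    rintro _ ⟨c, rfl⟩
    exact ⟨_, ⟨_, ⟨c, rfl⟩, _, ⟨c, rfl⟩, rfl⟩, _, ⟨_, ⟨c, rfl⟩, _, ⟨c, rfl⟩, rfl⟩, rfl⟩

/-- The restriction of a family to a subset of the parameter space. -/
def restrict (F : PlanarForest C(Q, I)) (s : Set Q) : PlanarForest C(s, I) :=
  F.map fun ℓ => ℓ.restrict s

/-- On the face of `c₀` a length is identically 0 or 1 as soon as it is so at `c₀`. Therefore the
generic type over the face is the type at `c₀`. -/
lemma reflect_restrict_face (F : PlanarForest C(Q, I)) (c₀ : Q) :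
    (F.restrict (F.face c₀)).All fun ℓ =>
      (ℓ ⟨c₀, F.mem_face c₀⟩ = 0 ↔ ℓ = 0) ∧ (ℓ ⟨c₀, F.mem_face c₀⟩ = 1 ↔ ℓ = 1) := by
  rw [restrict, all_map]
  have key : ∀ (G : PlanarForest C(Q, I)) (s : Set Q) (hc : c₀ ∈ s), s ⊆ G.face c₀ →
      G.All fun ℓ => (ℓ.restrict s ⟨c₀, hc⟩ = 0 ↔ ℓ.restrict s = 0) ∧
        (ℓ.restrict s ⟨c₀, hc⟩ = 1 ↔ ℓ.restrict s = 1) := by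
    intro G s hc hs
    induction G with
    | nil => trivial
    | leaf B ih => exact ih hs
    | node ℓ A B ihA ihB =>
      refine ⟨⟨⟨fun h => ?_, fun h => ?_⟩, ⟨fun h => ?_, fun h => ?_⟩⟩,
        ihA fun c hc => (hs hc).2.1, ihB fun c hc => (hs hc).2.2⟩
      · ext c; exact congrArg Subtype.val ((hs c.2).1.1 h)
      · rw [h]; rfl
      · ext c; exact congrArg Subtype.val ((hs c.2).1.2 h)
      · rw [h]; rfl
  exact key F _ _ subset_rfl

end PlanarForest

namespace TreeSpace

variable {n : ℕ} {S : ℕ → ℕ → Prop}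

/-- The faces of the admissible parameters do the job: their generic types are those at the
parameters that define them, and all other points of such a face are specializations, hence again
admissible as `S` is closed downwards. -/
lemma exists_face_cover (hS : LexLower S) {Q : Type} [TopologicalSpace Q]
    (T : PlanarTree C(Q, I)) : ∃ Φ : Set (Set Q), Φ.Finite ∧ (∀ s ∈ Φ, IsClosed s) ∧
      (∀ s ∈ Φ, (T.map fun ℓ => ℓ.restrict s).Ok S) ∧ {c | (T.at' c).Ok S} = ⋃₀ Φ := by
  cases T with
  | triv =>
    refine ⟨{Set.univ}, Set.finite_singleton _, by simp, ?_, by simp [PlanarTree.at',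
      PlanarTree.map, PlanarTree.Ok]⟩
    simp [PlanarTree.map, PlanarTree.Ok]
  | vertex F =>
    have key : ∀ c₀, (F.at' c₀).Good S ∧ (F.at' c₀).Ok S →
        (F.restrict (F.face c₀)).Good S ∧ (F.restrict (F.face c₀)).Ok S := by
      intro c₀ h
      have h1 := F.reflect_restrict_face c₀
      rw [← PlanarForest.good_map h1, ← PlanarForest.ok_map h1, PlanarForest.restrict,
        PlanarForest.map_map]
      exact h
    refine ⟨F.face '' {c | ((PlanarTree.vertex F).at' c).Ok S}, ?_, ?_, ?_, ?_⟩
    · exact F.finite_range_face.subset (Set.image_subset_range _ _)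
    · rintro _ ⟨c, -, rfl⟩; exact F.isClosed_face c
    · rintro _ ⟨c, hc, rfl⟩; exact key c hc
    · ext c
      constructor
      · exact fun hc => ⟨_, ⟨c, hc, rfl⟩, F.mem_face c⟩
      · rintro ⟨_, ⟨c₀, hc₀, rfl⟩, hc⟩
        have h1 : (PlanarTree.vertex (F.restrict (F.face c₀))).Ok S := key c₀ hc₀
        have h2 := h1.map_of_ok (f := fun ℓ => ℓ ⟨c, hc⟩) hS rfl rfl zero_ne_one
        simpa [PlanarTree.map, PlanarForest.restrict, PlanarForest.map_map, PlanarTree.at'] using h2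

/-- A map out of the space of trees with prime components in `S` is continuous if it is continuous
along the families of trees (of constant shape) for which the types of the generic prime components
are in `S`. -/
lemma continuous_of_families (hS : LexLower S) {Y : Type} [TopologicalSpace Y]
    (f : {x : TreeSpace n // x.Ok S} → Y)
    (hf : ∀ (K : Type) [TopologicalSpace K] [CompactSpace K] [T2Space K] (T : PlanarTree C(K, I))
      (hT : T.leaves = n) (_ : T.Ok S) (h' : ∀ t, (T.at' t).Ok S),
      Continuous fun t => f ⟨mk ⟨T.at' t, (T.leaves_at' t).trans hT⟩, h' t⟩) :
    Continuous f := by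
  refine continuous_of_cubes f (fun s hs => ?_) (fun s hs => ?_)
  · obtain ⟨T, hT⟩ := s.exists_taut
    obtain ⟨Φ, hΦ, hcl, -, hΦ'⟩ := exists_face_cover hS T
    have : IsClosed {c | (T.at' c).Ok S} := by
      rw [hΦ', Set.sUnion_eq_biUnion]
      exact hΦ.isClosed_biUnion hcl
    convert this using 2
    ext c
    rw [hT]
    rfl
  · obtain ⟨T, hT⟩ := s.exists_taut
    obtain ⟨Φ, hΦ, hcl, hok, hΦ'⟩ := exists_face_cover hS T
    have hTl : T.leaves = n := by
      by_cases h : Nonempty s.Cube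
      · obtain ⟨c⟩ := h
        rw [← T.leaves_at' c, hT, PlanarTree.leaves_fill, hs]
      · exact (h ⟨cubeDefault s⟩).elim
    have : Finite Φ := hΦ
    let Z := {c : s.Cube // (proj n ⟨⟨s, hs⟩, c⟩).Ok S}
    have hZ : ∀ c : s.Cube, (proj n ⟨⟨s, hs⟩, c⟩).Ok S ↔ (T.at' c).Ok S := fun c => by
      rw [hT]; rfl
    -- The admissible part of the cube is a finite union of closed faces, so continuity can be
    -- checked on each face.
    refine (locallyFinite_of_finite (fun a : Φ => (Subtype.val ⁻¹' a.1 : Set Z))).continuous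
      ?_ ?_ ?_
    · refine Set.eq_univ_of_forall fun c => ?_
      have : c.1 ∈ {c | (T.at' c).Ok S} := (hZ c.1).1 c.2
      rw [hΦ'] at this
      obtain ⟨a, ha, hc⟩ := this
      exact Set.mem_iUnion.2 ⟨⟨a, ha⟩, hc⟩
    · exact fun a => (hcl a.1 a.2).preimage continuous_subtype_val
    · rintro ⟨a, ha⟩
      -- A closed face of a cube is compact Hausdorff, as the hypothesis on families requires.
      have : CompactSpace a := isCompact_iff_compactSpace.1 (hcl a ha).isCompact
      have hl : (T.map fun ℓ => ℓ.restrict a).leaves = n := by rw [PlanarTree.leaves_map, hTl]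
      have e : ∀ t : a, (T.map fun ℓ => ℓ.restrict a).at' t = T.at' t.1 := by
        intro t
        cases T with
        | triv => rfl
        | vertex F => exact congrArg PlanarTree.vertex (F.map_map _ _)
      have h' : ∀ t : a, ((T.map fun ℓ => ℓ.restrict a).at' t).Ok S := by
        intro t
        rw [e]
        have : t.1 ∈ ⋃₀ Φ := ⟨a, ha, t.2⟩
        rwa [← hΦ'] at this
      have h1 := hf a (T.map fun ℓ => ℓ.restrict a) hl (hok a ha) h'
      rw [continuousOn_iff_continuous_domRestrict]
      let val : Z → s.Cube := Subtype.val
      have h2 : Continuous fun c : (Subtype.val ⁻¹' a : Set Z) => (⟨val c.1, c.2⟩ : a) :=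
        (continuous_subtype_val.comp continuous_subtype_val).subtype_mk _
      refine (h1.comp h2).congr fun c => ?_
      refine congrArg f (Subtype.ext (congrArg mk (Subtype.ext ?_)))
      exact (e _).trans (hT _)
where
  cubeDefault' : ∀ s : PlanarForest Unit, s.Cube
    | .nil => ()
    | .leaf B => cubeDefault' B
    | .node _ A B => (0, cubeDefault' A, cubeDefault' B)
  cubeDefault : ∀ s : PlanarTree Unit, s.Cube
    | .triv => ()
    | .vertex F => cubeDefault' F

end TreeSpace

/-! ## The truncated filtration terms -/

namespace TopOperad

/-- The restriction of a morphism to a range of degrees. -/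
def truncateMap {N : ℕ∞} {A B : TopOperad N} (f : A ⟶ B) (M : ℕ∞) (hM : M ≤ N) :
    A.truncate M hM ⟶ B.truncate M hM :=
  (show Hom (A.truncate M hM) (B.truncate M hM) from
  { app := fun c => Hom.app f ⟨c.1, c.2.trans hM⟩
    map_comp := fun i h x y => Hom.map_comp f (n := ⟨_, _⟩) (m := ⟨_, _⟩) (k := ⟨_, _⟩) i h x y
    map_one := fun h => Hom.map_one f (h.trans hM) })

end TopOperad

open TopOperad

/-- The operad of metric trees, in degrees up to `N`. -/
abbrev truncTrees (N : ℕ∞) : TopOperad N := treeOperad.truncate N le_top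

/-- The suboperad generated by the prime trees of a type in `S`, in degrees up to `N`. -/
abbrev truncGen (S : ℕ → ℕ → Prop) (N : ℕ∞) : TopOperad N :=
  (treeOperad.generated (primeTrees S)).truncate N le_top

/-- The inclusion. -/
abbrev truncGenι (S : ℕ → ℕ → Prop) (N : ℕ∞) : truncGen S N ⟶ truncTrees N :=
  truncateMap (treeOperad.generatedι (primeTrees S)) N le_top

/-- The inclusion of one such suboperad into another one. -/
abbrev truncIncl {S S' : ℕ → ℕ → Prop} (h : ∀ e u, S e u → S' e u) (N : ℕ∞) :
    truncGen S N ⟶ truncGen S' N :=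
  truncateMap (treeOperad.generatedIncl (primeTrees_mono h)) N le_top

section

variable {N : ℕ∞} {S : ℕ → ℕ → Prop}

/-- A tree as an element of a suboperad. -/
def toTruncGen {c : Color N} (x : TreeSpace c.1) (hx : x.Ok S) : (truncGen S N).X c :=
  GeneratedCarrier.mk x ((generated_iff_ok (c := ⟨c.1, le_top⟩) x).2 hx)

lemma ok_of_truncGen {c : Color N} (x : (truncGen S N).X c) :
    TreeSpace.Ok S (Hom.app (truncGenι S N) c x) :=
  ok_of_generated (GeneratedCarrier.property x)

lemma continuous_toTruncGen {c : Color N} {K : Type} [TopologicalSpace K] [CompactSpace K]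
    [T2Space K] {f : K → TreeSpace c.1} (hf : Continuous f) (h : ∀ t, (f t).Ok S) :
    Continuous fun t => (toTruncGen (f t) (h t) : (truncGen S N).X c) :=
  GeneratedCarrier.continuous_mk (O := treeOperad) (G := primeTrees S) (c := ⟨c.1, le_top⟩) K f hf _

lemma truncGenι_injective {c : Color N} : Function.Injective (Hom.app (truncGenι S N) c) :=
  fun _ _ h => GeneratedCarrier.ext h

lemma map_truncGenι_injective :
    Function.Injective (El.map (truncGenι S N)) := by
  rintro ⟨c, x⟩ ⟨c', x'⟩ h
  obtain ⟨h1, h⟩ := Sigma.mk.inj_iff.1 h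
  simp only at h1
  subst h1
  exact congrArg (Sigma.mk _) (truncGenι_injective (eq_of_heq h))

open Classical in
/-- The class of a tree in a suboperad. -/
noncomputable def PlanarTree.clsGen (S : ℕ → ℕ → Prop) {N : ℕ∞} (hN : InRange N 1)
    (T : PlanarTree I) : (truncGen S N).El :=
  if h : InRange N T.leaves ∧ T.Ok S then ⟨⟨T.leaves, h.1⟩, toTruncGen (TreeSpace.mk ⟨T, rfl⟩) h.2⟩
  else El.one hN

lemma PlanarTree.map_clsGen (hN : InRange N 1) {T : PlanarTree I} (h : InRange N T.leaves)
    (h' : T.Ok S) : El.map (truncGenι S N) (T.clsGen S hN) = T.cls N := by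
  have : T.clsGen S hN = ⟨⟨T.leaves, h⟩, toTruncGen (TreeSpace.mk ⟨T, rfl⟩) h'⟩ := dif_pos ⟨h, h'⟩
  rw [this, cls_eq h rfl]
  rfl

lemma PlanarTree.clsGen_eq (hN : InRange N 1) {T : PlanarTree I} (h : InRange N T.leaves)
    (h' : T.Ok S) {n : ℕ} (hT : T.leaves = n) : T.clsGen S hN =
      ⟨⟨n, hT ▸ h⟩, toTruncGen (c := ⟨n, hT ▸ h⟩) (TreeSpace.mk ⟨T, hT⟩) h'⟩ := by
  subst hT
  exact dif_pos ⟨h, h'⟩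

lemma ok_root {F : PlanarForest I} (h : (PlanarTree.vertex F).Ok S) :
    (PlanarTree.vertex F.root).Ok S := by
  refine ⟨?_, PlanarForest.ok_of_all F.all_root⟩
  have := h.1
  rwa [PlanarForest.Good, PlanarForest.rootUni, PlanarForest.ends_root, PlanarForest.uni_root]

lemma PlanarTree.clsGen_vertex (hN : InRange N 1) {F : PlanarForest I} (hF : InRange N F.leaves)
    (hF' : InRange N F.root.leaves) (h : (PlanarTree.vertex F).Ok S) :
    (vertex F).clsGen S hN =
      El.gam ((vertex F.root).clsGen S hN) 0 (F.subs.map (clsGen S hN)) := by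
  apply map_truncGenι_injective
  rw [map_clsGen (T := vertex F) hN hF h, El.map_gam,
    map_clsGen (T := vertex F.root) hN hF' (ok_root h), cls_vertex hF hF',
    List.map_map]
  congr 1
  refine List.map_congr_left fun T hT => (map_clsGen hN ?_ ?_).symm
  · exact hF.mono (PlanarForest.leaves_le_of_mem_subs hT)
  · exact PlanarForest.ok_subs h.2 T hT

/-- The component next to the root has at most `max 1 F.ends` leaves. If the types in `S` have their
first entry in the range, it is thus an element of the truncated operad, whatever the degree of the
whole tree. -/
lemma inRange_root (hN : InRange N 1) (hr : ∀ e u, S e u → InRange N e) {L : Type} [Zero L] [One L]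
    {F : PlanarForest L} (h : F.Good S) : InRange N F.root.leaves := by
  have h1 := F.leaves_root_add_uni
  rcases h with h | h
  · exact (hr _ _ h).mono (by omega)
  · exact hN.mono (by omega)

/-- Two morphisms out of a suboperad agree if they agree on the prime trees. -/
lemma truncGen_hom_ext (hN : InRange N 1) (hr : ∀ e u, S e u → InRange N e) {C : TopOperad N}
    {f g : truncGen S N ⟶ C} (h : ∀ (c : Color N) (x : (truncGen S N).X c),
      Hom.app (truncGenι S N) c x ∈ primeTrees S ⟨c.1, le_top⟩ → Hom.app f c x = Hom.app g c x) :
    f = g := by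
  have key : ∀ T : PlanarTree I, T.Ok S → InRange N T.leaves →
      El.map f (T.clsGen S hN) = El.map g (T.clsGen S hN) := by
    refine PlanarForest.cut_induction (fun _ _ => ?_) fun F ih hok hl => ?_
    · have : (PlanarTree.triv).clsGen S hN = El.one hN := dif_pos ⟨hN, trivial⟩
      rw [this, El.map_one, El.map_one]
    · have hF' := inRange_root hN hr hok.1
      rw [PlanarTree.clsGen_vertex hN hl hF' hok, El.map_gam, El.map_gam]
      have h1 : El.map f ((PlanarTree.vertex F.root).clsGen S hN) =
          El.map g ((PlanarTree.vertex F.root).clsGen S hN) := by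
        -- The component next to the root need not be reduced; its reduced form is the identity or a
        -- prime tree, to which the hypothesis applies.
        obtain ⟨T, hT, hT'⟩ := PlanarTree.exists_prime F.all_root
        have h2 : ∀ T T' : PlanarTree I, T.Equivalent T' → (T.Ok S ↔ T'.Ok S) := by
          intro T T' h
          induction h with
          | rel _ _ h => exact PlanarTree.ok_of_step h
          | refl => rfl
          | symm _ _ _ ih => exact ih.symm
          | trans _ _ _ _ _ ih ih' => exact ih.trans ih'
        have hTok : T.Ok S := (h2 _ _ hT).1 (ok_root hok)
        have h3 : (PlanarTree.vertex F.root).clsGen S hN = T.clsGen S hN := by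
          apply map_truncGenι_injective
          rw [PlanarTree.map_clsGen (T := .vertex F.root) hN hF' (ok_root hok), PlanarTree.map_clsGen hN _ hTok,
            PlanarTree.cls_eq_of_equivalent hT]
          rw [← hT.leaves_eq]
          exact hF'
        have hTl : InRange N T.leaves := by rw [← hT.leaves_eq]; exact hF'
        rw [h3]
        rcases hT' with rfl | hT'
        · have : (PlanarTree.triv).clsGen S hN = El.one hN := dif_pos ⟨hN, trivial⟩
          rw [this, El.map_one, El.map_one]
        · rw [PlanarTree.clsGen_eq hN hTl hTok rfl]
          refine congrArg (Sigma.mk _) (h _ _ ⟨⟨T, rfl⟩, hT', ?_, rfl⟩)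
          cases T with
          | triv => exact hT'.elim
          | vertex F' =>
            have h4 := hT'.type (S := S)
            simp only
            rw [← h4.1, ← h4.2.1]
            exact hTok.1.resolve_right h4.2.2.2.2
      rw [h1, List.map_map, List.map_map]
      congr 1
      refine List.map_congr_left fun T hT => ih T hT (PlanarForest.ok_subs hok.2 T hT) ?_
      exact hl.mono (PlanarForest.leaves_le_of_mem_subs hT)
  refine Hom.ext (funext fun c => ContinuousMap.ext fun x => ?_)
  have h1 := ok_of_truncGen x
  obtain ⟨c, hc⟩ := c
  obtain ⟨⟨T, hT⟩, h2⟩ := Quot.exists_rep (Hom.app (truncGenι S N) ⟨c, hc⟩ x)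
  simp only at hT
  subst hT
  have h3 : T.Ok S := by rw [← h2] at h1; exact h1
  have h4 := key T h3 hc
  rw [PlanarTree.clsGen_eq hN hc h3 rfl] at h4
  have h5 : x = toTruncGen (TreeSpace.mk ⟨T, rfl⟩) h3 := truncGenι_injective h2.symm
  rw [h5]
  exact eq_of_heq (Sigma.mk.inj_iff.1 h4).2

end

/-! ## Attaching cells of prime trees -/

/-- The pairs that precede `(n, i)` in the lexicographic order. -/
def LexLt (n i : ℕ) (e u : ℕ) : Prop := e < n ∨ (e = n ∧ u < i)

lemma PlanarForest.Ok.mono_orId {S S' : ℕ → ℕ → Prop} (h : ∀ e u, S e u → OrId S' e u)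
    {L : Type} [Zero L] [One L] {A : PlanarForest L} (hA : A.Ok S) : A.Ok S' := by
  induction A with
  | nil => trivial
  | leaf A ih => exact ih hA
  | node ℓ A A' ih ih' =>
    exact ⟨fun h' => (hA.1 h').elim (h _ _) .inr, ih hA.2.1, ih' hA.2.2⟩

lemma PlanarTree.Ok.mono_orId {S S' : ℕ → ℕ → Prop} (h : ∀ e u, S e u → OrId S' e u)
    {L : Type} [Zero L] [One L] : ∀ {T : PlanarTree L}, T.Ok S → T.Ok S'
  | .triv, _ => trivial
  | .vertex _, hA => ⟨hA.1.elim (h _ _) .inr, PlanarForest.Ok.mono_orId h hA.2⟩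

lemma TreeSpace.Ok.mono_orId {S S' : ℕ → ℕ → Prop} (h : ∀ e u, S e u → OrId S' e u) {n : ℕ}
    {x : TreeSpace n} (hx : x.Ok S) : x.Ok S' := by
  induction x using Quot.ind with | mk T => exact PlanarTree.Ok.mono_orId h hx

lemma PlanarTree.Equivalent.ok_iff {S : ℕ → ℕ → Prop} {T T' : PlanarTree I} (h : T.Equivalent T') :
    T.Ok S ↔ T'.Ok S := by
  induction h with
  | rel _ _ h => exact ok_of_step h
  | refl => rfl
  | symm _ _ _ ih => exact ih.symm
  | trans _ _ _ _ _ ih ih' => exact ih.trans ih'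

/-- A family of discs in the space of trees, whose interiors are disjoint and fill the set of prime
trees of type `(n, i)`, such that all families of trees of this type are families in the discs. -/
structure TreeCells (n i d : ℕ) (ι : Type) where
  char : ι → C(Disc d, TreeSpace (n - i))
  ok_of_boundary : ∀ j p, ‖p.1‖ = 1 → (char j p).Ok (LexLt n i)
  interior : ∀ x, (∃ j p, ‖p.1‖ < 1 ∧ char j p = x) ↔
    x ∈ primeTrees (fun e u => e = n ∧ u = i) (deg (n - i))
  inj : ∀ j p j' p', ‖p.1‖ < 1 → ‖p'.1‖ < 1 → char j p = char j' p' → j = j' ∧ p = p'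
  family : ∀ (K : Type) [TopologicalSpace K] [CompactSpace K] [T2Space K] (R : PlanarForest C(K, I)),
    R.All (· ≠ 1) → max 1 R.ends = n → R.rootUni = i → ∀ hR : R.leaves = n - i,
    ∃ (j : ι) (q : C(K, Disc d)), ∀ t, TreeSpace.mk ⟨(PlanarTree.vertex R).at' t,
      ((PlanarTree.vertex R).leaves_at' t).trans hR⟩ = char j (q t)

/-- `S'` arises from `S` by adding the type `(n, i)`. -/
structure IsStage (N : ℕ∞) (S S' : ℕ → ℕ → Prop) (n i : ℕ) : Prop where
  lower : LexLower S
  lower' : LexLower S'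
  le : ∀ e u, S e u → S' e u
  lt : ∀ e u, LexLt n i e u → OrId S e u
  -- Types with `u > e` belong to no tree, so they do not matter.
  cases : ∀ e u, S' e u → u ≤ e → OrId S e u ∨ (e = n ∧ u = i)
  mem : S' n i
  not_mem : ¬ OrId S n i
  one_le : 1 ≤ n
  range : ∀ e u, S' e u → InRange N e

namespace IsStage

variable {N : ℕ∞} {S S' : ℕ → ℕ → Prop} {n i : ℕ}

lemma inRange_one (h : IsStage N S S' n i) : InRange N 1 := (h.range _ _ h.mem).mono h.one_le

lemma inRange (h : IsStage N S S' n i) : InRange N (n - i) :=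
  (h.range _ _ h.mem).mono (Nat.sub_le _ _)

lemma range_left (h : IsStage N S S' n i) (e u : ℕ) (he : S e u) : InRange N e :=
  h.range e u (h.le e u he)

lemma good_cases (h : IsStage N S S' n i) {L : Type} [Zero L] [One L] {F : PlanarForest L}
    (hF : F.Good S') : F.Good S ∨ (max 1 F.ends = n ∧ F.rootUni = i) := by
  rcases hF with hF | hF
  · refine h.cases _ _ hF ?_
    unfold PlanarForest.rootUni
    have := F.uni_le_ends
    split_ifs <;> omega
  · exact .inl (.inr hF)

end IsStage

lemma PlanarForest.leaves_of_type {L : Type} [Zero L] [One L] {n i : ℕ} {F : PlanarForest L}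
    (hF : F.All (· ≠ 1)) (h : max 1 F.ends = n) (h' : F.rootUni = i) : F.leaves = n - i := by
  have := F.leaves_add_uni hF
  unfold rootUni at h'
  split_ifs at h' <;> omega

lemma PlanarForest.root_of_all {L : Type} [One L] {F : PlanarForest L} (hF : F.All (· ≠ 1)) :
    F.root = F ∧ F.subs = List.replicate F.leaves .triv := by
  induction F with
  | nil => exact ⟨rfl, rfl⟩
  | leaf B ih => simp [root, subs, ih hF, leaves, List.replicate_succ]
  | node ℓ A B ihA ihB =>
    have hℓ : ℓ ≠ 1 := hF.1
    simp only [root, subs, hℓ, if_false, ihA hF.2.1, ihB hF.2.2, leaves, List.replicate_add]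
    exact ⟨trivial, trivial⟩

lemma PlanarForest.root_append {L : Type} [One L] (A B : PlanarForest L) :
    (A.append B).root = A.root.append B.root := by
  induction A with
  | nil => rfl
  | leaf A ih => simp [append, root, ih]
  | node ℓ A A' _ ih => by_cases h : ℓ = 1 <;> simp [append, root, ih, h]

lemma PlanarTree.clsGen_eq_of_equivalent {N : ℕ∞} {S : ℕ → ℕ → Prop} (hN : InRange N 1)
    {T T' : PlanarTree I} (h : T.Equivalent T') : T.clsGen S hN = T'.clsGen S hN := by
  by_cases hT : InRange N T.leaves ∧ T.Ok S
  · have hT' : InRange N T'.leaves ∧ T'.Ok S := by rwa [← h.leaves_eq, ← h.ok_iff]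
    apply map_truncGenι_injective
    rw [map_clsGen hN hT.1 hT.2, map_clsGen hN hT'.1 hT'.2, cls_eq_of_equivalent h]
  · have hT' : ¬ (InRange N T'.leaves ∧ T'.Ok S) := by rwa [← h.leaves_eq, ← h.ok_iff]
    have key : ∀ {T : PlanarTree I}, ¬ (InRange N T.leaves ∧ T.Ok S) →
      T.clsGen S hN = El.one hN := fun h => dif_neg h
    rw [key hT, key hT']

/-! ### Extension of a morphism over the attached cells -/

section

variable {N : ℕ∞} {S S' : ℕ → ℕ → Prop} {n i d : ℕ} {ι : Type} (𝒞 : TreeCells n i d ι)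
  (h : IsStage N S S' n i) {C : TopOperad N} (g : truncGen S N ⟶ C)
  (φ : ι → C(Disc d, C.X ⟨n - i, h.inRange⟩))

open Classical in
/-- The map on trees that have at most one prime component, given by a morphism on a suboperad and
its values on cells. -/
noncomputable def cellBase (T : PlanarTree I) : C.El :=
  if T.Ok S then El.map g (T.clsGen S h.inRange_one)
  else if h' : ∃ (j : ι) (p : Disc d), ‖p.1‖ < 1 ∧ T.cls N = ⟨⟨n - i, h.inRange⟩, 𝒞.char j p⟩ then
    ⟨⟨n - i, h.inRange⟩, φ h'.choose h'.choose_spec.choose⟩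
  -- This default does not occur for a tree that is a single component of a type in `S'`: if it is
  -- not in the suboperad of `S`, then it is an interior point of a disc.
  else El.one h.inRange_one

lemma cellBase_of_ok {T : PlanarTree I} (hT : T.Ok S) :
    cellBase 𝒞 h g φ T = El.map g (T.clsGen S h.inRange_one) := if_pos hT

lemma cellBase_char {T : PlanarTree I} {j : ι} {p : Disc d} (hT : ¬ T.Ok S) (hp : ‖p.1‖ < 1)
    (hT' : T.cls N = ⟨⟨n - i, h.inRange⟩, 𝒞.char j p⟩) :
    cellBase 𝒞 h g φ T = ⟨⟨n - i, h.inRange⟩, φ j p⟩ := by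
  have h' : ∃ (j : ι) (p : Disc d), ‖p.1‖ < 1 ∧
    T.cls N = ⟨⟨n - i, h.inRange⟩, 𝒞.char j p⟩ := ⟨j, p, hp, hT'⟩
  have e : cellBase 𝒞 h g φ T = ⟨⟨n - i, h.inRange⟩, φ h'.choose h'.choose_spec.choose⟩ :=
    (if_neg hT).trans (dif_pos h')
  have h1 := h'.choose_spec.choose_spec
  have h2 := h1.2.symm.trans hT'
  have h3 := eq_of_heq (Sigma.mk.inj_iff.1 h2).2
  have h4 := 𝒞.inj _ _ _ _ h1.1 hp h3
  rw [e, h4.2, h4.1]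

lemma cellBase_congr {T T' : PlanarTree I} (hT : T.Equivalent T') :
    cellBase 𝒞 h g φ T = cellBase 𝒞 h g φ T' := by
  by_cases hok : T.Ok S
  · rw [cellBase_of_ok 𝒞 h g φ hok, cellBase_of_ok 𝒞 h g φ (hT.ok_iff.1 hok),
      PlanarTree.clsGen_eq_of_equivalent _ hT]
  have hok' : ¬ T'.Ok S := mt hT.ok_iff.2 hok
  by_cases hc : ∃ (j : ι) (p : Disc d), ‖p.1‖ < 1 ∧ T.cls N = ⟨⟨n - i, h.inRange⟩, 𝒞.char j p⟩
  · obtain ⟨j, p, hp, hc⟩ := hc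
    rw [cellBase_char 𝒞 h g φ hok hp hc, cellBase_char 𝒞 h g φ hok' hp
      ((PlanarTree.cls_eq_of_equivalent hT).symm.trans hc)]
  · have hc' : ¬ ∃ (j : ι) (p : Disc d), ‖p.1‖ < 1 ∧
        T'.cls N = ⟨⟨n - i, h.inRange⟩, 𝒞.char j p⟩ := by
      rwa [← PlanarTree.cls_eq_of_equivalent hT]
    have key : ∀ {T : PlanarTree I}, ¬ T.Ok S → (¬ ∃ (j : ι) (p : Disc d), ‖p.1‖ < 1 ∧
        T.cls N = ⟨⟨n - i, h.inRange⟩, 𝒞.char j p⟩) →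
        cellBase 𝒞 h g φ T = El.one h.inRange_one := fun h1 h2 => (if_neg h1).trans (dif_neg h2)
    rw [key hok hc, key hok' hc']

lemma cellBase_triv : cellBase 𝒞 h g φ .triv = El.one h.inRange_one := by
  rw [cellBase_of_ok]
  · have : (PlanarTree.triv).clsGen S h.inRange_one = El.one h.inRange_one :=
      dif_pos ⟨h.inRange_one, trivial⟩
    rw [this, El.map_one]
  · trivial

open Classical in
/-- The values on the trees over the component next to the root. -/
noncomputable def cellEvs : PlanarForest I → List C.El
  | .nil => []
  | .leaf B => El.one h.inRange_one :: cellEvs B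
  | .node ℓ A B =>
    if ℓ = 1 then El.gam (cellBase 𝒞 h g φ (.vertex A.root)) 0 (cellEvs A) :: cellEvs B
    else cellEvs A ++ cellEvs B

/-- The extension of the map to all trees. -/
noncomputable def cellEv : PlanarTree I → C.El
  | .triv => El.one h.inRange_one
  | .vertex F => El.gam (cellBase 𝒞 h g φ (.vertex F.root)) 0 (cellEvs 𝒞 h g φ F)

lemma cellEvs_eq (F : PlanarForest I) : cellEvs 𝒞 h g φ F = F.subs.map (cellEv 𝒞 h g φ) := by
  induction F with
  | nil => rfl
  | leaf B ih => simp [cellEvs, PlanarForest.subs, ih, cellEv]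
  | node ℓ A B ihA ihB =>
    by_cases hℓ : ℓ = 1 <;> simp [cellEvs, PlanarForest.subs, ihA, ihB, cellEv, hℓ]

lemma cellEv_vertex (F : PlanarForest I) : cellEv 𝒞 h g φ (.vertex F) =
    El.gam (cellBase 𝒞 h g φ (.vertex F.root)) 0 (F.subs.map (cellEv 𝒞 h g φ)) := by
  rw [← cellEvs_eq]; rfl

lemma cellEvs_append (A B : PlanarForest I) :
    cellEvs 𝒞 h g φ (A.append B) = cellEvs 𝒞 h g φ A ++ cellEvs 𝒞 h g φ B := by
  induction A with
  | nil => rfl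
  | leaf A ih => simp [PlanarForest.append, cellEvs, ih]
  | node ℓ A A' _ ih => by_cases hℓ : ℓ = 1 <;> simp [PlanarForest.append, cellEvs, ih, hℓ]

-- The values above the root component do not change, and that component changes only within its
-- class. The critical cases are bivalent vertices at a cut edge: there an identity component
-- appears or disappears, and its value is the identity of the operad.
open PlanarForest in
lemma cellEvs_step {F F' : PlanarForest I} (hF : PlanarForest.Step F F') :
    F.root.Equivalent F'.root ∧ cellEvs 𝒞 h g φ F = cellEvs 𝒞 h g φ F' := by
  have hb : ∀ {A A' : PlanarForest I}, A.Equivalent A' →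
      cellBase 𝒞 h g φ (.vertex A) = cellBase 𝒞 h g φ (.vertex A') := fun hA =>
    cellBase_congr 𝒞 h g φ (PlanarTree.Equivalent.vertex hA)
  have h1 : cellBase 𝒞 h g φ (.vertex (.leaf .nil)) = El.one h.inRange_one :=
    (cellBase_congr 𝒞 h g φ (.of_step .unary_leaf)).trans (cellBase_triv 𝒞 h g φ)
  induction hF with
  | contract A B =>
    rw [root_append, cellEvs_append]
    simp only [root, cellEvs, zero_ne_one_I, if_false]
    exact ⟨.of_step (.contract _ _), trivial⟩
  | unary_leaf ℓ B =>
    by_cases hℓ : ℓ = 1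
    · simp only [root, cellEvs, hℓ, if_true, h1, El.gam_one]
      exact ⟨.refl _, trivial⟩
    · simp only [root, cellEvs, hℓ, if_false]
      exact ⟨.of_step (.unary_leaf _ _), by simp⟩
  | unary_node ℓ ℓ' A B =>
    by_cases hℓ : ℓ = 1
    · have hm : max ℓ ℓ' = 1 := (max_eq_one_iff _ _).2 (.inl hℓ)
      by_cases hℓ' : ℓ' = 1
      · simp only [root, cellEvs, hm, if_true]
        simp only [hℓ, hℓ', if_true, h1, El.gam_one]
        exact ⟨.refl _, trivial⟩
      · simp only [root, cellEvs, hm, if_true]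
        simp only [hℓ, hℓ', if_true, if_false, List.append_nil]
        refine ⟨.refl _, ?_⟩
        rw [cellBase_congr 𝒞 h g φ (.of_step (.unary_node _ _))]
    · by_cases hℓ' : ℓ' = 1
      · have hm : max ℓ ℓ' = 1 := (max_eq_one_iff _ _).2 (.inr hℓ')
        simp only [root, cellEvs, hm, if_true]
        simp only [hℓ, hℓ', if_true, if_false]
        exact ⟨.of_step (.unary_leaf _ _), by simp⟩
      · have hm : max ℓ ℓ' ≠ 1 := fun e => ((max_eq_one_iff _ _).1 e).elim hℓ hℓ'
        simp only [root, cellEvs, hm, hℓ, hℓ', if_false]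
        exact ⟨.of_step (.unary_node _ _ _ _), by simp⟩
  | leaf hF ih => exact ⟨ih.1.leaf, congrArg (El.one h.inRange_one :: ·) ih.2⟩
  | node_left ℓ B hF ih =>
    by_cases hℓ : ℓ = 1
    · simp only [root, cellEvs, hℓ, if_true, ih.2, hb ih.1]
      exact ⟨.refl _, trivial⟩
    · simp only [root, cellEvs, hℓ, if_false, ih.2]
      exact ⟨.node _ ih.1 (.refl _), trivial⟩
  | node_right ℓ A hF ih =>
    by_cases hℓ : ℓ = 1
    · simp only [root, cellEvs, hℓ, if_true, ih.2]
      exact ⟨ih.1.leaf, trivial⟩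
    · simp only [root, cellEvs, hℓ, if_false, ih.2]
      exact ⟨.node _ (.refl _) ih.1, trivial⟩

lemma cellEv_step {T T' : PlanarTree I} (hT : PlanarTree.Step T T') :
    cellEv 𝒞 h g φ T = cellEv 𝒞 h g φ T' := by
  have h1 : cellBase 𝒞 h g φ (.vertex (.leaf .nil)) = El.one h.inRange_one :=
    (cellBase_congr 𝒞 h g φ (.of_step .unary_leaf)).trans (cellBase_triv 𝒞 h g φ)
  cases hT with
  | vertex hF =>
    have := cellEvs_step 𝒞 h g φ hF
    simp only [cellEv, this.2, cellBase_congr 𝒞 h g φ (PlanarTree.Equivalent.vertex this.1)]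
  | unary_leaf => simp [cellEv, PlanarForest.root, cellEvs, h1, El.gam_one]
  | unary_node ℓ A =>
    by_cases hℓ : ℓ = 1
    · simp [cellEv, PlanarForest.root, cellEvs, h1, El.gam_one, hℓ]
    · simp only [cellEv, PlanarForest.root, cellEvs, hℓ, if_false, List.append_nil]
      rw [cellBase_congr 𝒞 h g φ (.of_step (.unary_node _ _))]

lemma cellEv_congr {T T' : PlanarTree I} (hT : T.Equivalent T') :
    cellEv 𝒞 h g φ T = cellEv 𝒞 h g φ T' := by
  induction hT with
  | rel _ _ hT => exact cellEv_step 𝒞 h g φ hT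
  | refl => rfl
  | symm _ _ _ ih => exact ih.symm
  | trans _ _ _ _ _ ih ih' => exact ih.trans ih'

lemma cellEv_of_all {F : PlanarForest I} (hF : F.All (· ≠ 1)) :
    cellEv 𝒞 h g φ (.vertex F) = cellBase 𝒞 h g φ (.vertex F) := by
  rw [cellEv_vertex, (F.root_of_all hF).1, (F.root_of_all hF).2, List.map_replicate]
  exact El.gam_ones _ _ _ _

include h in
/-- A tree of type `(n, i)` lies in one of the cells. -/
lemma exists_char {F : PlanarForest I} (hF : F.All (· ≠ 1)) (h1 : max 1 F.ends = n)
    (h2 : F.rootUni = i) : ¬ (PlanarTree.vertex F).Ok S ∧ ∃ (j : ι) (p : Disc d), ‖p.1‖ < 1 ∧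
      (PlanarTree.vertex F).cls N = ⟨⟨n - i, h.inRange⟩, 𝒞.char j p⟩ := by
  have hno : ¬ (PlanarTree.vertex F).Ok S := fun h' => by
    have := h'.1
    rw [PlanarForest.Good, h1, h2] at this
    exact h.not_mem this
  refine ⟨hno, ?_⟩
  obtain ⟨T, hT, hT'⟩ := PlanarTree.exists_prime hF
  have hl := F.leaves_of_type hF h1 h2
  have hTl : T.leaves = n - i := hT.leaves_eq.symm.trans hl
  rcases hT' with rfl | hT'
  · exact (hno (hT.ok_iff.2 trivial)).elim
  cases T with
  | triv => exact hT'.elim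
  | vertex F' =>
    have h3 := hT'.type (S := S)
    have h4 : max 1 F'.ends = n ∧ F'.rootUni = i := by
      have h5 : (PlanarTree.vertex F').Ok (fun e u => e = n ∧ u = i) :=
        hT.ok_iff.1 ⟨.inl ⟨h1, h2⟩, PlanarForest.ok_of_all hF⟩
      exact h5.1.resolve_right h3.2.2.2.2
    obtain ⟨j, p, hp, hjp⟩ := (𝒞.interior (TreeSpace.mk ⟨.vertex F', hTl⟩)).2
      ⟨⟨.vertex F', hTl⟩, hT', ⟨h3.1.symm.trans h4.1, h3.2.1.symm.trans h4.2⟩, rfl⟩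
    refine ⟨j, p, hp, ?_⟩
    rw [PlanarTree.cls_eq_of_equivalent hT, PlanarTree.cls_eq h.inRange hTl, hjp]

lemma deg_cellBase {F : PlanarForest I} (hF : F.All (· ≠ 1)) (hF' : F.Good S')
    (hl : InRange N F.leaves) : (cellBase 𝒞 h g φ (.vertex F)).deg = F.leaves := by
  rcases h.good_cases hF' with h1 | h1
  · have hok : (PlanarTree.vertex F).Ok S := ⟨h1, PlanarForest.ok_of_all hF⟩
    rw [cellBase_of_ok _ _ _ _ hok, El.deg_map, PlanarTree.clsGen_eq (T := .vertex F) _ hl hok rfl]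
    rfl
  · obtain ⟨hno, j, p, hp, hjp⟩ := exists_char 𝒞 h hF h1.1 h1.2
    rw [cellBase_char 𝒞 h g φ hno hp hjp, F.leaves_of_type hF h1.1 h1.2]
    rfl

lemma deg_cellRoot {F : PlanarForest I} (hF : F.Good S') :
    (cellBase 𝒞 h g φ (.vertex F.root)).deg = F.root.leaves := by
  refine deg_cellBase 𝒞 h g φ F.all_root ?_ (inRange_root h.inRange_one h.range hF)
  rwa [PlanarForest.Good, PlanarForest.rootUni, PlanarForest.ends_root, PlanarForest.uni_root]

lemma degSum_map_of_deg {E : PlanarTree I → C.El} {ys : List (PlanarTree I)}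
    (hE : ∀ y ∈ ys, (E y).deg = y.leaves) :
    El.degSum (ys.map E) = (ys.map PlanarTree.leaves).sum := by
  rw [El.degSum, List.map_map]
  exact congrArg _ (List.map_congr_left hE)

lemma deg_cellEv : ∀ T : PlanarTree I, T.Ok S' → InRange N T.leaves →
    (cellEv 𝒞 h g φ T).deg = T.leaves := by
  refine PlanarForest.cut_induction (fun _ _ => rfl) fun F ih hok hl => ?_
  have h1 : ∀ T ∈ F.subs, (cellEv 𝒞 h g φ T).deg = T.leaves := fun T hT =>
    ih T hT (PlanarForest.ok_subs hok.2 T hT) (hl.mono (PlanarForest.leaves_le_of_mem_subs hT))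
  have h2 := deg_cellRoot 𝒞 h g φ hok.1
  have h3 := F.sum_leaves_subs
  have h4 := F.length_subs
  have h5 := El.deg_gam (x := cellBase 𝒞 h g φ (.vertex F.root)) (p := 0)
    (ys := F.subs.map (cellEv 𝒞 h g φ)) (by rw [h2, List.length_map]; omega)
    (by
      rw [degSum_map_of_deg h1, h2, h3, List.length_map, h4]
      exact hl.mono (by simp only [PlanarTree.leaves]; omega))
  rw [degSum_map_of_deg h1, h2, h3, List.length_map, h4] at h5
  rw [cellEv_vertex]
  simp only [PlanarTree.leaves]
  omega

lemma map_graftList {E : PlanarTree I → C.El} {ys : List (PlanarTree I)} {b : PlanarTree I}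
    (hE : ∀ y ∈ ys, (E y).deg = y.leaves)
    (hE' : ∀ y ∈ ys, ∀ k < y.leaves, E (y.graft k b) = El.comp (E y) k (E b)) (k : ℕ) :
    (PlanarForest.graftList ys k b).map E = El.compList (ys.map E) k (E b) := by
  induction ys generalizing k with
  | nil => rfl
  | cons y ys ih =>
    simp only [List.mem_cons, forall_eq_or_imp] at hE hE'
    simp only [PlanarForest.graftList, List.map_cons, El.compList, hE.1]
    split_ifs with hk
    · rw [List.map_cons, hE'.1 k hk]
    · rw [List.map_cons, ih hE.2 hE'.2]

/-- Grafting does not affect the root component and is a grafting into one of the trees above it. By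
induction its value there is a composition, and `El.gam_comp` pulls this composition out. -/
lemma cellEv_graft {T' : PlanarTree I} (hok' : T'.Ok S') (hl' : InRange N T'.leaves) :
    ∀ T : PlanarTree I, T.Ok S' → InRange N T.leaves → InRange N (T.leaves + T'.leaves - 1) →
      ∀ k < T.leaves, cellEv 𝒞 h g φ (T.graft k T') =
        El.comp (cellEv 𝒞 h g φ T) k (cellEv 𝒞 h g φ T') := by
  refine PlanarForest.cut_induction (fun _ _ _ k hk => ?_) fun F ih hok hl hl'' k hk => ?_
  · obtain rfl : k = 0 := by simp only [PlanarTree.leaves] at hk; omega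
    exact (El.one_comp _ _).symm
  · cases T' with
    | triv => exact (El.comp_one _ _ _).symm
    | vertex G =>
      simp only [PlanarTree.leaves] at hk hl hl' hl''
      have h1 : ∀ T ∈ F.subs, (cellEv 𝒞 h g φ T).deg = T.leaves := fun T hT =>
        deg_cellEv 𝒞 h g φ T (PlanarForest.ok_subs hok.2 T hT)
          (hl.mono (PlanarForest.leaves_le_of_mem_subs hT))
      have h2 := deg_cellRoot 𝒞 h g φ hok.1
      have h3 := F.sum_leaves_subs
      have h4 := F.length_subs
      have h6 := deg_cellEv 𝒞 h g φ (.vertex G) hok' hl'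
      simp only [PlanarTree.graft]
      simp only [PlanarTree.leaves] at h6
      rw [cellEv_vertex, PlanarForest.root_graft hk, PlanarForest.subs_graft hk, map_graftList h1,
        cellEv_vertex 𝒞 h g φ F]
      · have := El.gam_comp (x := cellBase 𝒞 h g φ (.vertex F.root)) (p := 0) (i := k)
          (b := cellEv 𝒞 h g φ (.vertex G))
          (ys := F.subs.map (cellEv 𝒞 h g φ)) (by rw [h2, List.length_map]; omega)
          (by
            rw [degSum_map_of_deg h1, h2, h3, List.length_map, h4]
            exact hl.mono (by omega))
          (by rwa [degSum_map_of_deg h1, h3])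
          (by
            rw [degSum_map_of_deg h1, h3, h6]
            exact hl'')
          (by
            rw [degSum_map_of_deg h1, h2, h3, List.length_map, h4, h6]
            exact hl''.mono (by omega))
        rw [Nat.zero_add] at this
        exact this.symm
      · intro T hT k hk
        have := PlanarForest.leaves_le_of_mem_subs hT
        have e : (PlanarTree.vertex G).leaves = G.leaves := rfl
        exact ih T hT (PlanarForest.ok_subs hok.2 T hT) (hl.mono this)
          (hl''.mono (by omega)) k hk

/-- On the old suboperad the construction returns `g`, since `g` is compatible with composition
along the cuts. This is the extension property, and also what identifies the values on the
boundaries of the discs. -/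
lemma cellEv_of_ok : ∀ T : PlanarTree I, T.Ok S → InRange N T.leaves →
    cellEv 𝒞 h g φ T = El.map g (T.clsGen S h.inRange_one) := by
  refine PlanarForest.cut_induction (fun _ _ => ?_) fun F ih hok hl => ?_
  · rw [← cellBase_of_ok 𝒞 h g φ (T := .triv) trivial, cellBase_triv]
    rfl
  · rw [PlanarTree.clsGen_vertex h.inRange_one hl
      (inRange_root h.inRange_one h.range_left hok.1) hok, El.map_gam, cellEv_vertex,
      cellBase_of_ok _ _ _ _ (ok_root hok), List.map_map]
    congr 1
    exact List.map_congr_left fun T hT => ih T hT (PlanarForest.ok_subs hok.2 T hT)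
      (hl.mono (PlanarForest.leaves_le_of_mem_subs hT))

/-- The compatibility of the values on the cells with the morphism on the suboperad. -/
def CellCompatible : Prop := ∀ (j : ι) (p : Disc d) (hp : ‖p.1‖ = 1),
  φ j p = Hom.app g ⟨n - i, h.inRange⟩
    (toTruncGen (𝒞.char j p) ((𝒞.ok_of_boundary j p hp).mono_orId h.lt))

variable {g φ}

/-- In the interior of the disc the tree is equivalent to a prime tree of the new type and gets the
value of `φ` by definition. On the boundary it belongs to the old suboperad, and the compatibility
of `φ` with `g` is needed. -/
lemma cellEv_char (hφ : CellCompatible 𝒞 h g φ) {T : PlanarTree I} (hT : T.leaves = n - i) {j : ι}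
    {p : Disc d} (hT' : TreeSpace.mk ⟨T, hT⟩ = 𝒞.char j p) :
    cellEv 𝒞 h g φ T = ⟨⟨n - i, h.inRange⟩, φ j p⟩ := by
  have hp := p.2
  rw [mem_closedBall_zero_iff] at hp
  rcases hp.lt_or_eq with hp | hp
  · obtain ⟨⟨T₁, hT₁⟩, hT₁p, hT₁', h2⟩ := (𝒞.interior _).1 ⟨j, p, hp, rfl⟩
    -- Equality of classes gives a chain of elementary identifications, along which the value is
    -- constant.
    have e : cellEv 𝒞 h g φ T = cellEv 𝒞 h g φ T₁ := by
      have := h2.trans hT'.symm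
      have h3 := Quot.eqvGen_exact this
      have := Relation.EqvGen.map_rel (s := PlanarTree.Step) Subtype.val (fun _ _ h => h) h3
      exact (cellEv_congr 𝒞 h g φ this).symm
    rw [e]
    cases T₁ with
    | triv => exact hT₁p.elim
    | vertex F =>
      have h3 := hT₁p.type (S := S)
      rw [cellEv_of_all 𝒞 h g φ h3.2.2.2.1]
      refine cellBase_char 𝒞 h g φ ?_ hp ?_
      · intro h'
        have := h'.1
        rw [PlanarForest.Good, h3.1, h3.2.1, hT₁'.1, hT₁'.2] at this
        exact h.not_mem this
      · rw [PlanarTree.cls_eq h.inRange hT₁, ← h2]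
  · have h1 := (𝒞.ok_of_boundary j p hp).mono_orId h.lt
    have hTok : T.Ok S := by rw [← hT'] at h1; exact h1
    have hl : InRange N T.leaves := by rw [hT]; exact h.inRange
    rw [cellEv_of_ok 𝒞 h g φ T hTok hl, PlanarTree.clsGen_eq _ hl hTok hT, hφ j p hp]
    simp only [El.map]
    congr 3

/-- Only the edges that have length 1 at all parameters are cut, so the pattern of composition is
constant. A generic component is either a family in the old suboperad, where `g` is continuous, or
by `TreeCells.family` a family in one disc, where `φ` is; for single parameters it may well break
into smaller components. -/
lemma continuousFamily_cellEv (hφ : CellCompatible 𝒞 h g φ) {K : Type} [TopologicalSpace K]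
    [CompactSpace K] [T2Space K] : ∀ T : PlanarTree C(K, I), T.Ok S' → InRange N T.leaves →
      El.ContinuousFamily T.leaves fun t => cellEv 𝒞 h g φ (T.at' t) := by
  refine PlanarForest.cut_induction (fun _ hl => ?_) fun F ih hok hl => ?_
  · exact ⟨hl, ⟨fun _ => C.one hl, continuous_const⟩, fun t => rfl⟩
  · have hr := inRange_root h.inRange_one h.range hok.1
    have hrok : (PlanarTree.vertex F.root).Ok S' := by
      refine ⟨?_, PlanarForest.ok_of_all F.all_root⟩
      have := hok.1
      rwa [PlanarForest.Good, PlanarForest.rootUni, PlanarForest.ends_root, PlanarForest.uni_root]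
    have e : ∀ t, cellEv 𝒞 h g φ ((PlanarTree.vertex F).at' t) =
        El.gam (cellEv 𝒞 h g φ ((PlanarTree.vertex F.root).at' t)) 0
          (F.subs.map fun T => cellEv 𝒞 h g φ (T.at' t)) := fun t =>
      PlanarTree.map_of_graft (E := cellEv 𝒞 h g φ) (Q := PlanarTree.Ok S')
        (fun hi h h' => h.graft h' hi) (fun {T} => deg_cellEv 𝒞 h g φ T)
        (fun {T T' i} hi h1 h2 h3 h4 h5 => cellEv_graft 𝒞 h g φ h2 h4 T h1 h3 h5 i hi)
        (f := fun ℓ : C(K, I) => ℓ t) (F := F) rfl (hrok.map_of_ok h.lower' rfl rfl zero_ne_one)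
        (fun T hT => (PlanarForest.ok_subs hok.2 T hT).map_of_ok h.lower' rfl rfl zero_ne_one)
        hl hr
    have h1 : El.ContinuousFamily F.root.leaves
        fun t => cellEv 𝒞 h g φ ((PlanarTree.vertex F.root).at' t) := by
      rcases h.good_cases hrok.1 with h2 | h2
      · have h3 : ∀ t, ((PlanarTree.vertex F.root).at' t).Ok S := fun t =>
          PlanarTree.Ok.map_of_ok (T := .vertex F.root) h.lower rfl rfl zero_ne_one
            ⟨h2, PlanarForest.ok_of_all F.all_root⟩
        have h4 : ∀ t, ((PlanarTree.vertex F.root).at' t).leaves = F.root.leaves :=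
          fun t => PlanarTree.leaves_at' _ t
        have h5 := continuous_toTruncGen (N := N) (c := ⟨F.root.leaves, hr⟩)
          ((PlanarTree.vertex F.root).continuous_mk rfl) h3
        refine ⟨hr, (Hom.app g _).comp ⟨_, h5⟩, fun t => ?_⟩
        have hl : InRange N ((PlanarTree.vertex F.root).at' t).leaves := by rw [h4]; exact hr
        refine (cellEv_of_ok 𝒞 h g φ _ (h3 t) hl).trans ?_
        rw [PlanarTree.clsGen_eq _ hl (h3 t) (h4 t)]
        rfl
      · have hrl := F.root.leaves_of_type F.all_root h2.1 h2.2
        obtain ⟨j, q, hq⟩ := 𝒞.family K F.root F.all_root h2.1 h2.2 hrl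
        rw [hrl]
        -- The formula `φ j (q t)` also holds for those `t` with `q t` on the boundary of the disc,
        -- by `cellEv_char`.
        exact ⟨h.inRange, (φ j).comp q, fun t => cellEv_char 𝒞 h hφ _ (hq t)⟩
    have h2 := h1.gam (p := 0) (ys := F.subs) (r := PlanarTree.leaves)
      (y := fun T t => cellEv 𝒞 h g φ (T.at' t)) (fun T hT => ih T hT
        (PlanarForest.ok_subs hok.2 T hT) (hl.mono (PlanarForest.leaves_le_of_mem_subs hT)))
      (by rw [F.length_subs]; omega)
      (by
        rw [F.length_subs, F.sum_leaves_subs]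
        exact hl.mono (by simp only [PlanarTree.leaves]; omega))
    have e2 : F.root.leaves + (F.subs.map PlanarTree.leaves).sum - F.subs.length =
        (PlanarTree.vertex F).leaves := by
      rw [F.length_subs, F.sum_leaves_subs]
      simp only [PlanarTree.leaves]; omega
    rw [e2] at h2
    simpa only [e] using h2

/-- An element of an operad, as an element of a component. -/
def TopOperad.El.get (y : C.El) {c : Color N} (hy : y.deg = c.1) : C.X c :=
  (Subtype.ext hy : y.1 = c) ▸ y.2

lemma TopOperad.El.mk_get (y : C.El) {c : Color N} (hy : y.deg = c.1) :
    (⟨c, y.get hy⟩ : C.El) = y := by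
  obtain ⟨c', y⟩ := y
  obtain rfl : c' = c := Subtype.ext hy
  rfl

lemma TopOperad.El.get_eq {y : C.El} {c : Color N} (hy : y.deg = c.1) {z : C.X c}
    (hz : y = ⟨c, z⟩) : y.get hy = z := by
  subst hz
  rfl

variable (g φ)

/-- The extension of the map to the space of trees. -/
noncomputable def cellEvQ {k : ℕ} : TreeSpace k → C.El :=
  Quot.lift (fun T => cellEv 𝒞 h g φ T.1) fun _ _ hT => cellEv_step 𝒞 h g φ hT

lemma deg_cellEvQ {k : ℕ} {x : TreeSpace k} (hx : x.Ok S') (hk : InRange N k) :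
    (cellEvQ 𝒞 h g φ x).deg = k := by
  induction x using Quot.ind with | mk T =>
  obtain ⟨T, rfl⟩ := T
  exact deg_cellEv 𝒞 h g φ T hx hk

lemma cellEvQ_comp {a b k : Color N} (i : Fin a.1) (hk : a.1 + b.1 = k.1 + 1)
    {x : TreeSpace a.1} {y : TreeSpace b.1} (hx : x.Ok S') (hy : y.Ok S') :
    cellEvQ 𝒞 h g φ (TreeSpace.comp i hk x y) =
      El.comp (cellEvQ 𝒞 h g φ x) i (cellEvQ 𝒞 h g φ y) := by
  induction x using Quot.ind with | mk T =>
  induction y using Quot.ind with | mk T' =>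
  obtain ⟨a, ha⟩ := a
  obtain ⟨b, hb⟩ := b
  obtain ⟨k, hk'⟩ := k
  obtain ⟨T, hT⟩ := T
  obtain ⟨T', hT'⟩ := T'
  simp only at hT hT' hk
  subst hT hT'
  exact cellEv_graft 𝒞 h g φ hy hb T hx ha (InRange.mono hk' (show T.leaves + T'.leaves - 1 ≤ k by omega)) i i.2

variable {g φ}

lemma continuous_cellEvQ (hφ : CellCompatible 𝒞 h g φ) (c : Color N) :
    Continuous fun x : {x : TreeSpace c.1 // x.Ok S'} =>
      (cellEvQ 𝒞 h g φ x.1).get (deg_cellEvQ 𝒞 h g φ x.2 c.2) := by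
  refine TreeSpace.continuous_of_families h.lower' _ fun K _ _ _ T hT hok h' => ?_
  obtain ⟨c, hc⟩ := c
  simp only at hT
  subst hT
  obtain ⟨_, f, hf⟩ := continuousFamily_cellEv 𝒞 h hφ T hok hc
  refine f.continuous.congr fun t => ?_
  exact (El.get_eq _ (hf t)).symm

/-- The extension of a morphism along the attachment of the cells. -/
noncomputable def cellExtend (hφ : CellCompatible 𝒞 h g φ) : truncGen S' N ⟶ C :=
  (show Hom (truncGen S' N) C from
  { app := fun c => ⟨fun x => (cellEvQ 𝒞 h g φ (Hom.app (truncGenι S' N) c x)).get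
        (deg_cellEvQ 𝒞 h g φ (ok_of_truncGen x) c.2),
      (continuous_cellEvQ 𝒞 h hφ c).comp
        ((Hom.app (truncGenι S' N) c).continuous.subtype_mk fun x => ok_of_truncGen x)⟩
    map_comp := fun {a b k} i hk x y => by
      refine El.get_eq (deg_cellEvQ 𝒞 h g φ (ok_of_truncGen _) k.2) ?_
      have h1 := El.mk_get (cellEvQ 𝒞 h g φ (Hom.app (truncGenι S' N) a x))
        (deg_cellEvQ 𝒞 h g φ (ok_of_truncGen x) a.2)
      have h2 := El.mk_get (cellEvQ 𝒞 h g φ (Hom.app (truncGenι S' N) b y))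
        (deg_cellEvQ 𝒞 h g φ (ok_of_truncGen y) b.2)
      refine (cellEvQ_comp 𝒞 h g φ i hk (ok_of_truncGen x) (ok_of_truncGen y)).trans ?_
      rw [← h1, ← h2, El.comp_mk]
      rfl
    map_one := fun hN => El.get_eq (z := C.one hN) (deg_cellEvQ 𝒞 h g φ
      (ok_of_truncGen ((truncGen S' N).one hN)) hN) rfl })

lemma cellExtend_eq (hφ : CellCompatible 𝒞 h g φ) {c : Color N} {x : (truncGen S' N).X c}
    {z : C.X c} (hz : cellEvQ 𝒞 h g φ (Hom.app (truncGenι S' N) c x) = ⟨c, z⟩) :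
    Hom.app (cellExtend 𝒞 h hφ) c x = z :=
  El.get_eq (deg_cellEvQ 𝒞 h g φ (ok_of_truncGen _) c.2) hz

include h in
lemma ok_char (j : ι) (p : Disc d) : (𝒞.char j p).Ok S' := by
  have hp := p.2
  rw [mem_closedBall_zero_iff] at hp
  rcases hp.lt_or_eq with hp | hp
  · refine ok_of_generated (c := deg (n - i)) (.of _ (primeTrees_mono ?_ _
      ((𝒞.interior _).1 ⟨j, p, hp, rfl⟩)))
    rintro _ _ ⟨rfl, rfl⟩
    exact h.mem
  · exact (𝒞.ok_of_boundary j p hp).mono_orId fun e u h' => (h.lt e u h').imp_left (h.le e u)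

/-- Two morphisms agree if they agree on the suboperad and on the cells. -/
lemma cell_hom_ext {f f' : truncGen S' N ⟶ C} (h1 : truncIncl h.le N ≫ f = truncIncl h.le N ≫ f')
    (h2 : ∀ j p, Hom.app f ⟨n - i, h.inRange⟩ (toTruncGen (𝒞.char j p) (ok_char 𝒞 h j p)) =
      Hom.app f' ⟨n - i, h.inRange⟩ (toTruncGen (𝒞.char j p) (ok_char 𝒞 h j p))) : f = f' := by
  refine truncGen_hom_ext h.inRange_one h.range fun c x hx => ?_
  obtain ⟨⟨T, hT⟩, hTp, hTS, hTx⟩ := id hx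
  cases T with
  | triv => exact hTp.elim
  | vertex F =>
    have h3 := hTp.type (S := S)
    rcases h.cases _ _ hTS (Nat.le_add_left _ _) with h4 | h4
    · have hok : TreeSpace.Ok S (Hom.app (truncGenι S' N) c x) := by
        rw [← hTx]
        refine ⟨?_, h3.2.2.1⟩
        rw [PlanarForest.Good, h3.1, h3.2.1]
        exact h4
      exact congrArg (fun f : truncGen S N ⟶ C => Hom.app f c (toTruncGen _ hok)) h1
    · have hc : c = ⟨n - i, h.inRange⟩ := Subtype.ext (by
        have e : (PlanarTree.vertex F).leaves = c.1 := hT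
        obtain ⟨h5, h6⟩ := h4
        change (PlanarTree.vertex F).leaves + (PlanarTree.vertex F).univalent = n at h5
        change (PlanarTree.vertex F).univalent = i at h6
        change c.1 = n - i
        omega)
      subst hc
      obtain ⟨j, p, -, hjp⟩ := (𝒞.interior (Hom.app (truncGenι S' N) _ x)).2
        ⟨⟨.vertex F, hT⟩, hTp, h4, hTx⟩
      have h5 : x = toTruncGen (𝒞.char j p) (ok_char 𝒞 h j p) := truncGenι_injective hjp.symm
      rw [h5]
      exact h2 j p

instance (d : ℕ) : CompactSpace (DiscBoundary d) := by
  have : IsClosed {p : Disc d | ‖p.1‖ = 1} :=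
    isClosed_eq (continuous_norm.comp continuous_subtype_val) continuous_const
  exact isCompact_iff_compactSpace.1 this.isCompact

/-- A family of trees of type `(n, i)` that is a family of cells attaches these cells. -/
noncomputable def TreeCells.attachment : CellAttachment (truncIncl h.le N) ι
    (fun _ => (⟨n - i, h.inRange⟩ : Color N)) (fun _ => d) where
  attach j := ⟨fun p => toTruncGen (𝒞.char j p.1) ((𝒞.ok_of_boundary j p.1 p.2).mono_orId h.lt),
    continuous_toTruncGen ((𝒞.char j).continuous.comp continuous_subtype_val) _⟩
  char j := ⟨fun p => toTruncGen (𝒞.char j p) (ok_char 𝒞 h j p),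
    continuous_toTruncGen (𝒞.char j).continuous _⟩
  comm j p := rfl
  exists_unique C g φ hφ := by
    have hφ' : CellCompatible 𝒞 h g φ := fun j p hp => hφ j ⟨p, hp⟩
    have ex : truncIncl h.le N ≫ cellExtend 𝒞 h hφ' = g ∧ ∀ j p,
        Hom.app (cellExtend 𝒞 h hφ') ⟨n - i, h.inRange⟩ (toTruncGen (𝒞.char j p)
          (ok_char 𝒞 h j p)) = φ j p := ⟨by
      refine Hom.ext (funext fun c => ContinuousMap.ext fun x => ?_)
      refine cellExtend_eq 𝒞 h hφ' ?_
      have h1 := ok_of_truncGen x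
      obtain ⟨c, hc⟩ := c
      obtain ⟨⟨T, hT⟩, h2⟩ := Quot.exists_rep (Hom.app (truncGenι S N) ⟨c, hc⟩ x)
      simp only at hT
      subst hT
      have h3 : T.Ok S := by rw [← h2] at h1; exact h1
      have h4 : Hom.app (truncGenι S' N) ⟨_, hc⟩ (Hom.app (truncIncl h.le N) ⟨_, hc⟩ x) =
        TreeSpace.mk ⟨T, rfl⟩ := h2.symm
      have h5 : x = toTruncGen (TreeSpace.mk ⟨T, rfl⟩) h3 := truncGenι_injective h2.symm
      rw [h4]
      refine (cellEv_of_ok 𝒞 h g φ T h3 hc).trans ?_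
      rw [PlanarTree.clsGen_eq h.inRange_one hc h3 rfl, h5]
      rfl, fun j p => by
      refine cellExtend_eq 𝒞 h hφ' ?_
      have h4 : Hom.app (truncGenι S' N) ⟨n - i, h.inRange⟩ (toTruncGen (𝒞.char j p)
        (ok_char 𝒞 h j p)) = 𝒞.char j p := rfl
      obtain ⟨⟨T, hT⟩, h2⟩ := Quot.exists_rep (𝒞.char j p)
      refine (congrArg (cellEvQ 𝒞 h g φ) (h4.trans h2.symm)).trans ?_
      exact cellEv_char 𝒞 h hφ' hT h2⟩
    exact ⟨cellExtend 𝒞 h hφ', ex, fun f hf => cell_hom_ext 𝒞 h (hf.1.trans ex.1.symm)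
      fun j p => (hf.2 j p).trans (ex.2 j p).symm⟩

lemma TreeCells.openCells_attachment : (𝒞.attachment h).openCells =
    {x | (Hom.app (truncGenι S' N) ⟨n - i, h.inRange⟩ x : TreeSpace (n - i)) ∈ primeTrees (fun e u => e = n ∧ u = i) (deg (n - i))} := by
  ext x
  refine Iff.trans ?_ (𝒞.interior _)
  constructor
  · rintro ⟨j, p, hp, rfl⟩
    exact ⟨j, p, hp, rfl⟩
  · rintro ⟨j, p, hp, hx⟩
    exact ⟨j, p, hp, truncGenι_injective hx⟩

end

/-! ## Prime trees are determined by their class -/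

namespace PlanarForest

/-- An edge with a forest on top of it, simplified. -/
noncomputable def edge (ℓ : I) (A : PlanarForest I) : PlanarForest I :=
  open Classical in
  if ℓ = 0 then A else
    match A with
    | leaf nil => leaf nil
    | node ℓ' A' nil => node (max ℓ ℓ') A' nil
    | A => node ℓ A nil

/-- The normal form of a forest. -/
noncomputable def normal : PlanarForest I → PlanarForest I
  | nil => nil
  | leaf B => leaf B.normal
  | node ℓ A B => (edge ℓ A.normal).append B.normal

lemma edge_zero (A : PlanarForest I) : edge 0 A = A := if_pos rfl

lemma edge_of_arity_ne {ℓ : I} (hℓ : ℓ ≠ 0) {A : PlanarForest I} (hA : A.arity ≠ 1) :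
    edge ℓ A = node ℓ A nil := by
  match A, hA with
  | nil, _ => exact if_neg hℓ
  | leaf (leaf _), _ => exact if_neg hℓ
  | leaf (node _ _ _), _ => exact if_neg hℓ
  | node _ _ (leaf _), _ => exact if_neg hℓ
  | node _ _ (node _ _ _), _ => exact if_neg hℓ
  | leaf nil, h => simp [arity] at h
  | node _ _ nil, h => simp [arity] at h

lemma edge_leaf (ℓ : I) : edge ℓ (leaf nil) = leaf nil := by
  unfold edge
  split_ifs <;> rfl

lemma edge_node {ℓ : I} (hℓ : ℓ ≠ 0) (ℓ' : I) (A : PlanarForest I) :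
    edge ℓ (node ℓ' A nil) = node (max ℓ ℓ') A nil := if_neg hℓ

lemma arity_eq_one {A : PlanarForest I} (h : A.arity = 1) :
    A = leaf nil ∨ ∃ ℓ A', A = node ℓ A' nil := by
  match A, h with
  | leaf nil, _ => exact .inl rfl
  | node ℓ A' nil, _ => exact .inr ⟨ℓ, A', rfl⟩

/-- Two edges in a row act like one edge whose length is the maximum. Together with `edge_zero` and
`edge_leaf` this makes `normal` invariant under all identifications. -/
lemma edge_edge (ℓ ℓ' : I) (A : PlanarForest I) : edge ℓ (edge ℓ' A) = edge (max ℓ ℓ') A := by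
  by_cases h' : ℓ' = 0
  · rw [h', edge_zero, max_eq_left unitInterval.nonneg']
  by_cases h : ℓ = 0
  · rw [h, edge_zero, max_eq_right unitInterval.nonneg']
  have hm : max ℓ ℓ' ≠ 0 := fun e => h ((max_eq_zero_iff _ _).1 e).1
  by_cases hA : A.arity = 1
  · obtain rfl | ⟨ℓ'', A', rfl⟩ := arity_eq_one hA
    · simp only [edge_leaf]
    · rw [edge_node h', edge_node h, edge_node hm, max_assoc]
  · rw [edge_of_arity_ne h' hA, edge_node h, edge_of_arity_ne hm hA]

lemma normal_append (A B : PlanarForest I) :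
    (A.append B).normal = A.normal.append B.normal := by
  induction A with
  | nil => rfl
  | leaf A ih => simp [append, normal, ih]
  | node ℓ A A' _ ih => simp [append, normal, ih, append_assoc]

lemma normal_step {F F' : PlanarForest I} (h : Step F F') : F.normal = F'.normal := by
  induction h with
  | contract A B => rw [normal_append, normal, edge_zero]
  | unary_leaf ℓ B => simp [normal, edge_leaf, append]
  | unary_node ℓ ℓ' A B => simp [normal, append_nil, edge_edge]
  | leaf h ih => rw [normal, ih, normal]
  | node_left ℓ B h ih => rw [normal, ih, normal]
  | node_right ℓ A h ih => rw [normal, ih, normal]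

lemma Prime.normal {F : PlanarForest I} (h : F.Prime) : F.normal = F := by
  induction F with
  | nil => rfl
  | leaf B ih => rw [PlanarForest.normal, ih h]
  | node ℓ A B ihA ihB =>
    obtain ⟨h0, h1, ha, hA, hB⟩ := h
    rw [PlanarForest.normal, ihA hA, ihB hB, edge_of_arity_ne h0.ne' ha]
    rfl

/-- The tree with the given forest on top of its root vertex, simplified. -/
def top : PlanarForest I → PlanarTree I
  | leaf nil => .triv
  | node _ A nil => .vertex A
  | A => .vertex A

lemma top_of_arity_ne {A : PlanarForest I} (hA : A.arity ≠ 1) : A.top = .vertex A := by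
  match A, hA with
  | nil, _ => rfl
  | leaf (leaf _), _ => rfl
  | leaf (node _ _ _), _ => rfl
  | node _ _ (leaf _), _ => rfl
  | node _ _ (node _ _ _), _ => rfl
  | leaf nil, h => simp [arity] at h
  | node _ _ nil, h => simp [arity] at h

end PlanarForest

namespace PlanarTree

/-- The normal form of a tree. -/
noncomputable def normal : PlanarTree I → PlanarTree I
  | triv => triv
  | vertex F => F.normal.top

lemma normal_step {T T' : PlanarTree I} (h : Step T T') : T.normal = T'.normal := by
  cases h with
  | vertex h => rw [normal, normal, PlanarForest.normal_step h]
  | unary_leaf => rfl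
  | unary_node ℓ A =>
    simp only [normal, PlanarForest.normal, PlanarForest.append_nil]
    by_cases hℓ : ℓ = 0
    · rw [hℓ, PlanarForest.edge_zero]
    · by_cases hA : A.normal.arity = 1
      · obtain h | ⟨ℓ'', A', h⟩ := PlanarForest.arity_eq_one hA
        · rw [h, PlanarForest.edge_leaf]
        · rw [h, PlanarForest.edge_node hℓ]
          rfl
      · rw [PlanarForest.edge_of_arity_ne hℓ hA, PlanarForest.top_of_arity_ne hA]
        rfl

/-- The normal form is constant on classes and fixes prime trees. -/
lemma Prime.eq_of_equivalent {T T' : PlanarTree I} (hT : T.Prime) (hT' : T'.Prime)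
    (h : T.Equivalent T') : T = T' := by
  have h1 : T.normal = T'.normal := by
    clear hT hT'
    induction h with
    | rel _ _ h => exact normal_step h
    | refl => rfl
    | symm _ _ _ ih => exact ih.symm
    | trans _ _ _ _ _ ih ih' => exact ih.trans ih'
  have h2 : ∀ {T : PlanarTree I}, T.Prime → T.normal = T := by
    intro T hT
    cases T with
    | triv => rfl
    | vertex F => rw [normal, hT.2.normal, PlanarForest.top_of_arity_ne hT.1]
  rw [← h2 hT, h1, h2 hT']

end PlanarTree

lemma PlanarTree.equivalent_of_mk_eq {n : ℕ} {T T' : MetricTree n}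
    (h : TreeSpace.mk T = TreeSpace.mk T') : T.1.Equivalent T'.1 :=
  Relation.EqvGen.map_rel (s := PlanarTree.Step) Subtype.val (fun _ _ h => h) (Quot.eqvGen_exact h)

/-! ## Coordinates of trees -/

namespace PlanarForest

section

variable {L L' : Type}

/-- No internal vertex is bivalent. -/
def Reduced : PlanarForest L → Prop
  | nil => True
  | leaf B => B.Reduced
  | node _ A B => A.arity ≠ 1 ∧ A.Reduced ∧ B.Reduced

/-- The list of the ends (leaves and univalent internal vertices): the entry is `true` for the
latter. -/
def flags : PlanarForest L → List Bool
  | nil => []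
  | leaf B => false :: B.flags
  | node _ A B => (if A.arity = 0 then [true] else A.flags) ++ B.flags

lemma flags_append (A B : PlanarForest L) : (A.append B).flags = A.flags ++ B.flags := by
  induction A with
  | nil => rfl
  | leaf A ih => simp [append, flags, ih]
  | node ℓ A A' _ ih => simp [append, flags, ih]

lemma length_flags (F : PlanarForest L) : F.flags.length = F.leaves + F.univalent := by
  induction F with
  | nil => rfl
  | leaf B ih => simp [flags, leaves, univalent, ih]; omega
  | node ℓ A B ihA ihB =>
    by_cases h : A.arity = 0
    · obtain rfl := arity_eq_zero.1 h
      simp [flags, leaves, univalent, arity, ihB]; omega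
    · simp [flags, leaves, univalent, h, ihA, ihB]; omega

lemma count_flags (F : PlanarForest L) : F.flags.count true = F.univalent := by
  induction F with
  | nil => rfl
  | leaf B ih => simp [flags, univalent, ih]
  | node ℓ A B ihA ihB =>
    by_cases h : A.arity = 0
    · obtain rfl := arity_eq_zero.1 h
      simp [flags, univalent, arity, ihB, Nat.add_comm]
    · simp [flags, univalent, h, ihA, ihB]

lemma flags_map (f : L → L') (F : PlanarForest L) : (F.map f).flags = F.flags := by
  induction F with
  | nil => rfl
  | leaf B ih => simp [map, flags, ih]
  | node ℓ A B ihA ihB => simp [map, flags, ihA, ihB, arity_map]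

lemma reduced_map (f : L → L') (F : PlanarForest L) : (F.map f).Reduced ↔ F.Reduced := by
  induction F with
  | nil => rfl
  | leaf B ih => exact ih
  | node ℓ A B ihA ihB => simp [map, Reduced, ihA, ihB, arity_map]

lemma Reduced.append {A B : PlanarForest L} (hA : A.Reduced) (hB : B.Reduced) :
    (A.append B).Reduced := by
  induction A with
  | nil => exact hB
  | leaf A ih => exact ih hA
  | node ℓ A A' _ ih => exact ⟨hA.1, hA.2.1, ih hA.2.2⟩

lemma Reduced.arity_le {F : PlanarForest L} (h : F.Reduced) : F.arity ≤ F.flags.length := by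
  induction F with
  | nil => simp [arity]
  | leaf B ih => simpa [arity, flags] using ih h
  | node ℓ A B ihA ihB =>
    have h1 := ihA h.2.1
    have h2 := ihB h.2.2
    simp only [arity, flags]
    split_ifs with h3
    · simpa using h2
    · rw [List.length_append]; omega

/-- Without bivalent vertices the number of edges is bounded by the number of ends. Hence a cell
involves only finitely many shapes, and the union of their cubes is compact. -/
lemma Reduced.size_add_arity_le {F : PlanarForest L} (h : F.Reduced) :
    F.size + F.arity ≤ 2 * F.flags.length := by
  induction F with
  | nil => simp [arity, size]
  | leaf B ih => have := ih h; simp [arity, flags, size]; omega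
  | node ℓ A B ihA ihB =>
    have h1 := ihA h.2.1
    have h2 := ihB h.2.2
    have h3 := h.1
    simp only [arity, flags, size]
    split_ifs with h4
    · obtain rfl := arity_eq_zero.1 h4
      simp [size]; omega
    · rw [List.length_append]; omega

end

/-- The coordinates of the ends of a forest: for every end, the height of the vertex where it meets
the preceding end, whether it is a univalent vertex, and the suitably normalized length of the edge
below the univalent vertex. The forest is carried by a vertex of height `a`, and `g` is the first
coordinate of the first end. -/
noncomputable def coords : ℝ → ℝ → PlanarForest I → List (ℝ × Bool × ℝ)
  | _, _, nil => []
  | g, a, leaf B => (g, false, 0) :: coords a a B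
  | g, a, node ℓ A B =>
    (if A.arity = 0 then [(g, true, 2 * (ℓ : ℝ) - 1)] else coords g (a + ℓ) A) ++ coords a a B

/-- The size of a forest: the maximum of the lengths of the edges, where the lengths of edges
below univalent vertices are normalized. -/
noncomputable def gauge : PlanarForest I → ℝ
  | nil => 0
  | leaf B => B.gauge
  | node ℓ A B => max (if A.arity = 0 then |2 * (ℓ : ℝ) - 1| else max (ℓ : ℝ) A.gauge) B.gauge

/-- The edges of length `0` end in a univalent vertex. -/
def Positive : PlanarForest I → Prop
  | nil => True
  | leaf B => B.Positive
  | node ℓ A B => (A.arity ≠ 0 → ℓ ≠ 0) ∧ A.Positive ∧ B.Positive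

lemma gauge_nonneg (F : PlanarForest I) : 0 ≤ F.gauge := by
  induction F with
  | nil => exact le_rfl
  | leaf B ih => exact ih
  | node ℓ A B ihA ihB => exact ihB.trans (le_max_right _ _)

lemma gauge_le_one (F : PlanarForest I) : F.gauge ≤ 1 := by
  induction F with
  | nil => exact zero_le_one
  | leaf B ih => exact ih
  | node ℓ A B ihA ihB =>
    have h0 := ℓ.2.1
    have h1 := ℓ.2.2
    refine max_le ?_ ihB
    split_ifs
    · rw [abs_le]; constructor <;> linarith
    · exact max_le h1 ihA

lemma gauge_append (A B : PlanarForest I) : (A.append B).gauge = max A.gauge B.gauge := by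
  induction A with
  | nil => exact (max_eq_right B.gauge_nonneg).symm
  | leaf A ih => exact ih
  | node ℓ A A' _ ih => simp only [append, gauge, ih, max_assoc]

/-- The coordinate `g` is used up by the first end, which must lie in `A`; after it, the ends
directly above the root vertex meet the preceding ones at height `a`. -/
lemma coords_append (g a : ℝ) {A : PlanarForest I} (hA : A.arity ≠ 0) (B : PlanarForest I) :
    coords g a (A.append B) = coords g a A ++ coords a a B := by
  have key : ∀ A : PlanarForest I, coords a a (A.append B) = coords a a A ++ coords a a B := by
    intro A
    induction A with
    | nil => rfl
    | leaf A ih => simp [append, coords, ih]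
    | node ℓ A A' _ ih => simp [append, coords, ih]
  cases A with
  | nil => simp [arity] at hA
  | leaf A => simp [append, coords, key]
  | node ℓ A A' => simp [append, coords, key]

lemma map_coords (g a : ℝ) (F : PlanarForest I) : (coords g a F).map (fun x => x.2.1) = F.flags := by
  induction F generalizing g a with
  | nil => rfl
  | leaf B ih => simp [coords, flags, ih]
  | node ℓ A B ihA ihB =>
    by_cases h : A.arity = 0 <;> simp [coords, flags, ihA, ihB, h]

lemma length_coords (g a : ℝ) (F : PlanarForest I) : (coords g a F).length = F.flags.length := by
  rw [← map_coords g a, List.length_map]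

lemma coords_snd (g a : ℝ) (F : PlanarForest I) : ∀ x ∈ coords g a F, x.2.1 = false → x.2.2 = 0 := by
  induction F generalizing g a with
  | nil => simp [coords]
  | leaf B ih => simpa [coords] using ih a a
  | node ℓ A B ihA ihB =>
    simp only [coords, List.mem_append]
    rintro x (hx | hx)
    · split_ifs at hx with h
      · simp only [List.mem_singleton] at hx
        simp [hx]
      · exact ihA _ _ x hx
    · exact ihB _ _ x hx

/-- The coordinates consist of those of the first end and of those of the other ends, which are
at least the height of the root vertex, and once equal to it if this is not univalent. -/
lemma Reduced.exists_coords {F : PlanarForest I} (h : F.Reduced) (h0 : F.arity ≠ 0) (g a : ℝ) :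
    ∃ x l, coords g a F = (g, x) :: l ∧ (∀ y ∈ l, a ≤ y.1) ∧ (2 ≤ F.arity → ∃ y ∈ l, y.1 = a) := by
  induction F generalizing g a with
  | nil => simp [arity] at h0
  | leaf B ih =>
    refine ⟨_, _, rfl, ?_⟩
    by_cases hB : B.arity = 0
    · obtain rfl := arity_eq_zero.1 hB
      simp [coords, arity]
    · obtain ⟨x, l, hl, hl', -⟩ := ih h hB a a
      rw [hl]
      simpa using fun y => hl' y
  | node ℓ A B ihA ihB =>
    have hB : (∀ y ∈ coords a a B, a ≤ y.1) ∧ (B.arity ≠ 0 → ∃ y ∈ coords a a B, y.1 = a) := by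
      by_cases hB : B.arity = 0
      · obtain rfl := arity_eq_zero.1 hB
        simp [coords, arity]
      · obtain ⟨x, l, hl, hl', -⟩ := ihB h.2.2 hB a a
        rw [hl]
        simpa using fun y => hl' y
    have hB' : 2 ≤ (node ℓ A B).arity → B.arity ≠ 0 := by simp only [arity]; omega
    by_cases hA : A.arity = 0
    · simp only [coords, hA, if_true]
      exact ⟨_, _, rfl, hB.1, fun h => hB.2 (hB' h)⟩
    · obtain ⟨x, l, hl, hl', -⟩ := ihA h.2.1 hA g (a + ℓ)
      simp only [coords, hA, if_false, hl]
      refine ⟨x, l ++ coords a a B, rfl, ?_, fun h => ?_⟩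
      · simp only [List.mem_append]
        rintro y (hy | hy)
        · have := hl' y hy
          have := ℓ.2.1
          linarith
        · exact hB.1 y hy
      · obtain ⟨y, hy, hy'⟩ := hB.2 (hB' h)
        exact ⟨y, List.mem_append_right _ hy, hy'⟩

/-- Inside the first tree the ends meet strictly above `a`, and the first end of the next tree meets
its predecessor at `a`. So the block of the first tree stops at the first return to height `a`. -/
lemma block_unique {a : ℝ} {l l' m m' : List (ℝ × Bool × ℝ)}
    (hl : ∀ x ∈ l, a < x.1) (hl' : ∀ x ∈ l', a < x.1) (hm : ∀ x ∈ m.head?, x.1 = a)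
    (hm' : ∀ x ∈ m'.head?, x.1 = a) (h : l ++ m = l' ++ m') : l = l' ∧ m = m' := by
  induction l generalizing l' with
  | nil =>
    cases l' with
    | nil => exact ⟨rfl, h⟩
    | cons y l' =>
      rw [List.nil_append] at h
      subst h
      have h1 := hm y (by simp)
      have h2 := hl' y (by simp)
      linarith
  | cons x l ih =>
    cases l' with
    | nil =>
      rw [List.nil_append] at h
      subst h
      have h1 := hm' x (by simp)
      have h2 := hl x (by simp)
      linarith
    | cons y l' =>
      simp only [List.cons_append, List.cons.injEq] at h
      have := ih (fun x hx => hl x (List.mem_cons_of_mem _ hx))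
        (fun x hx => hl' x (List.mem_cons_of_mem _ hx)) h.2
      exact ⟨by rw [h.1, this.1], this.2⟩

lemma Reduced.head_coords {F : PlanarForest I} (h : F.Reduced) (a : ℝ) :
    ∀ x ∈ (coords a a F).head?, x.1 = a := by
  by_cases h0 : F.arity = 0
  · obtain rfl := arity_eq_zero.1 h0
    simp [coords]
  · obtain ⟨x, l, hl, -⟩ := h.exists_coords h0 a a
    rw [hl]
    simp

/-- The coordinates of the first tree of a forest. -/
lemma Reduced.exists_block {ℓ : I} {A B : PlanarForest I} (h : (node ℓ A B).Reduced)
    (hp : A.arity ≠ 0 → ℓ ≠ 0) (g a : ℝ) : ∃ x l, coords g a (node ℓ A B) =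
      ((g, x) :: l) ++ coords a a B ∧ (∀ y ∈ l, a < y.1) ∧
      (if A.arity = 0 then l = [] ∧ x = (true, 2 * (ℓ : ℝ) - 1) else
        coords g (a + ℓ) A = (g, x) :: l ∧ (∀ y ∈ l, a + ℓ ≤ y.1) ∧ ∃ y ∈ l, y.1 = a + ℓ) := by
  by_cases hA : A.arity = 0
  · simp only [coords, hA, if_true]
    exact ⟨_, [], rfl, by simp, rfl, rfl⟩
  · obtain ⟨x, l, hl, hl', hl''⟩ := h.2.1.exists_coords hA g (a + ℓ)
    simp only [coords, hA, if_false]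
    have h1 := h.1
    refine ⟨x, l, by rw [hl], fun y hy => ?_, hl, hl', hl'' (by omega)⟩
    have := hl' y hy
    have : 0 < (ℓ : ℝ) := unitInterval.pos_iff_ne_zero.2 (hp hA)
    linarith

/-- The forest is rebuilt recursively. The first return to height `a` delimits the first tree; if it
is not a leaf or a stump, its root vertex has at least two branches, and the lowest height within
the block is `a` plus the length of its edge. Positivity of the lengths makes the delimitation
unambiguous. -/
lemma eq_of_coords_eq {F F' : PlanarForest I} (hF : F.Reduced) (hF' : F'.Reduced)
    (hp : F.Positive) (hp' : F'.Positive) {g a : ℝ} (h : coords g a F = coords g a F') : F = F' := by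
  induction F generalizing F' g a with
  | nil =>
    cases F' with
    | nil => rfl
    | leaf B => simp [coords] at h
    | node ℓ A B =>
      obtain ⟨x, l, hl, -⟩ := hF'.exists_block hp'.1 g a
      rw [hl] at h
      simp [coords] at h
  | leaf B ih =>
    cases F' with
    | nil => simp [coords] at h
    | leaf B' =>
      simp only [coords, List.cons.injEq, true_and] at h
      rw [ih (F' := B') hF hF' hp hp' h]
    | node ℓ A B' =>
      exfalso
      obtain ⟨x, l, hl, hl', hA⟩ := hF'.exists_block hp'.1 g a
      rw [hl] at h
      simp only [coords, List.cons_append, List.cons.injEq, Prod.mk.injEq] at h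
      have h1 := block_unique (l := []) (by simp) hl' (Reduced.head_coords (F := B) hF a) (hF'.2.2.head_coords a) h.2
      split_ifs at hA with h0
      · have := h.1.2
        rw [hA.2] at this
        simp at this
      · obtain ⟨y, hy, -⟩ := hA.2.2
        rw [← h1.1] at hy
        simp at hy
  | node ℓ A B ihA ihB =>
    obtain ⟨x, l, hl, hl', hA⟩ := hF.exists_block hp.1 g a
    rw [hl] at h
    cases F' with
    | nil => simp [coords] at h
    | leaf B' =>
      exfalso
      simp only [coords, List.cons_append, List.cons.injEq, Prod.mk.injEq] at h
      have h1 := block_unique (l' := []) hl' (by simp) (hF.2.2.head_coords a)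
        (Reduced.head_coords (F := B') hF' a) h.2
      split_ifs at hA with h0
      · have := h.1.2
        rw [hA.2] at this
        simp at this
      · obtain ⟨y, hy, -⟩ := hA.2.2
        rw [h1.1] at hy
        simp at hy
    | node ℓ' A' B' =>
      obtain ⟨x', m, hm, hm', hA'⟩ := hF'.exists_block hp'.1 g a
      rw [hm] at h
      simp only [List.cons_append, List.cons.injEq, Prod.mk.injEq, true_and] at h
      have h1 := block_unique hl' hm' (hF.2.2.head_coords a) (hF'.2.2.head_coords a) h.2
      obtain rfl := ihB hF.2.2 hF'.2.2 hp.2.2 hp'.2.2 h1.2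
      obtain rfl := h1.1
      obtain rfl := h.1
      split_ifs at hA with h0
      · obtain rfl := arity_eq_zero.1 h0
        obtain ⟨rfl, rfl⟩ := hA
        split_ifs at hA' with h0'
        · obtain rfl := arity_eq_zero.1 h0'
          have h2 := hA'.2
          simp only [Prod.mk.injEq, true_and] at h2
          have : ℓ = ℓ' := Subtype.ext (by linarith)
          rw [this]
        · simp at hA'
      · split_ifs at hA' with h0'
        · obtain ⟨rfl, -⟩ := hA'
          simp at hA
        -- The common block attains its minimum both at `a + ℓ` and at `a + ℓ'`.
        · obtain ⟨y, hy, hy'⟩ := hA.2.2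
          obtain ⟨z, hz, hz'⟩ := hA'.2.2
          have h2 := hA.2.1 z hz
          have h3 := hA'.2.1 y hy
          have : ℓ = ℓ' := Subtype.ext (by linarith)
          subst this
          rw [ihA hF.2.1 hF'.2.1 hp.2.1 hp'.2.1 (hA.1.trans hA'.1.symm)]

/-- The edges of length `0` can be contracted, except for those below univalent vertices. -/
lemma Reduced.exists_positive {F : PlanarForest I} (h : F.Reduced) : ∃ P : PlanarForest I,
    F.Equivalent P ∧ P.Reduced ∧ P.Positive ∧ (∀ g a, coords g a P = coords g a F) ∧
      P.gauge = F.gauge ∧ F.arity ≤ P.arity ∧ (F.arity = 0 → P.arity = 0) := by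
  induction F with
  | nil => exact ⟨nil, .refl _, trivial, trivial, fun _ _ => rfl, rfl, le_rfl, id⟩
  | leaf B ih =>
    obtain ⟨P, h1, h2, h3, h4, h5, h6, -⟩ := ih h
    refine ⟨leaf P, h1.leaf, h2, h3, fun g a => ?_, h5, by simpa [arity] using h6, by simp [arity]⟩
    simp [coords, h4]
  | node ℓ A B ihA ihB =>
    obtain ⟨P, h1, h2, h3, h4, h5, h6, h7⟩ := ihA h.2.1
    obtain ⟨Q, h1', h2', h3', h4', h5', h6', -⟩ := ihB h.2.2
    have hn := h1.node ℓ h1'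
    have h0 := h.1
    have hA : P.arity = 0 ↔ A.arity = 0 := ⟨fun h => by omega, h7⟩
    by_cases hc : A.arity ≠ 0 ∧ ℓ = 0
    · obtain ⟨hc, rfl⟩ := hc
      refine ⟨P.append Q, hn.trans (.of_step (.contract _ _)), h2.append h2', ?_, fun g a => ?_, ?_,
        ?_, by simp [arity]⟩
      · clear h1 h4 h5 h6 h7 hn hA h2
        induction P with
        | nil => exact h3'
        | leaf P ih => exact ih h3
        | node ℓ P P' _ ih => exact ⟨h3.1, h3.2.1, ih h3.2.2⟩
      · rw [coords_append _ _ (by omega), h4, h4']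
        simp [coords, hc]
      · rw [gauge_append, h5, h5', gauge, if_neg hc, max_eq_right (a := ((0 : I) : ℝ))]
        exact A.gauge_nonneg
      · rw [arity_append, arity]; omega
    · refine ⟨node ℓ P Q, hn, ⟨by omega, h2, h2'⟩, ⟨fun h => ?_, h3, h3'⟩, fun g a => ?_, ?_, ?_,
        by simp [arity]⟩
      · rw [Ne, hA] at h
        exact fun e => hc ⟨h, e⟩
      · simp [coords, hA, h4, h4']
      · simp [gauge, hA, h5, h5']
      · simpa [arity] using h6'

/-- No end survives only if there is no leaf and all edges have length 0. Then every end of the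
shape is a stump. -/
lemma univalent_of_ends_eq_zero {F : PlanarForest I} (h : F.ends = 0) :
    F.univalent = F.flags.length := by
  have key : F.leaves = 0 := by
    induction F with
    | nil => rfl
    | leaf B ih => simp [ends] at h
    | node ℓ A B ihA ihB =>
      simp only [ends] at h
      split_ifs at h with h1 h2
      · omega
      · simp only [leaves]
        rw [ihA (by omega), ihB (by omega)]
      · omega
  rw [length_flags, key, Nat.zero_add]

/-- The type of the component next to the root is at most the type that is read off from the shape,
and it is smaller if the size is `1`. -/
lemma Reduced.ends_le {F : PlanarForest I} (h : F.Reduced) : F.ends ≤ F.flags.length ∧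
    F.uni ≤ F.univalent ∧ (F.gauge = 1 → F.ends < F.flags.length ∨ F.uni < F.univalent) := by
  induction F with
  | nil => simp [ends, uni, gauge]
  | leaf B ih =>
    have := ih h
    simp only [ends, uni, gauge, flags, univalent, List.length_cons]
    refine ⟨by omega, by omega, fun h => ?_⟩
    have := this.2.2 h
    omega
  | node ℓ A B ihA ihB =>
    have h0 := h.1
    have hA := ihA h.2.1
    have hB := ihB h.2.2
    have ha := h.2.1.arity_le
    have hA0 := A.univalent_of_ends_eq_zero
    by_cases hz : A.arity = 0
    · obtain rfl := arity_eq_zero.1 hz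
      simp only [ends, uni, gauge, flags, univalent, List.length_append, arity, if_true,
        List.length_singleton]
      refine ⟨by split_ifs <;> omega, by split_ifs <;> omega, fun h => ?_⟩
      by_cases h1 : ℓ = 1
      -- At length 1 the stump turns into a leaf and `uni` drops; at length 0 it disappears and
      -- `ends` drops. These are the two points where `|2 * ℓ - 1|` is 1.
      · simp only [h1, if_true]; omega
      by_cases h2 : ℓ = 0
      · simp only [h2, zero_ne_one_I, if_true, if_false]; omega
      · have h3 : B.gauge = 1 := by
          rcases max_choice (|2 * (ℓ : ℝ) - 1|) B.gauge with h4 | h4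
          · exfalso
            rw [h4] at h
            have h5 : 0 < (ℓ : ℝ) := unitInterval.pos_iff_ne_zero.2 h2
            have h6 : (ℓ : ℝ) < 1 := unitInterval.lt_one_iff_ne_one.2 h1
            have : |2 * (ℓ : ℝ) - 1| < 1 := by rw [abs_lt]; constructor <;> linarith
            linarith
          · rwa [← h4]
        have := hB.2.2 h3
        simp only [h1, h2, if_false]
        omega
    · simp only [ends, uni, gauge, flags, univalent, List.length_append, if_neg hz]
      by_cases h1 : ℓ = 1
      -- The vertex above has at least two branches, so cutting the edge replaces at least two ends
      -- by one leaf.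
      · simp only [h1, if_true]
        exact ⟨by omega, by omega, fun _ => by omega⟩
      · have h6 : (ℓ : ℝ) ≠ 1 := fun h => h1 (Subtype.ext h)
        have key : max (max (ℓ : ℝ) A.gauge) B.gauge = 1 → A.gauge = 1 ∨ B.gauge = 1 := by
          intro h
          rcases max_choice (max (ℓ : ℝ) A.gauge) B.gauge with h4 | h4
          · rcases max_choice (ℓ : ℝ) A.gauge with h5 | h5
            · exact (h6 (by rw [← h5, ← h4, h])).elim
            · exact .inl (by rw [← h5, ← h4, h])
          · exact .inr (by rw [← h4, h])
        by_cases h2 : ℓ = 0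
        · simp only [h2, zero_ne_one_I, if_true, if_false]
          refine ⟨by omega, by omega, fun h => ?_⟩
          rw [h2] at key
          rcases key h with h | h
          · have := hA.2.2 h; omega
          · have := hB.2.2 h; omega
        · simp only [h1, h2, if_false]
          refine ⟨by omega, by split_ifs <;> omega, fun h => ?_⟩
          rcases key h with h | h
          · have := hA.2.2 h
            split_ifs <;> omega
          · have := hB.2.2 h
            split_ifs <;> omega

end PlanarForest

/-! ### Boundary of the cells, radial scaling, and forests with prescribed coordinates -/

namespace PlanarForest

/-- The number of ends of a component is at most the number of ends above its first edge. The
assumption `2 ≤ n` is for components that count as `max 1 0`. -/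
lemma Reduced.ok_of_length_lt {n i : ℕ} {F : PlanarForest I} (h : F.Reduced)
    (hn : F.flags.length < n) (hn' : 2 ≤ n) : F.Ok (LexLt n i) := by
  induction F with
  | nil => trivial
  | leaf B ih => exact ih h (by simp only [flags, List.length_cons] at hn; omega)
  | node ℓ A B ihA ihB =>
    simp only [flags, List.length_append] at hn
    have hA : A.flags.length < n := by
      by_cases hz : A.arity = 0
      · obtain rfl := arity_eq_zero.1 hz
        simp only [flags, List.length_nil]; omega
      · rw [if_neg hz] at hn; omega
    refine ⟨fun _ => .inl (.inl ?_), ihA h.2.1 hA, ihB h.2.2 (by omega)⟩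
    have := h.2.1.ends_le.1
    omega

/-- The trees on the boundary of a cell have smaller prime components. -/
lemma Reduced.ok_of_gauge_eq_one {n : ℕ} {F : PlanarForest I} (h : F.Reduced) (hF : F.arity ≠ 1)
    (hn : F.flags.length = n) (hn' : 2 ≤ n) (hg : F.gauge = 1) :
    (PlanarTree.vertex F).Ok (LexLt n F.univalent) := by
  constructor
  · have h1 := h.ends_le
    have h2 := h1.2.2 hg
    refine .inl ?_
    unfold LexLt rootUni
    split_ifs <;> omega
  · match F, h, hF, hn with
    | nil, _, _, _ => trivial
    | leaf B, h, _, hn =>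
      refine Reduced.ok_of_length_lt (F := B) h ?_ hn'
      simp only [flags, List.length_cons] at hn; omega
    | node ℓ A B, h, hF, hn =>
      simp only [flags, List.length_append, arity] at hn hF
      have hB := h.2.2.arity_le
      have hA := h.2.1.arity_le
      have h0 := h.1
      have hA' : A.flags.length < n ∧ B.flags.length < n := by
        by_cases hz : A.arity = 0
        · obtain rfl := arity_eq_zero.1 hz
          simp [arity, flags] at hn ⊢
          omega
        · rw [if_neg hz] at hn; omega
      refine ⟨fun _ => .inl (.inl ?_), h.2.1.ok_of_length_lt hA'.1 hn',
        h.2.2.ok_of_length_lt hA'.2 hn'⟩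
      have := h.2.1.ends_le.1
      omega

/-- Multiplication of the coordinates by a factor. -/
noncomputable def scale (r : ℝ) : PlanarForest I → PlanarForest I
  | nil => nil
  | leaf B => leaf (B.scale r)
  | node ℓ A B => node (Set.projIcc 0 1 zero_le_one
      (if A.arity = 0 then (r * (2 * ℓ - 1) + 1) / 2 else r * ℓ)) (A.scale r) (B.scale r)

lemma arity_scale (r : ℝ) (F : PlanarForest I) : (F.scale r).arity = F.arity := by
  induction F with
  | nil => rfl
  | leaf B ih => simp [scale, arity, ih]
  | node ℓ A B _ ih => simp [scale, arity, ih]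

lemma flags_scale (r : ℝ) (F : PlanarForest I) : (F.scale r).flags = F.flags := by
  induction F with
  | nil => rfl
  | leaf B ih => simp [scale, flags, ih]
  | node ℓ A B ihA ihB => simp [scale, flags, ihA, ihB, arity_scale]

lemma Reduced.scale {F : PlanarForest I} (h : F.Reduced) (r : ℝ) : (F.scale r).Reduced := by
  induction F with
  | nil => trivial
  | leaf B ih => exact ih h
  | node ℓ A B ihA ihB => exact ⟨by rw [arity_scale]; exact h.1, ihA h.2.1, ihB h.2.2⟩

/-- Heights are sums of edge lengths, and stump lengths enter through `2 * ℓ - 1`, so both depend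
linearly on what `scale` multiplies by `r`. The bound on `r * F.gauge` ensures that no length is
clipped to the unit interval. -/
lemma coords_gauge_scale {r : ℝ} (hr : 0 ≤ r) {F : PlanarForest I} (h : r * F.gauge ≤ 1) :
    (F.scale r).gauge = r * F.gauge ∧ ∀ g a, coords (r * g) (r * a) (F.scale r) =
      (coords g a F).map fun x => (r * x.1, x.2.1, r * x.2.2) := by
  induction F with
  | nil => simp [gauge, PlanarForest.scale, coords]
  | leaf B ih =>
    have := ih h
    simp [gauge, PlanarForest.scale, coords, this]
  | node ℓ A B ihA ihB =>
    have hm : r * (node ℓ A B).gauge =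
        max (r * (if A.arity = 0 then |2 * (ℓ : ℝ) - 1| else max (ℓ : ℝ) A.gauge)) (r * B.gauge) :=
      mul_max_of_nonneg _ _ hr
    rw [hm, max_le_iff] at h
    have hB := ihB h.2
    by_cases hz : A.arity = 0
    · obtain rfl := arity_eq_zero.1 hz
      have h1 := h.1
      simp only [if_pos hz] at h1 hm
      have h2 : r * |2 * (ℓ : ℝ) - 1| = |r * (2 * ℓ - 1)| := by rw [abs_mul, abs_of_nonneg hr]
      rw [h2, abs_le] at h1
      have h3 : (r * (2 * (ℓ : ℝ) - 1) + 1) / 2 ∈ Set.Icc (0 : ℝ) 1 := by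
        constructor <;> linarith
      have e : 2 * ((r * (2 * (ℓ : ℝ) - 1) + 1) / 2) - 1 = r * (2 * ℓ - 1) := by ring
      refine ⟨?_, fun g a => ?_⟩
      · rw [hm, h2, PlanarForest.scale, gauge, if_pos hz, Set.projIcc_of_mem _ h3, hB.1,
          PlanarForest.scale, if_pos hz]
        simp only [e]
      · rw [PlanarForest.scale, if_pos hz, Set.projIcc_of_mem _ h3, coords, PlanarForest.scale,
          if_pos hz, hB.2, coords, if_pos hz, List.map_append]
        simp only [e]
        rfl
    · have h1 := h.1
      simp only [if_neg hz] at h1 hm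
      rw [mul_max_of_nonneg _ _ hr, max_le_iff] at h1
      have hA := ihA h1.2
      have h3 : r * (ℓ : ℝ) ∈ Set.Icc (0 : ℝ) 1 := ⟨mul_nonneg hr ℓ.2.1, h1.1⟩
      have hz' : ¬ (A.scale r).arity = 0 := by rwa [arity_scale]
      refine ⟨?_, fun g a => ?_⟩
      · rw [hm, mul_max_of_nonneg _ _ hr, PlanarForest.scale, gauge, if_neg hz, if_neg hz',
          Set.projIcc_of_mem _ h3, hB.1, hA.1]
      · rw [PlanarForest.scale, if_neg hz, Set.projIcc_of_mem _ h3, coords, if_neg hz', hB.2, coords,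
          if_neg hz, List.map_append]
        simp only
        rw [← hA.2, mul_add]

/-- The forest with given coordinates. -/
lemma exists_coords (H : ℕ → ℝ) (f : ℕ → Bool) (τ : ℕ → ℝ) (hH : ∀ j k, H j - H k ≤ 1)
    (hτ : ∀ k, |τ k| ≤ 1) (hf : ∀ k, f k = false → τ k = 0) (m : ℕ) (p : ℕ) (a : ℝ) :
    (∀ k, p < k → k < p + (m + 1) → a ≤ H k ∧ H k ≤ a + 1) → ∃ F : PlanarForest I,
      F.Reduced ∧ F.arity ≠ 0 ∧ ((∃ k, p < k ∧ k < p + (m + 1) ∧ H k = a) → 2 ≤ F.arity) ∧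
      ∀ g, coords g a F = (List.range' p (m + 1)).map fun k =>
        ((if k = p then g else H k), f k, τ k) := by
  induction m using Nat.strong_induction_on generalizing p a with
  | _ m ih =>
  intro ha
  -- the case where the root vertex splits the interval
  have split : ∀ k b, p < k → k < p + (m + 1) → H k = b →
      (∀ k, p < k → k < p + (m + 1) → b ≤ H k ∧ H k ≤ b + 1) → ∃ F : PlanarForest I,
      F.Reduced ∧ 2 ≤ F.arity ∧ ∀ g, coords g b F = (List.range' p (m + 1)).map fun k =>
        ((if k = p then g else H k), f k, τ k) := by
    intro k b hk hk' hb hb'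
    -- The left forest takes the `q + 1` ends from `p` on, the right one the remaining `m - q`. The
    -- end `k` becomes the first end of the right forest, with first coordinate `b`.
    obtain ⟨q, rfl⟩ : ∃ q, k = p + (q + 1) := ⟨k - p - 1, by omega⟩
    obtain ⟨F₁, h1, h2, -, h3⟩ := ih q (by omega) p b fun j hj hj' => hb' j hj (by omega)
    obtain ⟨F₂, h1', h2', -, h3'⟩ := ih (m - q - 1) (by omega) (p + (q + 1)) b
      fun j hj hj' => hb' j (by omega) (by omega)
    refine ⟨F₁.append F₂, h1.append h1', by rw [arity_append]; omega, fun g => ?_⟩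
    have e : m + 1 = (q + 1) + (m - q - 1 + 1) := by omega
    have e' : List.range' p (m + 1) = List.range' p (q + 1) ++
        List.range' (p + (q + 1)) (m - q - 1 + 1) := by
      rw [List.range'_append_1, ← e]
    rw [coords_append _ _ h2, h3, h3', e', List.map_append]
    congr 1
    refine List.map_congr_left fun j hj => ?_
    rw [List.mem_range'_1] at hj
    have : j ≠ p := by omega
    simp only [this, if_false]
    split_ifs with hj'
    · rw [hj', hb]
    · rfl
  by_cases hs : ∃ k, p < k ∧ k < p + (m + 1) ∧ H k = a
  · obtain ⟨k, hk, hk', hk''⟩ := hs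
    obtain ⟨F, h1, h2, h3⟩ := split k a hk hk' hk'' ha
    exact ⟨F, h1, by omega, fun _ => h2, h3⟩
  rcases Nat.eq_zero_or_pos m with rfl | hm
  · cases hfp : f p with
    | false =>
      refine ⟨leaf nil, trivial, by simp [arity], fun h => (hs h).elim, fun g => ?_⟩
      simp [coords, hfp, hf p hfp]
    | true =>
      have h1 := abs_le.1 (hτ p)
      refine ⟨node ⟨(τ p + 1) / 2, by linarith, by linarith⟩ nil nil, ?_, by simp [arity],
        fun h => (hs h).elim, fun g => ?_⟩
      · simp [Reduced, arity]
      · have : 2 * ((τ p + 1) / 2) - 1 = τ p := by ring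
        simp [coords, hfp, arity, this]
  -- No height equals `a`, so the forest is one tree, and the vertex at the top of its edge lies at
  -- the smallest of the heights. As heights differ by at most 1, the construction can continue
  -- there.
  · obtain ⟨k, hk, hk'⟩ := Finset.exists_min_image (Finset.Ioo p (p + (m + 1))) H
      ⟨p + 1, by simp only [Finset.mem_Ioo]; omega⟩
    simp only [Finset.mem_Ioo] at hk hk'
    obtain ⟨F, h1, h2, h3⟩ := split k (H k) hk.1 hk.2 rfl fun j hj hj' =>
      ⟨hk' j ⟨hj, hj'⟩, by have := hH j k; linarith⟩
    have h4 := ha k hk.1 hk.2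
    refine ⟨node ⟨H k - a, by linarith, by linarith⟩ F nil, ⟨by omega, h1, trivial⟩,
      by simp [arity], fun h => (hs h).elim, fun g => ?_⟩
    have h5 : ¬ F.arity = 0 := by omega
    have e : a + (H k - a) = H k := by ring
    simp only [coords, h5, if_false, List.append_nil, e, h3]

lemma Prime.reduced {F : PlanarForest I} (h : F.Prime) :
    F.Reduced ∧ F.Positive ∧ F.gauge < 1 := by
  induction F with
  | nil => exact ⟨trivial, trivial, zero_lt_one⟩
  | leaf B ih => exact ih h
  | node ℓ A B ihA ihB =>
    obtain ⟨h0, h1, ha, hA, hB⟩ := h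
    have hA := ihA hA
    have hB := ihB hB
    have h0' : 0 < (ℓ : ℝ) := h0
    have h1' : (ℓ : ℝ) < 1 := h1
    refine ⟨⟨ha, hA.1, hB.1⟩, ⟨fun _ => h0.ne', hA.2.1, hB.2.1⟩, max_lt ?_ hB.2.2⟩
    split_ifs
    · rw [abs_lt]; constructor <;> linarith
    · exact max_lt h1' hA.2.2

lemma prime_of_reduced {F : PlanarForest I} (h : F.Reduced) (h' : F.Positive) (hg : F.gauge < 1) :
    F.Prime := by
  induction F with
  | nil => trivial
  | leaf B ih => exact ih h h' hg
  | node ℓ A B ihA ihB =>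
    simp only [gauge, max_lt_iff] at hg
    have hB := ihB h.2.2 h'.2.2 hg.2
    by_cases hz : A.arity = 0
    · rw [if_pos hz, abs_lt] at hg
      obtain rfl := arity_eq_zero.1 hz
      exact ⟨show 0 < (ℓ : ℝ) by linarith, show (ℓ : ℝ) < 1 by linarith, h.1, trivial, hB⟩
    · rw [if_neg hz, max_lt_iff] at hg
      exact ⟨unitInterval.pos_iff_ne_zero.2 (h'.1 hz), hg.1.1, h.1, ihA h.2.1 h'.2.1 hg.1.2, hB⟩

/-- A family of forests can be brought into a form without bivalent vertices. -/
lemma exists_reduced {K : Type} [TopologicalSpace K] {F : PlanarForest C(K, I)}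
    (hF : F.All (· ≠ 1)) : ∃ F' : PlanarForest C(K, I), F'.Reduced ∧
      (∀ t, (F.at' t).Equivalent (F'.at' t)) ∧ F'.flags.length = F.ends ∧ F'.univalent = F.uni := by
  induction F with
  | nil => exact ⟨nil, trivial, fun _ => .refl _, rfl, rfl⟩
  | leaf B ih =>
    obtain ⟨B', h1, h2, h3, h4⟩ := ih hF
    exact ⟨leaf B', h1, fun t => (h2 t).leaf, by simp [flags, ends, h3], by simp [univalent, uni, h4]⟩
  | node ℓ A B ihA ihB =>
    obtain ⟨hℓ, hA, hB⟩ := hF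
    obtain ⟨A', h1, h2, h3, h4⟩ := ihA hA
    obtain ⟨B', h1', h2', h3', h4'⟩ := ihB hB
    have hn : ∀ t, ((node ℓ A B).at' t).Equivalent ((node ℓ A' B').at' t) :=
      fun t => (h2 t).node _ (h2' t)
    simp only [ends, uni, if_neg hℓ]
    by_cases h0 : ℓ = 0
    · refine ⟨A'.append B', h1.append h1', fun t => (hn t).trans ?_, ?_, ?_⟩
      · simp only [at', map, map_append, h0]
        exact .of_step (.contract _ _)
      · rw [flags_append, List.length_append, h3, h3', if_pos h0]
      · rw [← count_flags, flags_append, List.count_append, count_flags, count_flags, h4, h4',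
          if_pos h0]
    simp only [if_neg h0]
    -- The vertex above the edge is bivalent: it is removed, and if an internal edge leaves it, the
    -- new length is the pointwise maximum, again a continuous function.
    by_cases ha : A'.arity = 1
    · match A', ha with
      | leaf nil, _ =>
        simp only [flags, univalent, List.length_singleton] at h3 h4
        refine ⟨leaf B', h1', fun t => (hn t).trans (.of_step (.unary_leaf _ _)), ?_, ?_⟩
        · simp only [flags, List.length_cons]; omega
        · simp only [univalent]
          split_ifs <;> omega
      | node ℓ' A'' nil, _ =>
        refine ⟨node ⟨fun t => max (ℓ t) (ℓ' t), ℓ.continuous.max ℓ'.continuous⟩ A'' B',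
          ⟨h1.1, h1.2.1, h1'⟩, fun t => (hn t).trans (.of_step (.unary_node _ _ _ _)), ?_, ?_⟩
        · have ha := h1.2.1.arity_le
          simp only [flags, List.append_nil] at h3
          simp only [flags, List.length_append, h3, h3']
          split_ifs at h3 with hz
          · simp only [List.length_singleton] at h3; omega
          · omega
        · have ha := h1.2.1.arity_le
          simp only [flags, univalent, List.append_nil, Nat.add_zero] at h3 h4
          simp only [univalent, h4, h4']
          split_ifs at h3 with hz
          · simp only [List.length_singleton] at h3
            rw [if_neg (by omega)]
          · rw [if_neg (by omega)]
    · have hl := h1.arity_le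
      refine ⟨node ℓ A' B', ⟨ha, h1, h1'⟩, hn, ?_, ?_⟩
      · simp only [flags, List.length_append, h3']
        split_ifs with hz
        · obtain rfl := arity_eq_zero.1 hz
          simp only [flags, List.length_nil] at h3
          simp only [List.length_singleton]; omega
        · omega
      · simp only [univalent, h4']
        split_ifs with hz hz' hz'
        · obtain rfl := arity_eq_zero.1 hz
          simp [univalent]
        · obtain rfl := arity_eq_zero.1 hz
          simp [flags] at h3
          omega
        · omega
        · omega

end PlanarForest

/-- A family of trees whose generic type is not that of a point can be brought into a form
without bivalent vertices. -/
lemma PlanarTree.exists_reduced {K : Type} [TopologicalSpace K] {F : PlanarForest C(K, I)}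
    (hF : F.All (· ≠ 1)) (h : 2 ≤ F.ends) : ∃ F' : PlanarForest C(K, I), F'.Reduced ∧ F'.arity ≠ 1 ∧
      (∀ t, ((vertex F).at' t).Equivalent ((vertex F').at' t)) ∧ F'.flags.length = F.ends ∧
      F'.univalent = F.uni := by
  obtain ⟨F', h1, h2, h3, h4⟩ := PlanarForest.exists_reduced hF
  have hv := fun t => PlanarTree.Equivalent.vertex (h2 t)
  by_cases ha : F'.arity = 1
  · match F', ha with
    | .leaf .nil, _ =>
      simp only [PlanarForest.flags, List.length_singleton] at h3; omega
    | .node ℓ A .nil, _ =>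
      simp only [PlanarForest.flags, List.append_nil, PlanarForest.univalent, Nat.add_zero] at h3 h4
      have hz : A.arity ≠ 0 := fun hz => by
        rw [if_pos hz, List.length_singleton] at h3; omega
      rw [if_neg hz] at h3 h4
      exact ⟨A, h1.2.1, h1.1, fun t => (hv t).trans (.of_step (.unary_node _ _)), h3, by omega⟩
  · exact ⟨F', h1, ha, hv, h3, h4⟩

/-! ## The cells -/

namespace PlanarForest

section

variable {L L' : Type}

/-- The positions of the univalent vertices among the ends. -/
def stumps (n : ℕ) (F : PlanarForest L) : Finset (Fin n) :=
  Finset.univ.filter fun k => F.flags.getD k false = true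

lemma card_stumps {n : ℕ} {F : PlanarForest L} (h : F.flags.length = n) :
    (F.stumps n).card = F.univalent := by
  subst h
  rw [← count_flags, stumps]
  generalize F.flags = l
  induction l with
  | nil => rfl
  | cons b l ih =>
    rw [Finset.card_filter] at ih ⊢
    simp only [List.length_cons, Fin.sum_univ_succ, Fin.val_zero, Fin.val_succ,
      List.getD_cons_zero, List.getD_cons_succ, ih, List.count_cons]
    cases b <;> simp [Nat.add_comm]

/-- The forests that describe points of the cell with univalent vertices in the positions `J`. -/
def IsShape {n : ℕ} (J : Finset (Fin n)) (F : PlanarForest L) : Prop :=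
  F.Reduced ∧ F.arity ≠ 1 ∧ F.flags.length = n ∧ F.stumps n = J

variable {n : ℕ} {J : Finset (Fin n)}

lemma isShape_map (f : L → L') (F : PlanarForest L) : (F.map f).IsShape J ↔ F.IsShape J := by
  simp [IsShape, reduced_map, arity_map, flags_map, stumps]

lemma IsShape.univalent {F : PlanarForest L} (h : F.IsShape J) : F.univalent = J.card := by
  rw [← card_stumps h.2.2.1, h.2.2.2]

lemma IsShape.leaves {F : PlanarForest L} (h : F.IsShape J) : F.leaves = n - J.card := by
  have h1 := F.length_flags
  rw [h.univalent, h.2.2.1] at h1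
  omega

end

lemma map_fill : ∀ (s : PlanarForest Unit) (c : s.Cube), (fill s c).map (fun _ => ()) = s
  | nil, _ => rfl
  | leaf B, c => by simp [fill, map, map_fill B c]
  | node _ A B, c => by simp [fill, map, map_fill A, map_fill B]

lemma isShape_fill {n : ℕ} {J : Finset (Fin n)} {s : PlanarForest Unit} {c : s.Cube} :
    (fill s c).IsShape J ↔ s.IsShape J := by
  conv_rhs => rw [← map_fill s c]
  exact (isShape_map _ _).symm

lemma finite_size_le (m : ℕ) : {s : PlanarForest Unit | s.size ≤ m}.Finite := by
  induction m with
  | zero =>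
    refine (Set.finite_singleton nil).subset fun s hs => ?_
    cases s with
    | nil => rfl
    | leaf B => simp [size] at hs
    | node ℓ A B => simp [size] at hs
  | succ m ih =>
    refine (((Set.finite_singleton nil).union (ih.image leaf)).union
      (ih.image2 (node ()) ih)).subset fun s hs => ?_
    cases s with
    | nil => exact .inl (.inl rfl)
    | leaf B => exact .inl (.inr ⟨B, by simpa [size] using hs, rfl⟩)
    | node ℓ A B =>
      simp only [size, Set.mem_ofPred_eq] at hs
      exact .inr ⟨A, show A.size ≤ m by omega, B, show B.size ≤ m by omega, rfl⟩

section

variable {K : Type} [TopologicalSpace K]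

lemma continuous_gauge (F : PlanarForest C(K, I)) : Continuous fun t => (F.at' t).gauge := by
  induction F with
  | nil => exact continuous_const
  | leaf B ih => exact ih
  | node ℓ A B ihA ihB =>
    refine Continuous.max ?_ ihB
    by_cases h : A.arity = 0
    · simp only [arity_map, h, if_true]
      fun_prop
    · simp only [arity_map, h, if_false]
      exact (continuous_subtype_val.comp ℓ.continuous).max ihA

/-- For a fixed shape the list of coordinates has a fixed length, and its entries are continuous
functions of the edge lengths. -/
lemma exists_coords_family (F : PlanarForest C(K, I)) (g a : C(K, ℝ)) :
    ∃ l : List C(K, ℝ × Bool × ℝ), ∀ t, coords (g t) (a t) (F.at' t) = l.map fun f => f t := by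
  induction F generalizing g a with
  | nil => exact ⟨[], fun t => rfl⟩
  | leaf B ih =>
    obtain ⟨l, hl⟩ := ih a a
    refine ⟨⟨fun t => (g t, false, 0), by fun_prop⟩ :: l, fun t => ?_⟩
    rw [List.map_cons, ← hl]
    rfl
  | node ℓ A B ihA ihB =>
    obtain ⟨l, hl⟩ := ihB a a
    by_cases h : A.arity = 0
    · refine ⟨⟨fun t => (g t, true, 2 * (ℓ t : ℝ) - 1), by fun_prop⟩ :: l, fun t => ?_⟩
      rw [List.map_cons, ← hl, at', map, coords, arity_map, if_pos h]
      rfl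
    · obtain ⟨m, hm⟩ := ihA g ⟨fun t => a t + ℓ t, by fun_prop⟩
      refine ⟨m ++ l, fun t => ?_⟩
      rw [List.map_append, ← hl, ← hm, at', map, coords, arity_map, if_neg h]
      rfl

end

/-- The coordinates of an end. -/
noncomputable def coord (F : PlanarForest I) (k : ℕ) : ℝ × Bool × ℝ :=
  (coords 0 0 F).getD k (0, false, 0)

lemma continuous_coord {K : Type} [TopologicalSpace K] (F : PlanarForest C(K, I)) (k : ℕ) :
    Continuous fun t => (F.at' t).coord k := by
  obtain ⟨l, hl⟩ := F.exists_coords_family 0 0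
  have : ∀ t, (F.at' t).coord k = l.getD k (ContinuousMap.const _ (0, false, 0)) t := fun t => by
    have h := hl t
    simp only [ContinuousMap.zero_apply] at h
    rw [coord, h]
    simp only [List.getD_eq_getElem?_getD, List.getElem?_map]
    cases l[k]? <;> rfl
  simp only [this]
  exact (l.getD k _).continuous

variable {n : ℕ} {J : Finset (Fin n)}

/-- The coordinates of a forest. -/
noncomputable def point (J : Finset (Fin n)) (F : PlanarForest I) :
    (Fin (n - 2) → ℝ) × (J → ℝ) :=
  (fun k => (F.coord (k + 2)).1 - (F.coord 1).1, fun k => (F.coord k.1).2.2)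

lemma continuous_point {K : Type} [TopologicalSpace K] (F : PlanarForest C(K, I)) :
    Continuous fun t => (F.at' t).point J := by
  have := F.continuous_coord
  unfold point
  fun_prop

lemma point_scale {r : ℝ} (hr : 0 ≤ r) {F : PlanarForest I} (h : r * F.gauge ≤ 1) :
    (F.scale r).point J = r • F.point J := by
  have key : ∀ k, (F.scale r).coord k =
      (r * (F.coord k).1, (F.coord k).2.1, r * (F.coord k).2.2) := fun k => by
    have := (coords_gauge_scale hr h).2 0 0
    rw [mul_zero] at this
    rw [coord, coord, this]
    simp only [List.getD_eq_getElem?_getD, List.getElem?_map]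
    cases (coords 0 0 F)[k]? <;> simp
  simp only [point, key]
  refine Prod.ext (funext fun k => ?_) (funext fun k => ?_)
  · simp [mul_sub]
  · simp

lemma IsShape.scale {F : PlanarForest I} (h : F.IsShape J) (r : ℝ) : (F.scale r).IsShape J :=
  ⟨h.1.scale r, by rw [arity_scale]; exact h.2.1, by rw [flags_scale]; exact h.2.2.1, by
    rw [stumps, flags_scale]; exact h.2.2.2⟩

lemma IsShape.exists_positive {F : PlanarForest I} (h : F.IsShape J) : ∃ P : PlanarForest I,
    F.Equivalent P ∧ P.IsShape J ∧ P.Positive ∧ P.gauge = F.gauge ∧ P.point J = F.point J := by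
  obtain ⟨P, h1, h2, h3, h4, h5, h6, h7⟩ := h.1.exists_positive
  have hf : P.flags = F.flags := by rw [← map_coords 0 0, h4, map_coords]
  refine ⟨P, h1, ⟨h2, ?_, by rw [hf]; exact h.2.2.1, by rw [stumps, hf]; exact h.2.2.2⟩, h3, h5, ?_⟩
  · have := h.2.1; omega
  · simp only [point, coord, h4]

lemma IsShape.two_le_arity (hn : 2 ≤ n) {F : PlanarForest I} (h : F.IsShape J) : 2 ≤ F.arity := by
  have h1 := h.2.1
  by_contra h2
  obtain rfl := arity_eq_zero.1 (show F.arity = 0 by omega)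
  have := h.2.2.1
  simp [flags] at this
  omega

/-- A forest without internal edges of length `0` is determined by its coordinates. -/
lemma IsShape.eq_of_point_eq (hn : 2 ≤ n) {F F' : PlanarForest I} (h : F.IsShape J)
    (h' : F'.IsShape J) (hp : F.Positive) (hp' : F'.Positive) (e : F.point J = F'.point J) :
    F = F' := by
  refine eq_of_coords_eq h.1 h'.1 hp hp' (g := 0) (a := 0) ?_
  have hlen : (coords 0 0 F).length = n := by rw [length_coords, h.2.2.1]
  have hlen' : (coords 0 0 F').length = n := by rw [length_coords, h'.2.2.1]
  -- the first coordinates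
  have first : ∀ G : PlanarForest I, G.IsShape J → (G.coord 0).1 = 0 ∧
      (∀ k, 1 ≤ k → k < n → 0 ≤ (G.coord k).1) ∧ ∃ k, 1 ≤ k ∧ k < n ∧ (G.coord k).1 = 0 := by
    intro G hG
    have hG2 := hG.two_le_arity hn
    obtain ⟨x, l, hl, hl', hl''⟩ := hG.1.exists_coords (by omega) 0 0
    have hlen : l.length + 1 = n := by
      rw [← hG.2.2.1, ← length_coords 0 0, hl, List.length_cons]
    have hc : ∀ k (hk : k < l.length), G.coord (k + 1) = l[k] := fun k hk => by
      rw [coord, hl, List.getD_cons_succ, List.getD_eq_getElem _ _ hk]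
    refine ⟨by rw [coord, hl]; rfl, fun k hk hk' => ?_, ?_⟩
    · obtain ⟨k, rfl⟩ := Nat.exists_eq_add_of_le' hk
      rw [hc k (by omega)]
      exact hl' _ (List.getElem_mem _)
    · obtain ⟨y, hy, hy'⟩ := hl'' hG2
      obtain ⟨k, hk, rfl⟩ := List.getElem_of_mem hy
      exact ⟨k + 1, by omega, by omega, by rw [hc k hk, hy']⟩
  obtain ⟨a0, a1, k, a2, a3, a4⟩ := first F h
  obtain ⟨b0, b1, k', b2, b3, b4⟩ := first F' h'
  simp only [point, Prod.mk.injEq] at e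
  have d : ∀ j, 1 ≤ j → j < n → (F.coord j).1 - (F.coord 1).1 = (F'.coord j).1 - (F'.coord 1).1 := by
    intro j hj hj'
    rcases Nat.lt_or_ge j 2 with h2 | h2
    · obtain rfl : j = 1 := by omega
      simp
    · obtain ⟨j, rfl⟩ := Nat.exists_eq_add_of_le' h2
      exact congrFun e.1 ⟨j, by omega⟩
  -- The differences to coordinate 1 agree, and both sequences have minimum 0, so the common shift
  -- is the same.
  have c1 : (F.coord 1).1 = (F'.coord 1).1 := by
    have d1 := d k a2 a3
    have d2 := d k' b2 b3
    have d3 := a1 k' b2 b3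
    have d4 := b1 k a2 a3
    linarith
  have flag : ∀ G : PlanarForest I, G.IsShape J → ∀ j : Fin n,
      (G.coord j).2.1 = decide (j ∈ J) ∧ (j ∉ J → (G.coord j).2.2 = 0) := by
    intro G hG j
    have hj : (j : ℕ) < (coords 0 0 G).length := by rw [length_coords, hG.2.2.1]; exact j.2
    have hj' : (j : ℕ) < G.flags.length := by rw [hG.2.2.1]; exact j.2
    have h1 : G.coord j = (coords 0 0 G)[(j : ℕ)] := List.getD_eq_getElem _ _ hj
    have h2 : (G.coord j).2.1 = G.flags.getD j false := by
      rw [h1, List.getD_eq_getElem _ _ hj']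
      simp only [← map_coords 0 0 G, List.getElem_map]
    have h3 : j ∈ J ↔ G.flags.getD j false = true := by
      conv_lhs => rw [← hG.2.2.2, stumps]
      simp
    refine ⟨?_, fun hJ => ?_⟩
    · rw [h2]
      by_cases hJ : j ∈ J
      · simpa [hJ] using h3.1 hJ
      · simpa [hJ] using mt h3.2 hJ
    · rw [h1]
      refine coords_snd 0 0 G _ (List.getElem_mem _) ?_
      rw [← h1, h2]
      simpa using mt h3.2 hJ
  have key : ∀ j : Fin n, F.coord j = F'.coord j := by
    intro j
    obtain ⟨f1, f2⟩ := flag F h j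
    obtain ⟨f1', f2'⟩ := flag F' h' j
    refine Prod.ext ?_ (Prod.ext (f1.trans f1'.symm) ?_)
    · rcases Nat.eq_zero_or_pos j.1 with hj | hj
      · rw [hj, a0, b0]
      · have := d j hj j.2
        linarith
    · by_cases hJ : j ∈ J
      · exact congrFun e.2 ⟨j, hJ⟩
      · rw [f2 hJ, f2' hJ]
  refine List.ext_getElem (hlen.trans hlen'.symm) fun j hj hj' => ?_
  have := key ⟨j, by omega⟩
  rwa [coord, coord, List.getD_eq_getElem _ _ hj, List.getD_eq_getElem _ _ hj'] at this

/-- Contracting the edges of length 0 that do not carry a stump changes neither the coordinates nor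
the gauge. Afterwards the coordinates determine the forest. -/
lemma IsShape.equivalent_of_point_eq (hn : 2 ≤ n) {F F' : PlanarForest I} (h : F.IsShape J)
    (h' : F'.IsShape J) (e : F.point J = F'.point J) : F.Equivalent F' ∧ F.gauge = F'.gauge := by
  obtain ⟨P, h1, h2, h3, h4, h5⟩ := h.exists_positive
  obtain ⟨P', h1', h2', h3', h4', h5'⟩ := h'.exists_positive
  obtain rfl := h2.eq_of_point_eq hn h2' h3 h3' (by rw [h5, h5', e])
  exact ⟨h1.trans h1'.symm, h4.symm.trans h4'⟩

lemma scale_of_gauge_eq_zero {F : PlanarForest I} (h : F.gauge = 0) (r : ℝ) : F.scale r = F := by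
  induction F with
  | nil => rfl
  | leaf B ih => rw [scale, ih h]
  | node ℓ A B ihA ihB =>
    have hB : B.gauge = 0 := le_antisymm (h ▸ le_max_right _ _) B.gauge_nonneg
    have hA := (h ▸ le_max_left _ _ :
      (if A.arity = 0 then |2 * (ℓ : ℝ) - 1| else max (ℓ : ℝ) A.gauge) ≤ 0)
    rw [scale, ihB hB]
    by_cases hz : A.arity = 0
    · rw [if_pos hz] at hA ⊢
      obtain rfl := arity_eq_zero.1 hz
      have h1 := abs_nonpos_iff.1 hA
      rw [h1, scale]
      congr 1
      rw [Set.projIcc_of_mem zero_le_one (by constructor <;> norm_num)]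
      refine Subtype.ext ?_
      simp only
      linarith
    · rw [if_neg hz] at hA ⊢
      obtain ⟨h1, h2⟩ := max_le_iff.1 hA
      have h3 : (ℓ : ℝ) = 0 := le_antisymm h1 ℓ.2.1
      rw [ihA (le_antisymm h2 A.gauge_nonneg), h3, mul_zero,
        Set.projIcc_of_mem zero_le_one (by constructor <;> norm_num)]
      congr 1
      exact Subtype.ext h3.symm

/-- A forest of gauge 0 is fixed by scaling with 2, so its point equals twice itself. Conversely, a
forest with point 0 has the same point as its scaling by 0, hence the same gauge. -/
lemma IsShape.gauge_eq_zero_iff (hn : 2 ≤ n) {F : PlanarForest I} (h : F.IsShape J) :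
    F.gauge = 0 ↔ F.point J = 0 := by
  constructor
  · intro h0
    have h1 := point_scale (J := J) (F := F) (r := 2) (by norm_num) (by rw [h0]; norm_num)
    rw [scale_of_gauge_eq_zero h0, two_smul] at h1
    simpa using h1
  · intro h0
    have h1 : (0 : ℝ) * F.gauge ≤ 1 := by rw [zero_mul]; exact zero_le_one
    have h2 := point_scale (J := J) le_rfl h1
    rw [zero_smul, ← h0] at h2
    rw [← ((h.scale 0).equivalent_of_point_eq hn h h2).2, (coords_gauge_scale le_rfl h1).1, zero_mul]

/-- Small points are coordinates of forests. -/
lemma exists_isShape (hn : 2 ≤ n) (v : (Fin (n - 2) → ℝ) × (J → ℝ)) (hv : ‖v‖ ≤ 1 / 2) :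
    ∃ F : PlanarForest I, F.IsShape J ∧ F.point J = v := by
  classical
  have hv1 : ∀ k, |v.1 k| ≤ 1 / 2 := fun k =>
    (norm_le_pi_norm v.1 k).trans ((norm_fst_le v).trans hv)
  have hv2 : ∀ k, |v.2 k| ≤ 1 / 2 := fun k =>
    (norm_le_pi_norm v.2 k).trans ((norm_snd_le v).trans hv)
  -- Only differences to coordinate 1 are prescribed, so coordinate 1 is provisionally set to 0.
  let h : ℕ → ℝ := fun j => if hj : 2 ≤ j ∧ j < n then v.1 ⟨j - 2, by omega⟩ else 0
  have hh : ∀ j, |h j| ≤ 1 / 2 := fun j => by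
    simp only [h]
    split_ifs
    · exact hv1 _
    · norm_num
  obtain ⟨k₀, hk₀, hk₀'⟩ := Finset.exists_min_image (Finset.Ico 1 n) h
    ⟨1, by simp only [Finset.mem_Ico]; omega⟩
  rw [Finset.mem_Ico] at hk₀
  -- Subtracting the minimum makes the lowest height 0, the height of the root vertex. The bound 1/2
  -- on the data keeps all heights within `[0, 1]`.
  let H : ℕ → ℝ := fun j => if 1 ≤ j ∧ j < n then h j - h k₀ else 0
  have hH : ∀ j, 0 ≤ H j ∧ H j ≤ 1 := fun j => by
    simp only [H]
    split_ifs with hj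
    · have h1 := hk₀' j (Finset.mem_Ico.2 hj)
      have h2 := abs_le.1 (hh j)
      have h3 := abs_le.1 (hh k₀)
      constructor <;> linarith
    · norm_num
  let f : ℕ → Bool := fun j => if hj : j < n then decide (⟨j, hj⟩ ∈ J) else false
  let τ : ℕ → ℝ := fun j =>
    if hj : j < n then (if hJ : ⟨j, hj⟩ ∈ J then v.2 ⟨⟨j, hj⟩, hJ⟩ else 0) else 0
  obtain ⟨F, h1, h2, h3, h4⟩ := exists_coords H f τ
    (fun j k => by have := hH j; have := hH k; linarith)
    (fun k => by
      simp only [τ]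
      split_ifs
      · exact (hv2 _).trans (by norm_num)
      · norm_num
      · norm_num)
    (fun k hk => by
      simp only [τ, f] at hk ⊢
      split_ifs at hk ⊢ <;> simp_all)
    (n - 1) 0 0 (fun k _ _ => ⟨(hH k).1, by rw [zero_add]; exact (hH k).2⟩)
  have en : n - 1 + 1 = n := by omega
  rw [en] at h3 h4
  have ha := h3 ⟨k₀, by omega, by omega, by simp only [H]; rw [if_pos hk₀, sub_self]⟩
  have hc : ∀ k < n, F.coord k = (if k = 0 then 0 else H k, f k, τ k) := fun k hk => by
    rw [coord, h4, List.getD_eq_getElem _ _ (by simpa using hk)]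
    simp
  have hf : F.flags = (List.range' 0 n).map f := by
    rw [← map_coords 0 0, h4, List.map_map]
    rfl
  refine ⟨F, ⟨h1, by omega, by simp [hf], ?_⟩, Prod.ext (funext fun k => ?_) (funext fun k => ?_)⟩
  · ext k
    rw [stumps, hf]
    simp [f]
  · have hk := k.2
    simp only [point]
    rw [hc _ (by omega), hc 1 (by omega)]
    have e1 : H (k + 2) = h (k + 2) - h k₀ := if_pos ⟨by omega, by omega⟩
    have e2 : H 1 = h 1 - h k₀ := if_pos ⟨by omega, by omega⟩
    have e3 : h (k + 2) = v.1 k := dif_pos ⟨by omega, by omega⟩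
    have e4 : h 1 = 0 := dif_neg (by omega)
    simp [e1, e2, e3, e4]
  · simp only [point]
    rw [hc _ k.1.2]
    have : τ k.1 = v.2 k := by
      have hk := k.2
      simp [τ, hk]
    exact this

end PlanarForest

/-! ### From coordinates to Euclidean discs -/

namespace PlanarForest

section

variable {n d : ℕ} {J : Finset (Fin n)}
  (e : ((Fin (n - 2) → ℝ) × (J → ℝ)) ≃L[ℝ] EuclideanSpace ℝ (Fin d))

/-- The point in the disc that belongs to a forest. -/
noncomputable def discPoint (F : PlanarForest I) : EuclideanSpace ℝ (Fin d) :=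
  (F.gauge / ‖e (F.point J)‖) • e (F.point J)

lemma norm_discPoint (hn : 2 ≤ n) {F : PlanarForest I} (h : F.IsShape J) :
    ‖F.discPoint e‖ = F.gauge := by
  rw [discPoint, norm_smul, norm_div, norm_norm, Real.norm_of_nonneg F.gauge_nonneg]
  by_cases h0 : F.point J = 0
  · rw [h0, map_zero, norm_zero, (h.gauge_eq_zero_iff hn).2 h0, mul_zero]
  · have : ‖e (F.point J)‖ ≠ 0 := by simpa using h0
    field_simp

/-- Away from the point 0 the formula is continuous. Where the point is 0, the formula divides by
zero, but the norm of the value is the gauge, which tends to 0. -/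
lemma continuous_discPoint (hn : 2 ≤ n) {K : Type} [TopologicalSpace K] {F : PlanarForest C(K, I)}
    (h : F.IsShape J) : Continuous fun t => (F.at' t).discPoint e := by
  have hg := F.continuous_gauge
  have hp := e.continuous.comp (F.continuous_point (J := J))
  have hs : ∀ t, (F.at' t).IsShape J := fun t => (isShape_map _ F).2 h
  rw [continuous_iff_continuousAt]
  intro t
  by_cases h0 : (F.at' t).point J = 0
  · have h1 : (F.at' t).discPoint e = 0 := by
      rw [discPoint, h0, map_zero, smul_zero]
    rw [ContinuousAt, h1, tendsto_zero_iff_norm_tendsto_zero]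
    have h2 := hg.tendsto t
    rw [((hs t).gauge_eq_zero_iff hn).2 h0] at h2
    simpa only [norm_discPoint e hn (hs _)] using h2
  · have : ‖e ((F.at' t).point J)‖ ≠ 0 := by simpa using h0
    exact (hg.continuousAt.div hp.norm.continuousAt this).smul hp.continuousAt

/-- Two forests with the same image have points on one ray and the same gauge. One point is `c`
times the other with `c ≤ 1`, so the gauge is multiplied by `c` as well, which forces `c = 1` unless
the gauge is 0. -/
lemma point_eq_of_discPoint_eq (hn : 2 ≤ n) {F F' : PlanarForest I} (h : F.IsShape J)
    (h' : F'.IsShape J) (hd : F.discPoint e = F'.discPoint e) : F.point J = F'.point J := by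
  have hg : F.gauge = F'.gauge := by rw [← norm_discPoint e hn h, hd, norm_discPoint e hn h']
  by_cases h0 : F.point J = 0
  · rw [h0, ((h'.gauge_eq_zero_iff hn).1 (hg.symm.trans ((h.gauge_eq_zero_iff hn).2 h0)))]
  have h0' : F'.point J ≠ 0 := fun h1 =>
    h0 ((h.gauge_eq_zero_iff hn).1 (hg.trans ((h'.gauge_eq_zero_iff hn).2 h1)))
  have hG : 0 < F.gauge := lt_of_le_of_ne F.gauge_nonneg fun h1 =>
    h0 ((h.gauge_eq_zero_iff hn).1 h1.symm)
  have hp : 0 < ‖e (F.point J)‖ := by simpa using h0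
  have hp' : 0 < ‖e (F'.point J)‖ := by simpa using h0'
  -- one of the points is a multiple of the other one by a factor at most 1
  have key : ∀ {F F' : PlanarForest I}, F.IsShape J → F'.IsShape J → F.gauge = F'.gauge →
      0 < F.gauge → ∀ c : ℝ, 0 ≤ c → c ≤ 1 → F'.point J = c • F.point J →
      F.point J = F'.point J := by
    intro F F' h h' hg hG c hc hc' hcF
    have h1 : c * F.gauge ≤ 1 := mul_le_one₀ hc' F.gauge_nonneg F.gauge_le_one
    have h2 := ((h.scale c).equivalent_of_point_eq hn h' ((point_scale hc h1).trans hcF.symm)).2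
    rw [(coords_gauge_scale hc h1).1, ← hg] at h2
    have : c = 1 := by
      have := mul_right_cancel₀ hG.ne' (h2.trans (one_mul _).symm)
      exact this
    rw [hcF, this, one_smul]
  have hd' : ∀ {F F' : PlanarForest I}, F.gauge = F'.gauge → 0 < F.gauge →
      0 < ‖e (F'.point J)‖ → F.discPoint e = F'.discPoint e →
      F'.point J = (‖e (F'.point J)‖ / ‖e (F.point J)‖) • F.point J := by
    intro F F' hg hG hp' hd
    apply e.injective
    rw [map_smul]
    rw [discPoint, discPoint, ← hg, div_eq_mul_inv, div_eq_mul_inv, mul_smul, mul_smul] at hd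
    have := smul_right_injective _ hG.ne' hd
    rw [div_eq_mul_inv, mul_smul, this, smul_smul, mul_inv_cancel₀ hp'.ne', one_smul]
  rcases le_total ‖e (F'.point J)‖ ‖e (F.point J)‖ with hle | hle
  · exact key h h' hg hG _ (by positivity) ((div_le_one hp).2 hle) (hd' hg hG hp' hd)
  · exact (key h' h hg.symm (hg ▸ hG) _ (by positivity) ((div_le_one hp').2 hle)
      (hd' hg.symm (hg ▸ hG) hp hd.symm)).symm

/-- Forests exist for all points of norm at most 1/2. One in the required direction is scaled until
its gauge is the norm of `p`, which is possible since this norm is at most 1. -/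
lemma exists_discPoint_eq (hn : 2 ≤ n) (p : Disc d) :
    ∃ F : PlanarForest I, F.IsShape J ∧ F.discPoint e = p.1 := by
  by_cases hp : p.1 = 0
  · obtain ⟨F, h, h'⟩ := exists_isShape (J := J) hn 0 (by norm_num)
    exact ⟨F, h, by rw [discPoint, h', map_zero, smul_zero, hp]⟩
  have hp1 : ‖p.1‖ ≤ 1 := mem_closedBall_zero_iff.1 p.2
  have hv : 0 < ‖e.symm p.1‖ := by simpa using hp
  obtain ⟨F, h, h'⟩ := exists_isShape (J := J) hn ((1 / 2 / ‖e.symm p.1‖) • e.symm p.1) (by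
    rw [norm_smul, Real.norm_of_nonneg (by positivity), div_mul_cancel₀ _ hv.ne'])
  set c := 1 / 2 / ‖e.symm p.1‖
  have hc : 0 < c := by positivity
  have hpt : F.point J ≠ 0 := by
    rw [h']
    exact smul_ne_zero hc.ne' (norm_pos_iff.1 hv)
  have hG : 0 < F.gauge := lt_of_le_of_ne F.gauge_nonneg fun h1 =>
    hpt ((h.gauge_eq_zero_iff hn).1 h1.symm)
  have hr : 0 ≤ ‖p.1‖ / F.gauge := by positivity
  have hr' : ‖p.1‖ / F.gauge * F.gauge ≤ 1 := by rwa [div_mul_cancel₀ _ hG.ne']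
  refine ⟨F.scale (‖p.1‖ / F.gauge), h.scale _, ?_⟩
  have hp0 : 0 < ‖p.1‖ := norm_pos_iff.2 hp
  rw [discPoint, point_scale hr hr', (coords_gauge_scale hr hr').1, h', div_mul_cancel₀ _ hG.ne',
    smul_smul, map_smul, e.apply_symm_apply, norm_smul, Real.norm_of_nonneg (by positivity),
    smul_smul]
  have : ‖p.1‖ / (‖p.1‖ / F.gauge * c * ‖p.1‖) * (‖p.1‖ / F.gauge * c) = 1 := by
    field_simp
  rw [this, one_smul]

/-- The shapes of the forests that describe the points of a cell. -/
abbrev Shapes {n : ℕ} (J : Finset (Fin n)) : Type :=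
  {s : PlanarForest Unit // s.IsShape J ∧ s.size ≤ 2 * n}

instance : Finite (Shapes J) :=
  ((finite_size_le (2 * n)).subset fun _ (h : _ ∧ _) => h.2).to_subtype

lemma IsShape.size_le {L : Type} {F : PlanarForest L} (h : F.IsShape J) : F.size ≤ 2 * n := by
  have := h.1.size_add_arity_le
  rw [h.2.2.1] at this
  omega

/-- The forests that describe the points of a cell. -/
abbrev ShapeCubes {n : ℕ} (J : Finset (Fin n)) : Type := Σ s : Shapes J, s.1.Cube

lemma IsShape.exists_fill {F : PlanarForest I} (h : F.IsShape J) :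
    ∃ c : ShapeCubes J, fill c.1.1 c.2 = F := by
  obtain ⟨s, c, rfl⟩ := F.exists_fill
  have hs := isShape_fill.1 h
  exact ⟨⟨⟨s, hs, hs.size_le⟩, c⟩, rfl⟩

/-- The projection from the cubes to the disc. -/
noncomputable def discProj (hn : 2 ≤ n) : C(ShapeCubes J, Disc d) where
  toFun c := ⟨(fill c.1.1 c.2).discPoint e, by
    rw [mem_closedBall_zero_iff, norm_discPoint e hn (isShape_fill.2 c.1.2.1)]
    exact gauge_le_one _⟩
  continuous_toFun := by
    refine Continuous.subtype_mk (continuous_sigma fun s => ?_) _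
    obtain ⟨F, hF⟩ := s.1.exists_taut
    by_cases hs : Nonempty s.1.Cube
    · obtain ⟨c⟩ := hs
      have h1 : F.IsShape J := by
        have := isShape_fill (c := c).2 s.2.1
        rw [← hF] at this
        exact (isShape_map _ F).1 this
      simpa only [hF] using continuous_discPoint e hn h1
    · exact continuous_iff_continuousAt.2 fun t => (hs ⟨t⟩).elim

/-- There are finitely many shapes with compact cubes, and the disc is Hausdorff, so a continuous
surjection is a quotient map. This yields continuity of the characteristic map. -/
lemma isQuotientMap_discProj (hn : 2 ≤ n) : IsQuotientMap (discProj (J := J) e hn) := by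
  refine .of_surjective_continuous (fun p => ?_) (discProj e hn).continuous
  obtain ⟨F, h, hF⟩ := exists_discPoint_eq e hn p
  obtain ⟨c, rfl⟩ := h.exists_fill
  exact ⟨c, Subtype.ext hF⟩

/-- The projection from the cubes to the space of trees. -/
noncomputable def shapeProj {i : ℕ} (hJ : J.card = i) : C(ShapeCubes J, TreeSpace (n - i)) where
  toFun c := TreeSpace.mk ⟨.vertex (fill c.1.1 c.2), (isShape_fill.2 c.1.2.1).leaves.trans
    (by rw [hJ])⟩
  continuous_toFun := by
    refine continuous_sigma fun s => ?_
    have hs : (PlanarTree.vertex s.1).leaves = n - i := s.2.1.leaves.trans (by rw [hJ])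
    exact (TreeSpace.isQuotientMap_proj _).continuous.comp
      (@continuous_sigmaMk {s : PlanarTree Unit // s.leaves = n - i} (fun s => s.1.Cube) _
        ⟨.vertex s.1, hs⟩)

variable {i : ℕ} (hJ : J.card = i)

lemma factorsThrough_shapeProj (hn : 2 ≤ n) :
    Function.FactorsThrough (shapeProj hJ) (discProj (J := J) e hn) := fun c c' h => by
  have h1 := isShape_fill (c := c.2).2 c.1.2.1
  have h2 := isShape_fill (c := c'.2).2 c'.1.2.1
  have h3 := point_eq_of_discPoint_eq e hn h1 h2 (congrArg Subtype.val h)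
  exact TreeSpace.mk_eq_of_equivalent (.vertex (h1.equivalent_of_point_eq hn h2 h3).1) _ _

/-- The characteristic map of a cell. -/
noncomputable def cellChar (hn : 2 ≤ n) : C(Disc d, TreeSpace (n - i)) :=
  (isQuotientMap_discProj e hn).lift (shapeProj hJ) (factorsThrough_shapeProj e hJ hn)

lemma cellChar_eq (hn : 2 ≤ n) {F : PlanarForest I} (h : F.IsShape J) {p : Disc d}
    (hp : F.discPoint e = p.1) : cellChar e hJ hn p =
      TreeSpace.mk ⟨.vertex F, h.leaves.trans (by rw [hJ])⟩ := by
  obtain ⟨c, rfl⟩ := h.exists_fill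
  have h1 : p = discProj e hn c := Subtype.ext hp.symm
  rw [h1]
  exact DFunLike.congr_fun ((isQuotientMap_discProj e hn).lift_comp (shapeProj hJ)
    (factorsThrough_shapeProj e hJ hn)) c

end

end PlanarForest

open PlanarForest in
/-- The cells of the trees of type `(n, i)`, for `n ≥ 2`. -/
noncomputable def treeCells {n i d : ℕ} (hn : 2 ≤ n)
    (e : ∀ j : {J : Finset (Fin n) // J.card = i},
      ((Fin (n - 2) → ℝ) × (j.1 → ℝ)) ≃L[ℝ] EuclideanSpace ℝ (Fin d)) :
    TreeCells n i d {J : Finset (Fin n) // J.card = i} where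
  char j := cellChar (e j) j.2 hn
  ok_of_boundary j p hp := by
    obtain ⟨F, h, hF⟩ := exists_discPoint_eq (e j) hn p
    rw [cellChar_eq (e j) j.2 hn h hF]
    -- The norm in the disc is the gauge, so the boundary sphere is where the type drops.
    have h1 := h.1.ok_of_gauge_eq_one h.2.1 h.2.2.1 hn (by
      rw [← norm_discPoint (e j) hn h, hF, hp])
    rw [h.univalent, j.2] at h1
    exact h1
  interior x := by
    constructor
    · rintro ⟨j, p, hp, rfl⟩
      obtain ⟨F, h, hF⟩ := exists_discPoint_eq (e j) hn p
      -- Once the edges of length 0 not carrying stumps are contracted, gauge less than 1 means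
      -- prime.
      obtain ⟨P, h1, h2, h3, h4, h5⟩ := h.exists_positive
      have hP : P.Prime := prime_of_reduced h2.1 h3 (by
        rwa [h4, ← norm_discPoint (e j) hn h, hF])
      have hl : (PlanarTree.vertex P).leaves = n - i := h2.leaves.trans (by rw [j.2])
      have h0 : P.arity ≠ 0 := by have := h2.two_le_arity hn; omega
      refine ⟨⟨.vertex P, hl⟩, ⟨h2.2.1, hP⟩, ?_, ?_⟩
      · have h6 := P.length_flags
        rw [h2.2.2.1] at h6
        simp only [PlanarTree.leaves, PlanarTree.univalent, if_neg h0, zero_add, h2.univalent, j.2]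
          at h6 ⊢
        exact ⟨h6.symm, trivial⟩
      · rw [cellChar_eq (e j) j.2 hn h hF]
        exact TreeSpace.mk_eq_of_equivalent (.vertex h1.symm) _ _
    · rintro ⟨⟨T, hT⟩, hTp, ⟨h1, h2⟩, rfl⟩
      cases T with
      | triv => exact hTp.elim
      | vertex F =>
        obtain ⟨hr, hp, hg⟩ := hTp.2.reduced
        have h0 : F.arity ≠ 0 := fun h0 => by
          obtain rfl := arity_eq_zero.1 h0
          simp [PlanarTree.leaves, PlanarTree.univalent, leaves, univalent, arity] at h1
          omega
        simp only [PlanarTree.leaves, PlanarTree.univalent, if_neg h0, zero_add] at h1 h2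
        have hl : F.flags.length = n := by rw [F.length_flags, h1]
        let j : {J : Finset (Fin n) // J.card = i} := ⟨F.stumps n, by rw [card_stumps hl, h2]⟩
        have h : F.IsShape j.1 := ⟨hr, hTp.1, hl, rfl⟩
        have hle : ‖F.discPoint (e j)‖ < 1 := by rwa [norm_discPoint (e j) hn h]
        exact ⟨j, ⟨F.discPoint (e j), mem_closedBall_zero_iff.2 hle.le⟩, hle,
          cellChar_eq (e j) j.2 hn h rfl⟩
  inj j p j' p' hp hp' hx := by
    obtain ⟨F, h, hF⟩ := exists_discPoint_eq (e j) hn p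
    obtain ⟨P, h1, h2, h3, h4, h5⟩ := h.exists_positive
    obtain ⟨F', h', hF'⟩ := exists_discPoint_eq (e j') hn p'
    obtain ⟨P', h1', h2', h3', h4', h5'⟩ := h'.exists_positive
    have hP : P.Prime := prime_of_reduced h2.1 h3 (by
      rwa [h4, ← norm_discPoint (e j) hn h, hF])
    have hP' : P'.Prime := prime_of_reduced h2'.1 h3' (by
      rwa [h4', ← norm_discPoint (e j') hn h', hF'])
    rw [cellChar_eq (e j) j.2 hn h hF, cellChar_eq (e j') j'.2 hn h' hF'] at hx
    have hx' := PlanarTree.equivalent_of_mk_eq hx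
    have h6 : PlanarTree.vertex P = .vertex P' :=
      PlanarTree.Prime.eq_of_equivalent ⟨h2.2.1, hP⟩ ⟨h2'.2.1, hP'⟩
        ((PlanarTree.Equivalent.vertex h1.symm).trans (hx'.trans (.vertex h1')))
    obtain rfl := PlanarTree.vertex.inj h6
    obtain rfl : j = j' := Subtype.ext (h2.2.2.2.symm.trans h2'.2.2.2)
    refine ⟨rfl, Subtype.ext ?_⟩
    rw [← hF, ← hF', discPoint, discPoint, ← h4, ← h5, ← h4', ← h5']
  family K _ _ _ R hR h1 h2 hl := by
    have he : R.ends = n := by omega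
    have h2' : R.uni = i := by
      rw [rootUni, if_neg (by omega)] at h2
      exact h2
    -- Reducing the whole family at once gives one shape for all parameters, hence one set of stump
    -- positions and one disc.
    obtain ⟨F, h3, h4, h5, h6, h7⟩ := PlanarTree.exists_reduced hR (by omega)
    have hn' : F.flags.length = n := h6.trans he
    let j : {J : Finset (Fin n) // J.card = i} := ⟨F.stumps n, by rw [card_stumps hn', h7, h2']⟩
    have h : F.IsShape j.1 := ⟨h3, h4, hn', rfl⟩
    have ht : ∀ t, (F.at' t).IsShape j.1 := fun t => (isShape_map _ F).2 h
    have hm : ∀ t, (F.at' t).discPoint (e j) ∈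
        Metric.closedBall (0 : EuclideanSpace ℝ (Fin d)) 1 := fun t => by
      rw [mem_closedBall_zero_iff, norm_discPoint (e j) hn (ht t)]
      exact gauge_le_one _
    refine ⟨j, ⟨fun t => ⟨_, hm t⟩, (continuous_discPoint (e j) hn h).subtype_mk hm⟩, fun t => ?_⟩
    exact (TreeSpace.mk_eq_of_equivalent (h5 t) _ _).trans
      (cellChar_eq (e j) j.2 hn (ht t) rfl).symm

/-- Renaming of the cells. -/
def TreeCells.reindex {n i d : ℕ} {ι ι' : Type} (𝒞 : TreeCells n i d ι) (e : ι' ≃ ι) :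
    TreeCells n i d ι' where
  char j := 𝒞.char (e j)
  ok_of_boundary j := 𝒞.ok_of_boundary (e j)
  interior x := by
    rw [← 𝒞.interior x, e.surjective.exists]
  inj j p j' p' hp hp' h := by
    have := 𝒞.inj _ _ _ _ hp hp' h
    exact ⟨e.injective this.1, this.2⟩
  family K _ _ _ R hR h1 h2 hl := by
    obtain ⟨j, q, hq⟩ := 𝒞.family K R hR h1 h2 hl
    exact ⟨e.symm j, q, fun t => by rw [hq, e.apply_symm_apply]⟩

/-- There is one cell for each choice of the `i` positions of the stumps among the `n` ends, and its
parameter space has dimension `(n - 2) + i`. -/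
lemma nonempty_treeCells {n i : ℕ} (hn : 2 ≤ n) :
    Nonempty (TreeCells n i (n - 2 + i) (Fin (n.choose i))) := by
  have e : ∀ j : {J : Finset (Fin n) // J.card = i},
      ((Fin (n - 2) → ℝ) × (j.1 → ℝ)) ≃L[ℝ] EuclideanSpace ℝ (Fin (n - 2 + i)) := fun j =>
    ContinuousLinearEquiv.ofFinrankEq (by simp [j.2])
  have e' : Fin (n.choose i) ≃ {J : Finset (Fin n) // J.card = i} :=
    (Fintype.equivFinOfCardEq (by simp)).symm
  exact ⟨(treeCells hn e).reindex e'⟩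

/-- The cell of type `(1, 1)`. -/
lemma nonempty_treeCells_one : Nonempty (TreeCells 1 1 0 (Fin 1)) := by
  have hd : ∀ p : Disc 0, ‖p.1‖ = 0 := fun p => by
    rw [Subsingleton.elim p.1 0, norm_zero]
  -- A reduced family of the type `(1, 1)` has at most one end, so it is constantly the tree with a
  -- single inner vertex, of valence 1.
  have key : ∀ (K : Type) [TopologicalSpace K] {R : PlanarForest C(K, I)}, R.All (· ≠ 1) →
      max 1 R.ends = 1 → R.rootUni = 1 →
      ∀ t, ((PlanarTree.vertex R).at' t).Equivalent (.vertex .nil) := by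
    intro K _ R hR h1 h2 t
    obtain ⟨R', h3, h4, h5, h6⟩ := PlanarForest.exists_reduced hR
    have h9 := h3.arity_le
    refine (PlanarTree.Equivalent.vertex (h4 t)).trans ?_
    match R', h3, h5, h6, h9 with
    | .nil, _, _, _, _ => exact .refl _
    | .leaf B, h3, h5, h6, h9 =>
      have hB : B.arity = 0 := by
        simp only [PlanarForest.arity] at h9
        omega
      obtain rfl := PlanarForest.arity_eq_zero.1 hB
      simp only [PlanarForest.flags, List.length_singleton, PlanarForest.univalent] at h5 h6
      rw [PlanarForest.rootUni, if_neg (by omega)] at h2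
      omega
    | .node ℓ A B, h3, h5, h6, h9 =>
      have hB : B.arity = 0 := by
        simp only [PlanarForest.arity] at h9
        omega
      obtain rfl := PlanarForest.arity_eq_zero.1 hB
      have hA : A.arity = 0 := by
        by_contra hA
        have h7 := h3.2.1.arity_le
        have h8 := h3.1
        simp only [PlanarForest.flags, if_neg hA, List.append_nil] at h5
        omega
      obtain rfl := PlanarForest.arity_eq_zero.1 hA
      exact .of_step (.unary_node _ _)
  refine ⟨⟨fun _ => ⟨fun _ => TreeSpace.mk ⟨.vertex .nil, rfl⟩, continuous_const⟩,
    fun j p hp => ?_, fun x => ⟨?_, ?_⟩, fun j p j' p' _ _ _ => ?_, ?_⟩⟩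
  · rw [hd] at hp
    exact (zero_ne_one hp).elim
  · rintro ⟨j, p, -, rfl⟩
    exact ⟨⟨.vertex .nil, rfl⟩, ⟨by simp [PlanarForest.arity], trivial⟩, ⟨rfl, rfl⟩, rfl⟩
  · rintro ⟨⟨T, hT⟩, hTp, ⟨h1, h2⟩, rfl⟩
    refine ⟨0, 0, by rw [hd]; exact zero_lt_one, ?_⟩
    cases T with
    | triv => exact hTp.elim
    | vertex F =>
      have h0 : F.arity = 0 := by
        by_contra h0
        have h3 := hTp.2.reduced.1.arity_le
        have h4 := hTp.1
        simp only [PlanarTree.leaves, PlanarTree.univalent, if_neg h0, zero_add] at h1 h2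
        rw [F.length_flags] at h3
        omega
      obtain rfl := PlanarForest.arity_eq_zero.1 h0
      rfl
  · exact ⟨Subsingleton.elim _ _, Subtype.ext (Subsingleton.elim _ _)⟩
  · intro K _ _ _ R hR h1 h2 hl
    refine ⟨0, ContinuousMap.const _ ⟨0, by simp⟩, fun t => ?_⟩
    exact TreeSpace.mk_eq_of_equivalent (key K hR h1 h2 t) _ _

/-! ## Contractions of the spaces of trees -/

namespace PlanarForest

/-- The clock of a juxtaposition. -/
def joinClock (p q : ℝ × ℝ) : ℝ × ℝ := (min (min p.1 q.1) (max p.2 q.2), min p.2 q.2)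

/-- The two times that govern the pruning of a forest without leaves: during pruning, the time runs
from `1` to `0`; from the first time on there is at most one end left, and at the second time
the forest has vanished. -/
noncomputable def clock : PlanarForest I → ℝ × ℝ
  | nil => (1, 1)
  | leaf B => B.clock
  | node ℓ A B => joinClock (A.clock.1, min A.clock.2 (A.clock.1 * (1 - ℓ / 2))) B.clock

/-- The length of an edge during pruning. -/
noncomputable def pruneLength (u a : ℝ) (ℓ : I) : I :=
  ⟨max 0 (ℓ - 2 * max 0 (1 - u / a)), le_max_left _ _, max_le zero_le_one
    ((sub_le_self _ (mul_nonneg zero_le_two (le_max_left _ _))).trans ℓ.2.2)⟩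

/-- The forest at the time `u` of the pruning of its parts without leaves, with all other lengths
multiplied by `s`. -/
noncomputable def prune (u s : I) : PlanarForest I → PlanarForest I
  | nil => nil
  | leaf B => leaf (B.prune u s)
  | node ℓ A B => node (if A.leaves = 0 then pruneLength u A.clock.1 ℓ else s * ℓ)
      (A.prune u s) (B.prune u s)

lemma clock_bounds (F : PlanarForest I) :
    0 < F.clock.2 ∧ F.clock.2 ≤ F.clock.1 ∧ F.clock.1 ≤ 1 := by
  induction F with
  | nil => simp [clock]
  | leaf B ih => exact ih
  | node ℓ A B ihA ihB =>
    obtain ⟨h1, h2, h3⟩ := ihA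
    obtain ⟨h1', h2', h3'⟩ := ihB
    have hℓ := ℓ.2.1
    have hℓ' := ℓ.2.2
    have h4 : 0 < A.clock.1 * (1 - ℓ / 2) := mul_pos (h1.trans_le h2) (by linarith)
    refine ⟨lt_min (lt_min h1 h4) h1', le_min (le_min ?_ ?_) min_le_max, ?_⟩
    · exact (min_le_left _ _).trans ((min_le_left _ _).trans h2)
    · exact (min_le_right _ _).trans h2'
    · exact (min_le_left _ _).trans ((min_le_left _ _).trans h3)

lemma joinClock_assoc (p q r : ℝ × ℝ) :
    joinClock (joinClock p q) r = joinClock p (joinClock q r) := by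
  obtain ⟨p, p'⟩ := p
  obtain ⟨q, q'⟩ := q
  obtain ⟨r, r'⟩ := r
  simp only [joinClock, Prod.mk.injEq, min_assoc, and_true]
  rcases le_total p' q' with h | h <;> rcases le_total q' r' with h' | h' <;>
    rcases le_total p' r' with h'' | h'' <;> simp only [min_eq_left, min_eq_right, max_eq_left,
      max_eq_right, h, h', h''] <;> grind

lemma clock_append (A B : PlanarForest I) : (A.append B).clock = joinClock A.clock B.clock := by
  induction A with
  | nil =>
    obtain ⟨h1, h2, h3⟩ := B.clock_bounds
    refine Prod.ext ?_ ?_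
    · change B.clock.1 = min (min 1 B.clock.1) (max 1 B.clock.2)
      rw [min_eq_right h3, max_eq_left (h2.trans h3), min_eq_left h3]
    · exact (min_eq_right (h2.trans h3)).symm
  | leaf A ih => exact ih
  | node ℓ A A' _ ih => rw [append, clock, clock, ih, joinClock_assoc]

/-- Two successive edges below a forest start to shrink at the same time and at the same speed. So
they have vanished when the longer one has, in accordance with the maximum in the identification. -/
lemma clock_step {F F' : PlanarForest I} (h : Step F F') (h0 : F.leaves = 0) :
    F.clock = F'.clock := by
  induction h with
  | contract A B =>
    obtain ⟨h1, h2, h3⟩ := A.clock_bounds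
    rw [clock_append, clock]
    simp [min_eq_left h2]
  | unary_leaf ℓ B => simp [leaves] at h0
  | unary_node ℓ ℓ' A B =>
    obtain ⟨h1, h2, h3⟩ := A.clock_bounds
    have key : ∀ ℓ : I, clock (node ℓ A nil) =
        (A.clock.1, min A.clock.2 (A.clock.1 * (1 - ℓ / 2))) := by
      intro ℓ
      refine Prod.ext ?_ ?_
      · change min (min A.clock.1 1) (max _ 1) = A.clock.1
        rw [min_eq_left h3, min_eq_left (h3.trans (le_max_right _ _))]
      · exact min_eq_left ((min_le_left _ _).trans (h2.trans h3))
    rw [clock, key, clock]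
    congr 2
    simp only [min_assoc]
    congr 1
    have hm : ((max ℓ ℓ' : I) : ℝ) = max (ℓ : ℝ) ℓ' :=
      (Subtype.mono_coe (Set.Icc (0 : ℝ) 1)).map_max
    rw [hm, ← mul_min_of_nonneg _ _ (h1.le.trans h2)]
    congr 1
    rcases le_total (ℓ : ℝ) ℓ' with h | h
    · rw [max_eq_right h, min_eq_left (by linarith)]
    · rw [max_eq_left h, min_eq_right (by linarith)]
  | leaf h ih => simp [leaves] at h0
  | node_left ℓ B h ih =>
    simp only [leaves, Nat.add_eq_zero_iff] at h0
    rw [clock, clock, ih h0.1]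
  | node_right ℓ A h ih =>
    simp only [leaves, Nat.add_eq_zero_iff] at h0
    rw [clock, clock, ih h0.2]

lemma pruneLength_zero (u a : ℝ) : pruneLength u a 0 = 0 := by
  refine Subtype.ext (max_eq_left ?_)
  have := le_max_left 0 (1 - u / a)
  change (0 : ℝ) - _ ≤ 0
  linarith

lemma pruneLength_le (u a : ℝ) (ℓ : I) : pruneLength u a ℓ ≤ ℓ :=
  Subtype.coe_le_coe.1 (max_le ℓ.2.1
    (sub_le_self _ (mul_nonneg zero_le_two (le_max_left _ _))))

lemma pruneLength_of_le {u a : ℝ} (ha : 0 < a) (h : a ≤ u) (ℓ : I) : pruneLength u a ℓ = ℓ := by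
  refine Subtype.ext ?_
  have h1 : 1 - u / a ≤ 0 := by
    rw [sub_nonpos, one_le_div ha]
    exact h
  change max 0 ((ℓ : ℝ) - 2 * max 0 (1 - u / a)) = ℓ
  rw [max_eq_left h1, mul_zero, sub_zero, max_eq_right ℓ.2.1]

lemma pruneLength_eq_zero {u a : ℝ} (ha : 0 < a) {ℓ : I} (h : u ≤ a * (1 - ℓ / 2)) :
    pruneLength u a ℓ = 0 := by
  refine Subtype.ext (max_eq_left ?_)
  have h1 : u / a ≤ 1 - ℓ / 2 := by
    rw [div_le_iff₀ ha]
    linarith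
  have := le_max_right 0 (1 - u / a)
  linarith

lemma pruneLength_max (u a : ℝ) (ℓ ℓ' : I) :
    pruneLength u a (max ℓ ℓ') = max (pruneLength u a ℓ) (pruneLength u a ℓ') := by
  have hmono : Monotone (pruneLength u a) := fun ℓ ℓ' h =>
    Subtype.coe_le_coe.1 (max_le_max le_rfl (sub_le_sub_right (Subtype.coe_le_coe.2 h) _))
  exact hmono.map_max

lemma leaves_prune (u s : I) (F : PlanarForest I) : (F.prune u s).leaves = F.leaves := by
  induction F with
  | nil => rfl
  | leaf B ih => simp [prune, leaves, ih]
  | node ℓ A B ihA ihB => simp [prune, leaves, ihA, ihB]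

lemma prune_append (u s : I) (A B : PlanarForest I) :
    (A.append B).prune u s = (A.prune u s).append (B.prune u s) := by
  induction A with
  | nil => rfl
  | leaf A ih => exact congrArg leaf ih
  | node ℓ A A' _ ih => simp only [append, prune, ih]

/-- The new length of an edge depends only on its old length and on the clock of the forest above,
which is an invariant of its class if there are no leaves. As a function of the length it fixes 0
and commutes with maxima. -/
lemma prune_step (u s : I) {F F' : PlanarForest I} (h : Step F F') :
    Step (F.prune u s) (F'.prune u s) := by
  induction h with
  | contract A B =>
    rw [prune_append, prune, pruneLength_zero, mul_zero, ite_self]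
    exact .contract _ _
  | unary_leaf ℓ B => exact .unary_leaf _ _
  | unary_node ℓ ℓ' A B =>
    obtain ⟨h1, h2, h3⟩ := A.clock_bounds
    have hc : (node ℓ' A nil).clock.1 = A.clock.1 := by
      change min (min A.clock.1 1) (max _ 1) = A.clock.1
      rw [min_eq_left h3, min_eq_left (h3.trans (le_max_right _ _))]
    have hs : s * max ℓ ℓ' = max (s * ℓ) (s * ℓ') :=
      (show Monotone fun x : I => s * x from fun x y h => Subtype.coe_le_coe.1
        (mul_le_mul_of_nonneg_left (Subtype.coe_le_coe.2 h) s.2.1)).map_max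
    have := Step.unary_node (if A.leaves = 0 then pruneLength u A.clock.1 ℓ else s * ℓ)
      (if A.leaves = 0 then pruneLength u A.clock.1 ℓ' else s * ℓ') (A.prune u s) (B.prune u s)
    simp only [prune, hc, leaves, Nat.add_zero]
    convert this using 2
    split_ifs
    · exact pruneLength_max _ _ _ _
    · exact hs
  | leaf h ih => exact .leaf ih
  | node_left ℓ B h ih =>
    rename_i A A'
    have hl := leaves_step h
    have : (if A.leaves = 0 then pruneLength u A.clock.1 ℓ else s * ℓ) =
        if A'.leaves = 0 then pruneLength u A'.clock.1 ℓ else s * ℓ := by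
      rw [← hl]
      split_ifs with h0
      · rw [clock_step h h0]
      · rfl
    rw [prune, prune, this]
    exact .node_left _ _ ih
  | node_right ℓ A h ih => exact .node_right _ _ ih

lemma prune_one (F : PlanarForest I) : F.prune 1 1 = F := by
  induction F with
  | nil => rfl
  | leaf B ih => exact congrArg leaf ih
  | node ℓ A B ihA ihB =>
    obtain ⟨h1, h2, h3⟩ := A.clock_bounds
    have : pruneLength (1 : I) A.clock.1 ℓ = ℓ := pruneLength_of_le (h1.trans_le h2) h3 ℓ
    rw [prune, ihA, ihB, this, one_mul, ite_self]

lemma pruneLength_at_zero (F : PlanarForest I) (ℓ : I) :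
    pruneLength (0 : I) F.clock.1 ℓ = 0 := by
  obtain ⟨h1, h2, h3⟩ := F.clock_bounds
  refine pruneLength_eq_zero (h1.trans_le h2) (mul_nonneg (h1.le.trans h2) ?_)
  have := ℓ.2.2
  linarith

/-- The forest of `k` leaves. -/
def corolla (L : Type) : ℕ → PlanarForest L
  | 0 => nil
  | k + 1 => leaf (corolla L k)

lemma leaves_corolla {L : Type} (k : ℕ) : (corolla L k).leaves = k := by
  induction k with
  | zero => rfl
  | succ k ih => simp [corolla, leaves, ih]

lemma corolla_append {L : Type} (k m : ℕ) :
    (corolla L k).append (corolla L m) = corolla L (k + m) := by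
  induction k with
  | zero => rw [Nat.zero_add]; rfl
  | succ k ih =>
    rw [Nat.succ_add]
    exact congrArg leaf ih

lemma prune_zero_equivalent (F : PlanarForest I) :
    (F.prune 0 0).Equivalent (corolla I F.leaves) := by
  induction F with
  | nil => exact .refl _
  | leaf B ih => exact ih.leaf
  | node ℓ A B ihA ihB =>
    rw [prune, pruneLength_at_zero, zero_mul, ite_self]
    refine (Equivalent.of_step (.contract _ _)).trans ?_
    rw [leaves, ← corolla_append]
    exact ihA.append ihB

/-! ### The number of ends during the contraction -/

lemma ends_prune_of_le (u : I) {F : PlanarForest I} (h0 : F.leaves = 0) (h : u ≤ F.clock.2) :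
    (F.prune u 1).ends = 0 := by
  induction F with
  | nil => rfl
  | leaf B ih => simp [leaves] at h0
  | node ℓ A B ihA ihB =>
    obtain ⟨h1, h2, h3⟩ := A.clock_bounds
    simp only [leaves, Nat.add_eq_zero_iff] at h0
    have h4 := (h.trans (min_le_left _ _)).trans (min_le_left _ _)
    have h5 := (h.trans (min_le_left _ _)).trans (min_le_right _ _)
    rw [prune, if_pos h0.1, pruneLength_eq_zero (h1.trans_le h2) h5, ends,
      if_neg zero_ne_one_I, if_pos rfl, ihA h0.1 h4, ihB h0.2 (h.trans (min_le_right _ _))]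

/-- In a juxtaposition, the first time of the clock is reached when each part has at most one end
and one of the two parts has vanished. -/
lemma ends_prune_of_lt (u : I) {F : PlanarForest I} (h0 : F.leaves = 0) (h : u < F.clock.1) :
    (F.prune u 1).ends ≤ 1 := by
  induction F with
  | nil => simp [prune, ends]
  | leaf B ih => simp [leaves] at h0
  | node ℓ A B ihA ihB =>
    have h00 := h0
    simp only [leaves, Nat.add_eq_zero_iff] at h0
    obtain ⟨h1, h2⟩ := lt_min_iff.1 h
    obtain ⟨h1, h3⟩ := lt_min_iff.1 h1
    have hA := ihA h0.1 h1
    have hB := ihB h0.2 h3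
    rcases lt_max_iff.1 h2 with h4 | h4
    · have : ((node ℓ A nil).prune u 1).ends = 0 := by
        obtain ⟨h5, h6, h7⟩ := A.clock_bounds
        refine ends_prune_of_le u (by simp [leaves, h0]) ?_
        exact le_min h4.le ((h1.trans_le h7).le)
      rw [prune, ends] at this ⊢
      simp only [prune, ends, Nat.add_zero] at this
      omega
    · rw [prune, ends, ends_prune_of_le u h0.2 h4.le]
      split_ifs <;> omega

/-- This is why pruning stays inside the filtration term. An edge below a part without leaves starts
to shrink only when at most one end is left above it, so opening an edge of length 1 replaces the
one end that it represents by at most one. Edges with leaves above them keep their lengths because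
`s = 1`. -/
lemma ends_prune_le (u : I) (F : PlanarForest I) : (F.prune u 1).ends ≤ F.ends := by
  induction F with
  | nil => exact le_rfl
  | leaf B ih => simpa [prune, ends] using ih
  | node ℓ A B ihA ihB =>
    rw [prune, ends, ends]
    refine Nat.add_le_add ?_ ihB
    by_cases h0 : A.leaves = 0
    · rw [if_pos h0]
      obtain ⟨h1, h2, h3⟩ := A.clock_bounds
      rcases le_or_gt A.clock.1 u with h | h
      · rw [pruneLength_of_le (h1.trans_le h2) h]
        split_ifs <;> omega
      · have h4 := ends_prune_of_lt u h0 h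
        have h5 := pruneLength_le u A.clock.1 ℓ
        -- An edge of positive length counts for at least one end before pruning, an edge of length
        -- 0 is unaffected by it.
        by_cases hz : ℓ = 0
        · subst hz
          simpa [pruneLength_zero] using ihA
        · rw [if_neg hz]
          split_ifs <;> omega
    · rw [if_neg h0, one_mul]
      split_ifs <;> omega

/-- At time 0 the parts without leaves have vanished, and any other edge counting as an end carries
a leaf. So the number of ends is bounded by the number of leaves, whatever the lengths are. -/
lemma ends_prune_le_leaves (s : I) (F : PlanarForest I) : (F.prune 0 s).ends ≤ F.leaves := by
  induction F with
  | nil => exact le_rfl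
  | leaf B ih => simpa [prune, ends, leaves] using ih
  | node ℓ A B ihA ihB =>
    rw [prune, ends, leaves]
    refine Nat.add_le_add ?_ ihB
    by_cases h0 : A.leaves = 0
    · rw [if_pos h0, pruneLength_at_zero, if_neg zero_ne_one_I, if_pos rfl]
      exact ihA
    · split_ifs <;> omega

lemma good_of_ends_le {n : ℕ} (hn : 1 ≤ n) {F : PlanarForest I} (h : F.ends ≤ n) :
    F.Good fun e _ => e ≤ n :=
  .inl (max_le hn h)

lemma Good.ends_le {n : ℕ} (hn : 1 ≤ n) {F : PlanarForest I} (h : F.Good fun e _ => e ≤ n) :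
    F.ends ≤ n := by
  rcases h with h | h <;> omega

lemma Ok.prune_left {n : ℕ} (hn : 1 ≤ n) (u : I) {F : PlanarForest I}
    (h : F.Ok fun e _ => e ≤ n) : (F.prune u 1).Ok fun e _ => e ≤ n := by
  induction F with
  | nil => trivial
  | leaf B ih => exact ih h
  | node ℓ A B ihA ihB =>
    refine ⟨fun h1 => good_of_ends_le hn ((ends_prune_le u A).trans ((h.1 ?_).ends_le hn)),
      ihA h.2.1, ihB h.2.2⟩
    split_ifs at h1 with h0
    · exact le_antisymm unitInterval.le_one' (h1 ▸ pruneLength_le _ _ _)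
    · rwa [one_mul] at h1

lemma ok_prune_right {n : ℕ} (hn : 1 ≤ n) (s : I) {F : PlanarForest I} (h : F.leaves ≤ n) :
    (F.prune 0 s).Ok fun e _ => e ≤ n := by
  induction F with
  | nil => trivial
  | leaf B ih => exact ih ((Nat.le_succ _).trans h)
  | node ℓ A B ihA ihB =>
    rw [leaves] at h
    exact ⟨fun _ => good_of_ends_le hn ((ends_prune_le_leaves s A).trans (by omega)),
      ihA (by omega), ihB (by omega)⟩

/-! ### Continuity of the contraction -/

lemma continuous_clock {K : Type} [TopologicalSpace K] (F : PlanarForest C(K, I)) :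
    Continuous fun t => (F.at' t).clock := by
  induction F with
  | nil => exact continuous_const
  | leaf B ih => exact ih
  | node ℓ A B ihA ihB =>
    have h1 : Continuous fun t => (ℓ t : ℝ) := continuous_subtype_val.comp ℓ.continuous
    change Continuous fun t => joinClock ((A.at' t).clock.1, min (A.at' t).clock.2
      ((A.at' t).clock.1 * (1 - ℓ t / 2))) (B.at' t).clock
    unfold joinClock
    fun_prop

lemma exists_prune_family {K : Type} [TopologicalSpace K] (u s : C(K, I))
    (F : PlanarForest C(K, I)) : ∃ G : PlanarForest C(K, I),
      ∀ t, G.at' t = (F.at' t).prune (u t) (s t) := by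
  induction F with
  | nil => exact ⟨nil, fun _ => rfl⟩
  | leaf B ih =>
    obtain ⟨G, hG⟩ := ih
    exact ⟨leaf G, fun t => congrArg leaf (hG t)⟩
  | node ℓ A B ihA ihB =>
    obtain ⟨G, hG⟩ := ihA
    obtain ⟨G', hG'⟩ := ihB
    have h1 : Continuous fun t => (ℓ t : ℝ) := continuous_subtype_val.comp ℓ.continuous
    have h2 : Continuous fun t => (u t : ℝ) := continuous_subtype_val.comp u.continuous
    have h3 := A.continuous_clock
    have h4 : Continuous fun t => pruneLength (u t) (A.at' t).clock.1 (ℓ t) := by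
      refine Continuous.subtype_mk ?_ _
      have h5 : Continuous fun t => (u t : ℝ) / (A.at' t).clock.1 :=
        h2.div (continuous_fst.comp h3) fun t =>
          ((A.at' t).clock_bounds.1.trans_le (A.at' t).clock_bounds.2.1).ne'
      fun_prop
    refine ⟨node (if A.leaves = 0 then ⟨_, h4⟩ else s * ℓ) G G', fun t => ?_⟩
    have h5 : (A.at' t).leaves = A.leaves := leaves_map _ _
    simp only [at', map, prune, node.injEq]
    refine ⟨?_, hG t, hG' t⟩
    have h6 : (A.map fun ℓ => ℓ t).leaves = A.leaves := h5
    rw [h6]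
    split_ifs <;> rfl

end PlanarForest

/-! ### The contraction on trees and on the spaces of trees -/

namespace PlanarTree

/-- The tree during the contraction. -/
noncomputable def prune (u s : I) : PlanarTree I → PlanarTree I
  | triv => triv
  | vertex F => vertex (F.prune u s)

lemma leaves_prune (u s : I) : ∀ T : PlanarTree I, (T.prune u s).leaves = T.leaves
  | triv => rfl
  | vertex F => F.leaves_prune u s

lemma prune_step (u s : I) {T T' : PlanarTree I} (h : Step T T') :
    Step (T.prune u s) (T'.prune u s) := by
  cases h with
  | vertex h => exact .vertex (PlanarForest.prune_step u s h)
  | unary_leaf => exact .unary_leaf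
  | unary_node ℓ A => exact .unary_node _ _

lemma prune_one : ∀ T : PlanarTree I, T.prune 1 1 = T
  | triv => rfl
  | vertex F => congrArg vertex F.prune_one

lemma prune_zero_equivalent : ∀ T : PlanarTree I,
    (T.prune 0 0).Equivalent (vertex (.corolla I T.leaves))
  | triv => (Equivalent.of_step .unary_leaf).symm
  | vertex F => .vertex F.prune_zero_equivalent

lemma Ok.prune_left {n : ℕ} (hn : 1 ≤ n) (u : I) : ∀ {T : PlanarTree I},
    T.Ok (fun e _ => e ≤ n) → (T.prune u 1).Ok fun e _ => e ≤ n
  | triv, _ => trivial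
  | vertex F, h => ⟨PlanarForest.good_of_ends_le hn ((F.ends_prune_le u).trans (h.1.ends_le hn)),
      PlanarForest.Ok.prune_left hn u h.2⟩

lemma ok_prune_right {n : ℕ} (hn : 1 ≤ n) (s : I) : ∀ {T : PlanarTree I},
    T.leaves ≤ n → (T.prune 0 s).Ok fun e _ => e ≤ n
  | triv, _ => trivial
  | vertex F, h => ⟨PlanarForest.good_of_ends_le hn ((F.ends_prune_le_leaves s).trans h),
      PlanarForest.ok_prune_right hn s h⟩

lemma exists_prune_family {K : Type} [TopologicalSpace K] (u s : C(K, I)) :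
    ∀ F : PlanarTree C(K, I), ∃ G : PlanarTree C(K, I),
      ∀ t, G.at' t = (F.at' t).prune (u t) (s t)
  | triv => ⟨triv, fun _ => rfl⟩
  | vertex F => by
    obtain ⟨G, hG⟩ := F.exists_prune_family u s
    exact ⟨vertex G, fun t => congrArg vertex (hG t)⟩

end PlanarTree

namespace TreeSpace

variable {k : ℕ}

/-- The contraction of the space of trees: the first parameter controls the pruning of the parts
without leaves, the second one the lengths of the other edges. -/
noncomputable def prune (u s : I) : TreeSpace k → TreeSpace k :=
  Quot.map (fun T => ⟨T.1.prune u s, (T.1.leaves_prune u s).trans T.2⟩)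
    fun _ _ h => PlanarTree.prune_step u s h

/-- The product of the quotient map from the cubes with the locally compact `I` is a quotient map.
On a cube the pruned trees form a family of constant shape. -/
lemma continuous_prune (u s : C(I, I)) :
    Continuous fun p : I × TreeSpace k => prune (u p.1) (s p.1) p.2 := by
  refine (isQuotientMap_proj k).continuous_lift_prod_right ?_
  have h : Continuous fun p : Cubes k × I => prune (u p.2) (s p.2) (proj k p.1) := by
    refine continuous_sigma_prod fun a => ?_
    obtain ⟨F, hF⟩ := a.1.exists_taut
    let F' : PlanarTree C(a.1.Cube × I, I) := F.map fun ℓ => ℓ.comp ⟨_, continuous_fst⟩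
    obtain ⟨G, hG⟩ := F'.exists_prune_family (u.comp ⟨_, continuous_snd⟩)
      (s.comp ⟨_, continuous_snd⟩)
    have hF' : ∀ p, F'.at' p = PlanarTree.fill a.1 p.1 := fun p => by
      rw [← hF]
      cases F with
      | triv => rfl
      | vertex F => exact congrArg PlanarTree.vertex (F.map_map _ _)
    by_cases hc : Nonempty (a.1.Cube × I)
    · obtain ⟨c⟩ := hc
      have hl : G.leaves = k := by
        rw [← G.leaves_at' c, hG, PlanarTree.leaves_prune, hF', PlanarTree.leaves_fill, a.2]
      convert G.continuous_mk hl using 2 with p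
      refine congrArg mk (Subtype.ext ?_)
      refine Eq.symm ((hG p).trans ?_)
      rw [hF']
      rfl
    · exact continuous_iff_continuousAt.2 fun p => (hc ⟨p⟩).elim
  exact h.comp continuous_swap

/-- The path along which the space of trees is contracted: first the pruning, then the scaling. -/
noncomputable def pruneParam : C(I, I) × C(I, I) :=
  (⟨fun t => Set.projIcc 0 1 zero_le_one (1 - 2 * (t : ℝ)), by fun_prop⟩,
    ⟨fun t => Set.projIcc 0 1 zero_le_one (2 - 2 * (t : ℝ)), by fun_prop⟩)

lemma pruneParam_zero : pruneParam.1 0 = 1 ∧ pruneParam.2 0 = 1 :=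
  ⟨Set.projIcc_of_right_le zero_le_one (by norm_num), Set.projIcc_of_right_le zero_le_one (by norm_num)⟩

lemma pruneParam_one : pruneParam.1 1 = 0 ∧ pruneParam.2 1 = 0 :=
  ⟨Set.projIcc_of_le_left zero_le_one (by norm_num), Set.projIcc_of_le_left zero_le_one (by norm_num)⟩

lemma pruneParam_cases (t : I) : pruneParam.1 t = 0 ∨ pruneParam.2 t = 1 := by
  rcases le_total (t : ℝ) (1 / 2) with h | h
  · exact .inr (Set.projIcc_of_right_le zero_le_one (by linarith))
  · exact .inl (Set.projIcc_of_le_left zero_le_one (by linarith))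

/-- The contraction of the space of trees. -/
noncomputable def contraction (t : I) : TreeSpace k → TreeSpace k :=
  prune (pruneParam.1 t) (pruneParam.2 t)

lemma contraction_zero (x : TreeSpace k) : contraction 0 x = x := by
  rw [contraction, pruneParam_zero.1, pruneParam_zero.2]
  induction x using Quot.ind with | mk T =>
  exact congrArg mk (Subtype.ext T.1.prune_one)

/-- The tree with one internal vertex and `k` leaves. -/
noncomputable def corolla (k : ℕ) : TreeSpace k :=
  mk ⟨.vertex (.corolla I k), PlanarForest.leaves_corolla k⟩

lemma contraction_one (x : TreeSpace k) : contraction 1 x = corolla k := by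
  rw [contraction, pruneParam_one.1, pruneParam_one.2]
  induction x using Quot.ind with | mk T =>
  obtain ⟨T, rfl⟩ := T
  exact mk_eq_of_equivalent T.prune_zero_equivalent _ _

/-- At each time either the pruning is complete, so that `k ≤ n` leaves bound all components, or no
scaling has happened, so that no component has gained ends. -/
lemma Ok.contraction {n : ℕ} (hn : 1 ≤ n) (hk : k ≤ n) (t : I) {x : TreeSpace k}
    (hx : x.Ok fun e _ => e ≤ n) : (contraction t x).Ok fun e _ => e ≤ n := by
  rw [TreeSpace.contraction]
  induction x using Quot.ind with | mk T =>
  rcases pruneParam_cases t with h | h <;> rw [h]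
  · exact PlanarTree.ok_prune_right hn _ (T.2.trans_le hk)
  · exact PlanarTree.Ok.prune_left hn _ hx

lemma ok_corolla {n : ℕ} (hn : 1 ≤ n) (hk : k ≤ n) : (corolla k).Ok fun e _ => e ≤ n := by
  have h := (PlanarTree.vertex (.corolla I k)).prune_zero_equivalent
  have h' := PlanarTree.ok_prune_right (T := .vertex (.corolla I k)) hn 0
    ((PlanarForest.leaves_corolla k).trans_le hk)
  have e : (PlanarTree.vertex (.corolla I k)).leaves = k := PlanarForest.leaves_corolla k
  rw [h.ok_iff, e] at h'
  exact h'

instance : ContractibleSpace (TreeSpace k) := by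
  rw [contractible_iff_id_nullhomotopic]
  exact ⟨corolla k, ⟨⟨⟨fun p => contraction p.1 p.2, continuous_prune _ _⟩, contraction_zero,
    contraction_one⟩⟩⟩

end TreeSpace

/-- The topology of the suboperad is compactly generated, so maps into it are only controlled on
compact Hausdorff test spaces `K`. The homotopy is therefore checked on `K × I` and turned into a
map to the space of paths `C(I, X)`, whose continuity can be tested along `K`. -/
lemma contractibleSpace_treeFiltration {n k : ℕ} (hn : 1 ≤ n) (hk : k ≤ n) :
    ContractibleSpace ((treeFiltration n).X (deg k)) := by
  let X := (truncGen (fun e _ => e ≤ n) ⊤).X (deg k)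
  have hX : ∀ x : X, TreeSpace.Ok (fun e _ => e ≤ n) (GeneratedCarrier.val x) :=
    fun x => ok_of_generated x.property
  let H : I → X → X := fun t x => toTruncGen (TreeSpace.contraction t (GeneratedCarrier.val x))
    ((hX x).contraction hn hk t)
  have hH : ∀ (K : Type) [TopologicalSpace K] [CompactSpace K] [T2Space K] (g : C(K, X)),
      Continuous fun p : K × I => H p.2 (g p.1) := by
    intro K _ _ _ g
    refine continuous_toTruncGen (K := K × I) ?_ fun p => (hX (g p.1)).contraction hn hk p.2
    exact (TreeSpace.continuous_prune _ _).comp (continuous_snd.prodMk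
      (GeneratedCarrier.continuous_val.comp (g.continuous.comp continuous_fst)))
  have h1 : ∀ x : X, Continuous fun t => H t x := fun x =>
    (hH Unit (.const _ x)).comp (continuous_const (y := ()) |>.prodMk continuous_id)
  have h2 : Continuous fun x : X => (⟨fun t => H t x, h1 x⟩ : C(I, X)) := by
    refine continuous_from_uCompactlyGeneratedSpace.{0} _ fun K g => ?_
    exact ContinuousMap.continuous_of_continuous_uncurry _ (hH K g)
  have h3 : Continuous fun p : X × I => H p.2 p.1 :=
    ContinuousMap.continuous_uncurry_of_continuous ⟨_, h2⟩
  change ContractibleSpace X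
  rw [contractible_iff_id_nullhomotopic]
  refine ⟨toTruncGen (TreeSpace.corolla k) (TreeSpace.ok_corolla hn hk),
    ⟨⟨⟨fun p => H p.1 p.2, h3.comp continuous_swap⟩, fun x => ?_, fun x => ?_⟩⟩⟩
  · exact GeneratedCarrier.ext (TreeSpace.contraction_zero _)
  · exact GeneratedCarrier.ext (TreeSpace.contraction_one _)

/-! ## Contractible spaces are weakly equivalent to a point -/

section

variable {X Y : Type} [TopologicalSpace X] [TopologicalSpace Y]

/-- A clamped expansion of the unit interval. -/
noncomputable def expand (r t : I) : I :=
  Set.projIcc 0 1 zero_le_one ((t : ℝ) + r * (t - 1 / 2))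

lemma expand_end (r : I) {t : I} (h : t = 0 ∨ t = 1) : expand r t = t := by
  have := r.2.1
  rcases h with rfl | rfl
  · exact Set.projIcc_of_le_left zero_le_one (by simp; linarith)
  · refine Set.projIcc_of_right_le _ ?_
    simp only [Set.Icc.coe_one]
    linarith

/-- A function on the interval that vanishes at the ends and is `1` where `expand 1` takes values in
the interior. -/
noncomputable def tent (t : I) : I :=
  Set.projIcc 0 1 zero_le_one (4 * min (t : ℝ) (1 - t))

lemma tent_end {t : I} (h : t = 0 ∨ t = 1) : tent t = 0 := by
  rcases h with rfl | rfl <;> exact Set.projIcc_of_le_left zero_le_one (by simp)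

lemma expand_one_or_tent (t : I) : (expand 1 t = 0 ∨ expand 1 t = 1) ∨ tent t = 1 := by
  by_cases h : (t : ℝ) ≤ 1 / 4
  · refine .inl (.inl (Set.projIcc_of_le_left _ ?_))
    simp only [Set.Icc.coe_one]
    linarith
  by_cases h' : 3 / 4 ≤ (t : ℝ)
  · refine .inl (.inr (Set.projIcc_of_right_le _ ?_))
    simp only [Set.Icc.coe_one]
    linarith
  · refine .inr (Set.projIcc_of_right_le _ ?_)
    have : 1 / 4 ≤ min (t : ℝ) (1 - t) := le_min (by linarith) (by linarith)
    linarith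

/-- The contraction `H` may move the base point, so every loop is compared with one fixed loop `ω`.
The map `expand` squeezes the loop into an inner cube to which `H` is applied, while the collar runs
along the track of the base point under `H`. -/
instance [ContractibleSpace X] (n : ℕ) (x : X) : Subsingleton (HomotopyGroup (Fin n) X x) := by
  obtain ⟨p, ⟨H⟩⟩ := contractible_iff_id_nullhomotopic X |>.1 ‹_›
  have hτ : Continuous fun y : I^(Fin n) => Finset.univ.inf fun i => tent (y i) := by
    refine Continuous.finset_inf_apply fun i _ => ?_
    unfold tent
    fun_prop
  let τ : C(I^(Fin n), I) := ⟨_, hτ⟩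
  have hτ0 : ∀ y ∈ Cube.boundary (Fin n), τ y = 0 := fun y ⟨i, hi⟩ =>
    le_antisymm ((Finset.inf_le (Finset.mem_univ i)).trans_eq (tent_end hi)) unitInterval.nonneg'
  have hex : Continuous fun q : I × I => expand q.1 q.2 := by
    unfold expand
    fun_prop
  let ω : C(I^(Fin n), X) := ⟨fun y => H (τ y, x), by fun_prop⟩
  have key : ∀ γ : GenLoop (Fin n) X x, ContinuousMap.HomotopicRel γ.1 ω (Cube.boundary (Fin n)) := by
    intro γ
    have hγ : Continuous fun q : I × (I^(Fin n)) => γ.1 fun i => expand q.1 (q.2 i) :=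
      γ.1.continuous.comp (continuous_pi fun i =>
        hex.comp (continuous_fst.prodMk ((continuous_apply i).comp continuous_snd)))
    refine ⟨⟨⟨⟨fun q => H (q.1 * τ q.2, γ.1 fun i => expand q.1 (q.2 i)), ?_⟩, ?_, ?_⟩, ?_⟩⟩
    · exact H.continuous.comp (Continuous.prodMk (by fun_prop) hγ)
    · intro y
      have : (fun i => expand 0 (y i)) = y := by
        funext i
        simp only [expand, Set.Icc.coe_zero, zero_mul, add_zero]
        exact Set.projIcc_val _ _
      simp only [zero_mul, this]
      exact H.apply_zero _
    · intro y
      simp only [one_mul]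
      change _ = H (τ y, x)
      -- Either the expanded point is on the boundary, where the loop has the value `x`, or `τ y =
      -- 1`, and `H` has already arrived at its constant value.
      by_cases h : (fun i => expand 1 (y i)) ∈ Cube.boundary (Fin n)
      · exact congrArg (fun z => H (τ y, z)) (γ.2 _ h)
      · have : τ y = 1 := by
          refine le_antisymm unitInterval.le_one' ?_
          change 1 ≤ Finset.univ.inf fun i => tent (y i)
          refine Finset.le_inf fun i _ => ?_
          exact ((expand_one_or_tent (y i)).resolve_left fun h' => h ⟨i, h'⟩).ge
        rw [this]
        exact (H.apply_one _).trans (H.apply_one x).symm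
    · intro t y hy
      simp only [ContinuousMap.coe_mk, hτ0 y hy, mul_zero]
      have : (fun i => expand t (y i)) ∈ Cube.boundary (Fin n) := by
        obtain ⟨i, hi⟩ := hy
        refine ⟨i, ?_⟩
        simpa only [expand_end t hi] using hi
      refine (H.apply_zero _).trans ?_
      exact (γ.2 _ this).trans (γ.2 _ hy).symm
  refine ⟨fun a b => ?_⟩
  induction a using Quotient.inductionOn with | h γ =>
  induction b using Quotient.inductionOn with | h γ' =>
  exact Quotient.sound ((key γ).trans (key γ').symm)

lemma isWeakEquivalence_of_contractible [ContractibleSpace X] [ContractibleSpace Y] (f : C(X, Y)) :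
    IsWeakEquivalence f := by
  have key : ∀ {α β : Type} [Subsingleton α] [Nonempty α] [Subsingleton β] (g : α → β),
      Function.Bijective g := fun {α β} _ _ _ g =>
    ⟨fun _ _ _ => Subsingleton.elim _ _, fun b => ⟨Classical.arbitrary α, Subsingleton.elim _ _⟩⟩
  have hs : ∀ {Z : Type} [TopologicalSpace Z] [ContractibleSpace Z],
      Subsingleton (ZerothHomotopy Z) ∧ Nonempty (ZerothHomotopy Z) := fun {Z} _ _ =>
    ⟨⟨fun a b => Quotient.inductionOn₂ a b fun x y => Quotient.sound (PathConnectedSpace.joined x y)⟩,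
      ⟨Quotient.mk _ (Classical.arbitrary Z)⟩⟩
  have h1 := hs (Z := X)
  have h2 := hs (Z := Y)
  have := h1.1
  have := h1.2
  have := h2.1
  exact ⟨@key (ZerothHomotopy X) (ZerothHomotopy Y) h1.1 h1.2 h2.1 _, fun n x => key _⟩

end

lemma exists_weakEquivalence_assoc {N : ℕ∞} (P : TopOperad N) (h : ∀ c, ContractibleSpace (P.X c)) :
    ∃ f : P ⟶ assoc N, ∀ c, IsWeakEquivalence (Hom.app f c) := by
  refine ⟨(show Hom P (assoc N) from
    { app := fun c => .const _ (), map_comp := fun _ _ _ _ => rfl, map_one := fun _ => rfl }),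
    fun c => ?_⟩
  have : ContractibleSpace ((assoc N).X c) := inferInstanceAs (ContractibleSpace Unit)
  exact isWeakEquivalence_of_contractible _

/-! ## Comparison of the filtration terms -/

/-- A prime tree satisfies `u ≤ e`, and its type is not that of the identity; hence other types can
be added or dropped without changing the generators. -/
lemma primeTrees_subset {S S' : ℕ → ℕ → Prop} (h : ∀ e u, S' e u → u ≤ e → OrId S e u)
    (k : Color ⊤) : primeTrees S' k ⊆ primeTrees S k := by
  rintro x ⟨⟨T, hT⟩, hTp, hS, rfl⟩
  cases T with
  | triv => exact hTp.elim
  | vertex F =>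
    have h1 := hTp.type (S := S)
    refine ⟨⟨.vertex F, hT⟩, hTp, (h _ _ hS (Nat.le_add_left _ _)).resolve_right ?_, rfl⟩
    simp only
    rw [← h1.1, ← h1.2.1]
    exact h1.2.2.2.2

lemma isIso_truncIncl {N : ℕ∞} {S S' : ℕ → ℕ → Prop} (h : ∀ e u, S e u → S' e u)
    (h' : ∀ e u, S' e u → u ≤ e → OrId S e u) : IsIso (truncIncl h N) :=
  ⟨truncateMap (treeOperad.generatedIncl (primeTrees_subset h')) N le_top, rfl, rfl⟩

lemma PlanarForest.ok_of_forall {S : ℕ → ℕ → Prop} (h : ∀ e u, S e u) (F : PlanarForest I) :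
    F.Ok S := by
  induction F with
  | nil => trivial
  | leaf B ih => exact ih
  | node ℓ A B ihA ihB => exact ⟨fun _ => .inl (h _ _), ihA, ihB⟩

lemma TreeSpace.ok_of_forall {S : ℕ → ℕ → Prop} (h : ∀ e u, S e u) {n : ℕ} (x : TreeSpace n) :
    x.Ok S := by
  induction x using Quot.ind with | mk T =>
  obtain ⟨T, hT⟩ := T
  cases T with
  | triv => trivial
  | vertex F => exact ⟨.inl (h _ _), F.ok_of_forall h⟩

/-- The suboperad generated by all prime trees is the operad of trees. -/
def truncGenIso {S : ℕ → ℕ → Prop} (h : ∀ e u, S e u) : truncGen S ⊤ ≅ treeOperad where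
  hom := treeOperad.generatedι (primeTrees S)
  inv := (show Hom treeOperad (truncGen S ⊤) from
    { app := fun c => ⟨fun x => toTruncGen x (TreeSpace.ok_of_forall h x),
        continuous_from_uCompactlyGeneratedSpace.{0} (X := TreeSpace c.1) _
          fun _ g => continuous_toTruncGen g.2 fun _ => TreeSpace.ok_of_forall h _⟩
      map_comp := fun _ _ _ _ => rfl
      map_one := fun _ => rfl })
  hom_inv_id := rfl
  inv_hom_id := rfl

/-- A suboperad without generators is initial. -/
lemma nonempty_isInitial {N : ℕ∞} {S : ℕ → ℕ → Prop} (hN : InRange N 1)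
    (hS : ∀ e u, S e u → u ≤ e → e = 1 ∧ u = 0 ∨ e = 0) :
    Nonempty (Limits.IsInitial (truncGen S N)) := by
  -- The remaining types are that of the identity and those with `e = 0`, and no prime tree has
  -- them.
  have hempty : ∀ k x, x ∉ primeTrees S k := by
    intro k x hx
    have h1 : ∀ e u, S e u → u ≤ e → OrId (fun e _ => e = 0) e u := fun e u h h' =>
      (hS e u h h').symm
    obtain ⟨⟨T, hT⟩, hTp, h2, -⟩ := primeTrees_subset h1 k hx
    cases T with
    | triv => exact hTp.elim
    | vertex F =>
      have h3 := (hTp.type (S := S)).1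
      simp only at h2
      omega
  have h1 : ∀ (c : Color ⊤) (x : treeOperad.X c), Generated treeOperad (primeTrees S) c x →
      (⟨c, x⟩ : Σ c, treeOperad.X c) = ⟨⟨1, le_top⟩, treeOperad.one le_top⟩ := by
    intro c x hx
    induction hx with
    | of x hx => exact (hempty _ _ hx).elim
    | one h => rfl
    | @comp n m k i h x y _ _ ihx ihy =>
      cases ihx
      cases ihy
      obtain ⟨k, hk⟩ := k
      simp only at h
      obtain rfl : k = 1 := by omega
      exact congrArg (Sigma.mk _) (treeOperad.one_comp (n := ⟨1, le_top⟩) le_top i h _)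
  have h2 : ∀ (c : Color N) (x : (truncGen S N).X c),
      (⟨c, x⟩ : Σ c, (truncGen S N).X c) = ⟨⟨1, hN⟩, (truncGen S N).one hN⟩ := by
    rintro ⟨c, hc⟩ x
    obtain ⟨h3, h4⟩ := Sigma.mk.inj_iff.1 (h1 _ _ (GeneratedCarrier.property x))
    obtain rfl : c = 1 := congrArg Subtype.val h3
    exact congrArg (Sigma.mk _) (GeneratedCarrier.ext (eq_of_heq h4))
  have h3 : ∀ (c : Color N) (x : (truncGen S N).X c), (⟨1, hN⟩ : Color N) = c :=
    fun c x => (congrArg Sigma.fst (h2 c x)).symm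
  have h4 : ∀ c, Subsingleton ((truncGen S N).X c) := fun c => ⟨fun x y =>
    eq_of_heq (Sigma.mk.inj_iff.1 ((h2 c x).trans (h2 c y).symm)).2⟩
  refine ⟨Limits.IsInitial.ofUniqueHom (fun C => (show Hom (truncGen S N) C from
    { app := fun c => ⟨fun x => h3 c x ▸ C.one hN, ?_⟩
      map_comp := fun {n m k} i h x y => ?_
      map_one := fun _ => rfl })) fun C f => ?_⟩
  · have := h4 c
    exact continuous_of_const fun x y => by rw [Subsingleton.elim x y]
  · obtain rfl := h3 n x
    obtain rfl := h3 m y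
    obtain rfl := h3 k ((truncGen S N).comp i h x y)
    exact (C.one_comp hN i h _).symm
  · refine Hom.ext (funext fun c => ContinuousMap.ext fun x => ?_)
    obtain rfl := h3 c x
    have := h4 ⟨1, hN⟩
    rw [Subsingleton.elim x ((truncGen S N).one hN)]
    exact f.map_one hN

/-! ## Unions of filtrations -/

section

variable {S : ℕ → ℕ → ℕ → Prop} {S' : ℕ → ℕ → Prop}
  (hm : ∀ ⦃k k'⦄, k ≤ k' → ∀ e u, S k e u → S k' e u)

-- A tree has finitely many components, so one stage contains all their types. This also holds for
-- families with their generic components.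
include hm in
lemma PlanarForest.exists_ok_stage (hS : ∀ e u, S' e u → ∃ k, S k e u) {L : Type} [Zero L] [One L]
    {F : PlanarForest L} (h : F.Ok S') : ∃ k, F.Ok (S k) := by
  induction F with
  | nil => exact ⟨0, trivial⟩
  | leaf B ih => exact ih h
  | node ℓ A B ihA ihB =>
    obtain ⟨k, hk⟩ := ihA h.2.1
    obtain ⟨m, hm'⟩ := ihB h.2.2
    have h1 : ∃ l, ℓ = 1 → A.Good (S l) := by
      by_cases hℓ : ℓ = 1
      · rcases h.1 hℓ with h | h
        · obtain ⟨l, hl⟩ := hS _ _ h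
          exact ⟨l, fun _ => .inl hl⟩
        · exact ⟨0, fun _ => .inr h⟩
      · exact ⟨0, fun h => (hℓ h).elim⟩
    obtain ⟨l, hl⟩ := h1
    refine ⟨max k (max m l), fun hℓ => (hl hℓ).imp_left (hm ?_ _ _), hk.mono (hm ?_),
      hm'.mono (hm ?_)⟩ <;> omega

include hm in
lemma PlanarTree.exists_ok_stage (hS : ∀ e u, S' e u → ∃ k, S k e u) {L : Type} [Zero L] [One L] :
    ∀ {T : PlanarTree L}, T.Ok S' → ∃ k, T.Ok (S k)
  | triv, _ => ⟨0, trivial⟩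
  | vertex F, h => by
    obtain ⟨k, hk⟩ := PlanarForest.exists_ok_stage hm hS h.2
    rcases h.1 with h | h
    · obtain ⟨l, hl⟩ := hS _ _ h
      exact ⟨max k l, .inl (hm (le_max_right _ _) _ _ hl), hk.mono (hm (le_max_left _ _))⟩
    · exact ⟨k, .inr h, hk⟩

variable (N : ℕ∞)

/-- An increasing sequence of suboperads. -/
def stageFunctor : ℕ ⥤ TopOperad N where
  obj k := truncGen (S k) N
  map f := truncIncl (hm (leOfHom f)) N
  map_id _ := rfl
  map_comp _ _ := rfl

/-- The union of an increasing sequence of suboperads. -/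
def stageCocone (hS : ∀ e u, S' e u ↔ ∃ k, S k e u) : Limits.Cocone (stageFunctor hm N) where
  pt := truncGen S' N
  ι := { app := fun k => truncIncl (fun e u h => (hS e u).2 ⟨k, h⟩) N
         naturality := fun _ _ _ => rfl }

variable {N}

section

variable (s : Limits.Cocone (stageFunctor hm N))

lemma app_stage_eq {k k' : ℕ} {c : Color N} {x : TreeSpace c.1} (h : x.Ok (S k))
    (h' : x.Ok (S k')) : (s.ι.app k).app c (toTruncGen x h) = (s.ι.app k').app c (toTruncGen x h') := by
  wlog hk : k ≤ k' generalizing k k'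
  · exact (this h' h (le_of_not_ge hk)).symm
  · exact congrArg (fun f : truncGen (S k) N ⟶ s.pt => Hom.app f c (toTruncGen x h))
      (s.w (homOfLE hk)).symm

variable (hS : ∀ e u, S' e u ↔ ∃ k, S k e u)

include hm hS in
lemma exists_stage {n : ℕ} {x : TreeSpace n} (h : x.Ok S') : ∃ k, x.Ok (S k) := by
  induction x using Quot.ind with | mk T =>
  exact PlanarTree.exists_ok_stage hm (fun e u => (hS e u).1) h

/-- The map out of the union that is given by a cocone. -/
noncomputable def stageDesc (c : Color N) (x : {x : TreeSpace c.1 // x.Ok S'}) : s.pt.X c :=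
  (s.ι.app (exists_stage hm hS x.2).choose).app c (toTruncGen x.1 (exists_stage hm hS x.2).choose_spec)

lemma stageDesc_eq {k : ℕ} {c : Color N} {x : TreeSpace c.1} (hx : x.Ok S') (h : x.Ok (S k)) :
    stageDesc hm s hS c ⟨x, hx⟩ = (s.ι.app k).app c (toTruncGen x h) :=
  app_stage_eq hm s _ _

/-- A family whose generic components are admissible lies in one stage at all parameters, and there
the map is a morphism of the cocone. -/
lemma continuous_stageDesc (hl : ∀ k, LexLower (S k)) (hl' : LexLower S') (c : Color N) :
    Continuous (stageDesc hm s hS c) := by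
  refine TreeSpace.continuous_of_families hl' _ fun K _ _ _ T hT hok h' => ?_
  obtain ⟨k, hk⟩ := PlanarTree.exists_ok_stage hm (fun e u => (hS e u).1) hok
  have h1 : ∀ t, (T.at' t).Ok (S k) := fun t => hk.map_of_ok (hl k) rfl rfl zero_ne_one
  have h2 := ((s.ι.app k).app c).continuous.comp
    (continuous_toTruncGen (S := S k) (T.continuous_mk hT) h1)
  exact h2.congr fun t => (stageDesc_eq hm s hS (c := c)
    (x := TreeSpace.mk ⟨T.at' t, (T.leaves_at' t).trans hT⟩) (h' t) (h1 t)).symm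

end

/-- The union of an increasing sequence of suboperads is the colimit of the sequence. -/
noncomputable def isColimitStageCocone (hS : ∀ e u, S' e u ↔ ∃ k, S k e u)
    (hl : ∀ k, LexLower (S k)) (hl' : LexLower S') : Limits.IsColimit (stageCocone hm N hS) where
  desc s := (show Hom (truncGen S' N) s.pt from
    { app := fun c => ⟨fun x => stageDesc hm s hS c
          ⟨Hom.app (truncGenι S' N) c x, ok_of_truncGen x⟩,
        (continuous_stageDesc hm s hS hl hl' c).comp
          ((Hom.app (truncGenι S' N) c).continuous.subtype_mk fun x => ok_of_truncGen x)⟩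
      map_comp := fun {n m l} i h x y => by
        obtain ⟨k, hk⟩ := exists_stage hm hS (ok_of_truncGen x)
        obtain ⟨k', hk'⟩ := exists_stage hm hS (ok_of_truncGen y)
        have h1 : TreeSpace.Ok (S (max k k')) (Hom.app (truncGenι S' N) n x) :=
          hk.mono_orId fun e u h => .inl (hm (le_max_left _ _) e u h)
        have h2 : TreeSpace.Ok (S (max k k')) (Hom.app (truncGenι S' N) m y) :=
          hk'.mono_orId fun e u h => .inl (hm (le_max_right _ _) e u h)
        refine (stageDesc_eq hm s hS _ (TreeSpace.Ok.comp i h h1 h2)).trans ?_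
        refine (Hom.map_comp (s.ι.app (max k k')) i h (toTruncGen _ h1) (toTruncGen _ h2)).trans ?_
        exact congrArg₂ (s.pt.comp i h) (stageDesc_eq hm s hS _ h1).symm
          (stageDesc_eq hm s hS _ h2).symm
      map_one := fun h => (stageDesc_eq (k := 0) (c := ⟨1, h⟩) (x := TreeSpace.mk ⟨.triv, rfl⟩)
        hm s hS trivial trivial).trans
        (Hom.map_one (s.ι.app 0) h) })
  fac s k := by
    refine Hom.ext (funext fun c => ContinuousMap.ext fun x => ?_)
    exact stageDesc_eq hm s hS _ (ok_of_truncGen x)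
  uniq s f hf := by
    refine Hom.ext (funext fun c => ContinuousMap.ext fun x => ?_)
    obtain ⟨k, hk⟩ := exists_stage hm hS (ok_of_truncGen x)
    refine Eq.trans ?_ (stageDesc_eq hm s hS _ hk).symm
    exact congrArg (fun f : truncGen (S k) N ⟶ s.pt => Hom.app f c (toTruncGen _ hk)) (hf k)

end

/-! ## Cofibrancy -/

namespace TopOperad

/-- An isomorphism attaches the empty family of cells. -/
lemma freeAttachments_of_isIso {N : ℕ∞} {A B : TopOperad N} (f : A ⟶ B) [IsIso f] :
    freeAttachments N f :=
  ⟨Empty, Empty.elim, Empty.elim, ⟨{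
    attach := fun j => j.elim
    char := fun j => j.elim
    comm := fun j => j.elim
    exists_unique := fun C g _ _ => ⟨inv f ≫ g, ⟨by simp, fun j => j.elim⟩, fun h hh => by
      rw [← hh.1, IsIso.inv_hom_id_assoc]⟩ }⟩⟩

end TopOperad

/-! ### Adding the types of prime trees in lexicographic order -/

lemma lexLower_lexLt (n i : ℕ) : LexLower (LexLt n i) := fun e u e' u' h h' => by
  unfold LexLt at *
  omega

/-- The lexicographic successor of `(n, i)` among the pairs with `i ≤ n`. -/
def lexNext (p : ℕ × ℕ) : ℕ × ℕ := if p.2 < p.1 then (p.1, p.2 + 1) else (p.1 + 1, 0)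

/-- The sequence of the types of prime trees. -/
def lexSeq : ℕ → ℕ × ℕ
  | 0 => (1, 1)
  | k + 1 => lexNext (lexSeq k)

/-- The last estimate shows that the first entry is unbounded, so every type is eventually passed.
The third one excludes the type `(1, 0)` of the identity. -/
lemma lexSeq_bounds (k : ℕ) : 1 ≤ (lexSeq k).1 ∧ (lexSeq k).2 ≤ (lexSeq k).1 ∧
    ((lexSeq k).1 = 1 → (lexSeq k).2 = 1) ∧ k ≤ (lexSeq k).1 * (lexSeq k).1 + (lexSeq k).2 := by
  induction k with
  | zero => simp [lexSeq]
  | succ k ih =>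
    obtain ⟨h1, h2, h3, h4⟩ := ih
    simp only [lexSeq, lexNext]
    split_ifs with h
    · refine ⟨h1, h, fun h5 => ?_, ?_⟩
      · have := h3 h5
        omega
      · simp only
        omega
    · refine ⟨by simp, by simp, by simp; omega, ?_⟩
      simp only
      nlinarith

lemma exists_lt_lexSeq (e : ℕ) : ∃ k, e < (lexSeq k).1 := by
  refine ⟨e * e + e + 1, ?_⟩
  by_contra h
  obtain ⟨-, h2, -, h4⟩ := lexSeq_bounds (e * e + e + 1)
  have h5 := Nat.mul_le_mul (not_lt.1 h) (not_lt.1 h)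
  omega

/-- The sequence of sets of types, in degrees up to `N`. -/
def LexStage (N : ℕ∞) (k e u : ℕ) : Prop :=
  LexLt (lexSeq k).1 (lexSeq k).2 e u ∧ InRange N e

lemma LexStage.mono {N : ℕ∞} ⦃k k' : ℕ⦄ (h : k ≤ k') (e u : ℕ) (hk : LexStage N k e u) :
    LexStage N k' e u := by
  induction h with
  | refl => exact hk
  | step _ ih =>
    refine ⟨?_, ih.2⟩
    have := ih.1
    simp only [lexSeq, lexNext]
    split_ifs <;> simp only [LexLt] at * <;> omega

lemma LexStage.lower (N : ℕ∞) (k : ℕ) : LexLower (LexStage N k) := fun e u e' u' h h' =>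
  ⟨lexLower_lexLt _ _ h.1 h', h.2.mono (by omega)⟩

lemma exists_lexStage {N : ℕ∞} (e u : ℕ) : InRange N e ↔ ∃ k, LexStage N k e u := by
  constructor
  · intro h
    obtain ⟨k, hk⟩ := exists_lt_lexSeq e
    exact ⟨k, .inl hk, h⟩
  · rintro ⟨k, h⟩
    exact h.2

/-- If the next type is in the range, its cells are attached; otherwise no generator is added and
the inclusion is an isomorphism. -/
lemma freeAttachments_lexStage (N : ℕ∞) (k : ℕ) :
    freeAttachments N (truncIncl (LexStage.mono (N := N) (Nat.le_succ k)) N) := by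
  obtain ⟨h1, h2, h3, -⟩ := lexSeq_bounds k
  have hcases : ∀ e u, LexStage N (k + 1) e u → u ≤ e →
      LexStage N k e u ∨ (e = (lexSeq k).1 ∧ u = (lexSeq k).2) := by
    intro e u h hu
    by_cases h4 : LexLt (lexSeq k).1 (lexSeq k).2 e u
    · exact .inl ⟨h4, h.2⟩
    · refine .inr ?_
      have := h.1
      simp only [lexSeq, lexNext] at this
      split_ifs at this <;> simp only [LexLt] at * <;> omega
  by_cases hr : InRange N (lexSeq k).1
  · have hst : IsStage N (LexStage N k) (LexStage N (k + 1)) (lexSeq k).1 (lexSeq k).2 :=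
      { lower := LexStage.lower N k
        lower' := LexStage.lower N (k + 1)
        le := LexStage.mono (Nat.le_succ k)
        lt := fun e u h => .inl ⟨h, hr.mono (h.elim le_of_lt fun h => h.1.le)⟩
        cases := fun e u h hu => (hcases e u h hu).imp_left .inl
        mem := by
          refine ⟨?_, hr⟩
          simp only [lexSeq, lexNext]
          split_ifs
          · exact .inr ⟨rfl, Nat.lt_succ_self _⟩
          · exact .inl (Nat.lt_succ_self _)
        not_mem := by
          rintro (h | h)
          · have := h.1
            simp only [LexLt] at this
            omega
          · have := h3 h.1
            omega
        one_le := h1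
        range := fun e u h => h.2 }
    have hcells : ∃ (d : ℕ) (ι : Type),
        Nonempty (TreeCells (lexSeq k).1 (lexSeq k).2 d ι) := by
      rcases h1.eq_or_lt with h4 | h4
      · rw [h3 h4.symm, ← h4]
        exact ⟨_, _, nonempty_treeCells_one⟩
      · exact ⟨_, _, nonempty_treeCells h4⟩
    obtain ⟨d, ι, ⟨𝒞⟩⟩ := hcells
    exact ⟨ι, _, _, ⟨𝒞.attachment hst⟩⟩
  · have := isIso_truncIncl (N := N) (LexStage.mono (N := N) (Nat.le_succ k))
      fun e u h hu => .inl ((hcases e u h hu).resolve_right fun h4 => hr (h4.1 ▸ h.2))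
    exact freeAttachments_of_isIso _

/-- An operad that is isomorphic to the one generated by all prime trees whose type is in the range
is cofibrant. -/
lemma isCofibrant_of_iso {N : ℕ∞} (hN : InRange N 1) {S : ℕ → ℕ → Prop}
    (hS : ∀ e u, S e u ↔ InRange N e) {O : TopOperad N} (e : truncGen S N ≅ O) :
    O.IsCofibrant := by
  have hS' : ∀ e u, S e u ↔ ∃ k, LexStage N k e u := fun e u =>
    (hS e u).trans (exists_lexStage e u)
  have hl : LexLower S := fun e u e' u' h h' =>
    (hS _ _).2 (((hS _ _).1 h).mono (by omega))
  -- Before `(1, 1)` there are only the type `(1, 0)` of the identity and types with `e = 0`, so the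
  -- sequence starts with the initial operad.
  obtain ⟨hE⟩ := nonempty_isInitial (S := LexStage N 0) hN fun e u h hu => by
    have := h.1
    simp only [LexLt, lexSeq] at this
    omega
  refine ⟨_, hE, MorphismProperty.transfiniteCompositionsOfShape_le_transfiniteCompositions
    _ ℕ _ ⟨?_⟩⟩
  let c := stageCocone (LexStage.mono (N := N)) N hS'
  let F := stageFunctor (LexStage.mono (N := N)) N
  let ι : F ⟶ (Functor.const ℕ).obj O := c.ι ≫ (Functor.const ℕ).map e.hom
  have hc : Limits.IsColimit (Limits.Cocone.mk O ι) :=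
    Limits.IsColimit.ofIsoColimit (isColimitStageCocone (LexStage.mono (N := N)) hS'
      (LexStage.lower N) hl) (Limits.Cocone.ext e fun _ => rfl)
  exact
    { F := F
      isoBot := Iso.refl _
      incl := ι
      isColimit := hc
      fac := hE.hom_ext _ _
      map_mem := fun k _ => freeAttachments_lexStage N k }

/-! ### The cell structure of the filtration -/

lemma attachesCells_of_isStage {S S' : ℕ → ℕ → Prop} {n i d r : ℕ}
    (h : IsStage ⊤ S S' n i) (h𝒞 : Nonempty (TreeCells n i d (Fin r))) :
    AttachesCells (truncIncl h.le ⊤) r (deg (n - i)) d {x |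
      (Hom.app (truncGenι S' ⊤) (deg (n - i)) x : TreeSpace (n - i)) ∈
        primeTrees (fun e u => e = n ∧ u = i) (deg (n - i))} := by
  obtain ⟨𝒞⟩ := h𝒞
  exact ⟨𝒞.attachment h, 𝒞.openCells_attachment h⟩

theorem propositionp :
    -- the operad of metric trees is a cofibrant model of the associative operad
    treeOperad.IsCofibrantModel (TopOperad.assoc ⊤) ∧
    -- the truncated filtration terms are cofibrant models, contractible in degrees at most n
    (∀ n : ℕ, 1 ≤ n →
      ((treeFiltration n).truncate n le_top).IsCofibrantModel
        ((TopOperad.assoc ⊤).truncate n le_top) ∧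
      ∀ k : ℕ, k ≤ n → ContractibleSpace ((treeFiltration n).X (deg k))) ∧
    -- the explicit cell structure: the operad is the union of its filtration,
    -- which starts with the initial operad
    Nonempty (Limits.IsColimit treeFiltrationCocone) ∧
    Nonempty (Limits.IsInitial (treeFiltration 0)) ∧
    -- from the term 0 to the term 1: one cell of dimension 0 in degree 0
    TopOperad.AttachesCells (treeFiltrationMap (Nat.zero_le 1)) 1 (deg 0) 0
      {x | (treeFiltrationι 1).app _ x ∈ primeTrees (fun e u => e = 1 ∧ u = 1) (deg 0)} ∧
    -- from the term n - 1 to the term n: first, one cell of dimension n - 2 in degree n, then, for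
    -- i = 1, ..., n, choose n i cells of dimension n - 2 + i in degree n - i
    ∀ n : ℕ, 2 ≤ n →
      TopOperad.AttachesCells (treeFiltrationAuxStart (n - 1)) (n.choose 0) (deg n) (n - 2)
        {x | (treeFiltrationAuxι (n - 1) 0).app _ x ∈
          primeTrees (fun e u => e = n ∧ u = 0) (deg n)} ∧
      (∀ i : ℕ, i + 1 ≤ n →
        TopOperad.AttachesCells (treeFiltrationAuxStep (n - 1) i) (n.choose (i + 1))
          (deg (n - (i + 1))) (n - 2 + (i + 1))
          {x | (treeFiltrationAuxι (n - 1) (i + 1)).app _ x ∈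
            primeTrees (fun e u => e = n ∧ u = i + 1) (deg (n - (i + 1)))}) ∧
      IsIso (treeFiltrationAuxEnd (n - 1)) := by
  have hIn : ∀ e : ℕ, InRange ⊤ e := fun _ => le_top
  refine ⟨⟨?_, ?_⟩, fun n hn => ⟨⟨?_, ?_⟩, fun k hk => ?_⟩, ?_, ?_, ?_, fun n hn => ⟨?_, ?_, ?_⟩⟩
  · exact isCofibrant_of_iso le_top (fun e u => (iff_true_intro (hIn e)).symm)
      (truncGenIso (S := fun _ _ => True) fun _ _ => trivial)
  · exact exists_weakEquivalence_assoc treeOperad fun c =>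
      inferInstanceAs (ContractibleSpace (TreeSpace c.1))
  · exact isCofibrant_of_iso (N := n) (S := fun e _ => e ≤ n) (Nat.cast_le.2 hn)
      (fun e u => Nat.cast_le.symm) (Iso.refl _)
  · exact exists_weakEquivalence_assoc ((treeFiltration n).truncate n le_top) fun c =>
      contractibleSpace_treeFiltration hn (Nat.cast_le.1 c.2)
  · exact contractibleSpace_treeFiltration hn hk
  · have hm : ∀ ⦃k k' : ℕ⦄, k ≤ k' → ∀ e _ : ℕ, e ≤ k → e ≤ k' := fun _ _ h _ _ he => he.trans h
    have hl : ∀ k : ℕ, LexLower fun e _ => e ≤ k := fun k e u e' u' h h' => by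
      simp only at *
      omega
    exact ⟨Limits.IsColimit.ofIsoColimit (isColimitStageCocone (N := ⊤) hm
      (S' := fun _ _ => True) (fun e u => ⟨fun _ => ⟨e, le_rfl⟩, fun _ => trivial⟩) hl
      fun _ _ _ _ _ _ => trivial)
      (Limits.Cocone.ext (truncGenIso fun _ _ => trivial) fun _ => rfl)⟩
  · exact nonempty_isInitial (N := ⊤) le_top fun e u h _ => .inr (Nat.le_zero.1 h)
  -- From `e ≤ 0` to `e ≤ 1` only the type `(1, 1)` is added: `(1, 0)` is the identity, and `u ≤ e`.
  · refine attachesCells_of_isStage (n := 1) (i := 1) ?_ nonempty_treeCells_one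
    constructor <;> (try simp only [LexLower, LexLt, OrId, InRange, le_top, implies_true]) <;> omega
  · refine attachesCells_of_isStage (n := n) (i := 0) ?_ (nonempty_treeCells hn)
    constructor <;> (try simp only [LexLower, LexLt, OrId, InRange, le_top, implies_true]) <;> omega
  · intro i hi
    refine attachesCells_of_isStage (n := n) (i := i + 1) ?_ (nonempty_treeCells hn)
    constructor <;> (try simp only [LexLower, LexLt, OrId, InRange, le_top, implies_true]) <;> omega
  -- The condition `u ≤ n` is automatic for `e = n`, because `u ≤ e`.
  · refine isIso_truncIncl (N := ⊤) (S := fun e u => e ≤ n - 1 ∨ (e = n - 1 + 1 ∧ u ≤ n - 1 + 1))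
      (S' := fun e _ => e ≤ n - 1 + 1)
      (fun e u h => by omega) ?_
    simp only [OrId]
    omega
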